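/- Let $n\ge 2$ and let $\mathfrak g$ be a seaweed (biparabolic) subalgebra of $\mathfrak{sl}(n)=\mathfrak{sl}(n,\mathbb C)$, that is, $\mathfrak g=\mathfrak p\cap\mathfrak p'$ for two parabolic subalgebras $\mathfrak p,\mathfrak p'$ of $\mathfrak{sl}(n)$ with $\mathfrak p+\mathfrak p'=\mathfrak{sl}(n)$. For $F\in\mathfrak g^*$ let $B_F(x,y)=F([x,y])$ for $x,y\in\mathfrak g$, and suppose that $\mathfrak g$ is Frobenius, i.e. its index $\min_{F\in\mathfrak g^*}\dim\ker B_F$ is $0$. An element $\hat F\in\mathfrak g$ is called a principal element of $\mathfrak g$ if there is $F\in\mathfrak g^*$ with $B_F$ non-degenerate and $F([\hat F,-])=F$. Then the spectrum of $\mathfrak g$ is an unbroken set of integers centered at one half, and the multiplicities of the eigenvalues are symmetric about one half. Precisely: there is an integer $\lambda\ge 1$ such that, for every principal element $\hat F$ of $\mathfrak g$, the set of eigenvalues of $\mathrm{ad}\,\hat F:\mathfrak g\to\mathfrak g$ is $\{1-\lambda,2-\lambda,\dots,\lambda\}$, and for every integer $k$ the eigenspaces of $\mathrm{ad}\,\hat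 F$ for $k$ and for $1-k$ have the same dimension. -/

import Mathlib

namespace Seaweed

section General

variable {L : Type*} [LieRing L] [LieAlgebra ℂ L]

/-- A Borel subalgebra: a maximal solvable subalgebra. -/
def IsBorel (b : LieSubalgebra ℂ L) : Prop :=
  Maximal (fun s : LieSubalgebra ℂ L => LieAlgebra.IsSolvable s) b

/-- A parabolic subalgebra: a subalgebra that contains a Borel subalgebra. -/
def IsParabolic (p : LieSubalgebra ℂ L) : Prop :=
  ∃ b : LieSubalgebra ℂ L, IsBorel b ∧ b ≤ p

/-- A seaweed (biparabolic) subalgebra: the intersection of two parabolic subalgebras whose sum,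
as vector subspaces, is the whole Lie algebra. -/
def IsSeaweed (g : LieSubalgebra ℂ L) : Prop :=
  ∃ p p' : LieSubalgebra ℂ L, IsParabolic p ∧ IsParabolic p' ∧
    p.toSubmodule ⊔ p'.toSubmodule = ⊤ ∧ g = p ⊓ p'

/-- The Kirillov form `B_F (x, y) = F [x, y]` of a functional `F`. -/
def kirillovForm (F : Module.Dual ℂ L) : LinearMap.BilinForm ℂ L :=
  LinearMap.mk₂ ℂ (fun x y => F ⁅x, y⁆)
    (fun x x' y => by simp) (fun c x y => by simp)
    (fun x y y' => by simp) (fun c x y => by simp)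

variable (L) in
/-- The index of a finite-dimensional Lie algebra: the minimal dimension of the kernel of `B_F`,
where `F` ranges over all functionals. -/
noncomputable def index [FiniteDimensional ℂ L] : ℕ :=
  ⨅ F : Module.Dual ℂ L, Module.finrank ℂ (LinearMap.ker (kirillovForm F))

variable (L) in
/-- A Frobenius Lie algebra: one of index zero. -/
def IsFrobenius [FiniteDimensional ℂ L] : Prop :=
  index L = 0

/-- A Frobenius functional: one whose Kirillov form is nondegenerate. -/
def IsFrobeniusFunctional (F : Module.Dual ℂ L) : Prop :=
  (kirillovForm F).Nondegenerate

/-- `x` is a principal element: for some Frobenius functional `F`, the element `x` is the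
preimage of `F` under the isomorphism `x ↦ F [x, -]`. -/
def IsPrincipalElement (x : L) : Prop :=
  ∃ F : Module.Dual ℂ L, IsFrobeniusFunctional F ∧ kirillovForm F x = F

end General

end Seaweed

/-! By Lie's theorem a Borel subalgebra of `sl n` is the stabilizer of a flag, and two flags have a
common adapted basis. After a change of basis the seaweed therefore consists of the traceless
matrices supported on the pairs with `α i ≤ α j` and `β j ≤ β i`, for two block functions that never
order two indices in opposite ways (`IsSeaweed.exists_standard_form`). Adding the scalars turns the
Frobenius condition into "the kernel of the Kirillov form consists of the scalars" (`IndexOne`), a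
form suited to induction.

The symmetry is a duality: if `x` is principal for `F`, the adjoint of `ad x` for the Kirillov form
is `1 - ad x` (`finrank_eigenspace_symm`). The spectrum does not depend on `x`: along the complex
line joining two functionals the principal element is rational in the parameter and moves by `x' =
[x, z]`, so the traces of the powers of `ad x` are constant (`trace_ad_pow_eq`). It remains to find
one principal element with unbroken spectrum.

That element is built by reduction. Suppose that the first block `O` of `β` is properly contained in
the first block `O ∪ U` of `α`; otherwise transpose, while equality of the two blocks forces size
one. The matrices with rows in `U` and columns in `O` form an abelian ideal. A functional of index
one can be conjugated so that on this ideal it becomes a partial permutation matrix, which matches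
part of `O` with a set of rows `S ⊆ U` through a map `p` (`exists_reduction`). The orthogonal of the
ideal, modulo the ideal, is a smaller seaweed embedded by `inflate`, and index one passes in both
directions (`indexOne_rest`, `indexOne_of_rest`). A diagonal principal element `d'` of the smaller
algebra lifts to `d' ∘ p - 1` on `O` and `d'` elsewhere (`exists_extension`).

The eigenvalues are the differences `d i - d j` over related pairs. The invariant `Good` survives
the lifting (`Reduction.good`): values on a block form an interval, positive differences within a
block are realized by related pairs, values on different blocks of one kind can be linked with a
shift by one, and a block of `α` and a block of `β` share a value. A related pair always shares a
block of `α` or of `β`, so the differences fill `1, …, M`, and the symmetry supplies `1 - M, …, 0`.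
-/

set_option linter.unusedSectionVars false

namespace Seaweed

/-! ### Combinatorics of the reduction: values on the blocks of `α` -/

section Combinatorics

variable {ι : Type*} [DecidableEq ι]

/-- Properties of the values of `d` on the blocks of `α`, that is, on the fibres of `α` in `s`. -/
structure HalfGood (s : Finset ι) (α β : ι → ℕ) (d : ι → ℤ) : Prop where
  interval : ∀ i ∈ s, ∀ j ∈ s, α i = α j → ∀ v, d i ≤ v → v ≤ d j →
    ∃ l ∈ s, α l = α i ∧ d l = v
  -- The inequality for `β` makes `(i', j')` a related pair, so that `k` is an eigenvalue; `i` and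
  -- `j` themselves need not be related.
  diff : ∀ i ∈ s, ∀ j ∈ s, α i = α j → ∀ k, 1 ≤ k → k ≤ d i - d j →
    ∃ i' ∈ s, ∃ j' ∈ s, α i' = α i ∧ α j' = α i ∧ β j' ≤ β i' ∧ d i' - d j' = k
  shift : ∀ i ∈ s, ∀ j ∈ s, α j < α i →
    ∃ i' ∈ s, ∃ j' ∈ s, α i' = α i ∧ α j' = α j ∧ d i' = d j' - 1
  -- Serves to show, in `exists_extremes`, that the largest value on the image of `p` occurs on `S`.
  first : ∀ i ∈ s, ∀ u ∈ s, (∀ l ∈ s, α i ≤ α l ∧ β i ≤ β l) → α u = α i → β u ≠ β i →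
    ∃ j ∈ s, α j = α i ∧ β j ≠ β i ∧ d i ≤ d j

/-- The properties of the diagonal of a principal element that are preserved by reduction. -/
structure Good (s : Finset ι) (α β : ι → ℕ) (d : ι → ℤ) : Prop where
  left : HalfGood s α β d
  right : HalfGood s β α (fun i => -d i)
  cross : ∀ i ∈ s, ∀ j ∈ s, ∃ i' ∈ s, ∃ j' ∈ s, α i' = α i ∧ β j' = β j ∧ d i' = d j'

lemma Good.swap {s : Finset ι} {α β : ι → ℕ} {d : ι → ℤ} (h : Good s α β d) :
    Good s β α (fun i => -d i) where
  left := h.right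
  right := by simpa using h.left
  cross i hi j hj := by
    obtain ⟨i', hi', j', hj', h1, h2, h3⟩ := h.cross j hj i hi
    exact ⟨j', hj', i', hi', h2, h1, by rw [h3]⟩

/-- The data of a reduction step: `O` is the first block of `β`, properly contained in the first
block `O ∪ S ∪ K` of `α`, and `p` identifies part of `O` with `S`. -/
structure Reduction (s : Finset ι) (α β : ι → ℕ) (O S K : Finset ι) (p : ι → ι) (a b : ℕ) :
    Prop where
  comono : ∀ i ∈ s, ∀ j ∈ s, α i < α j → β i ≤ β j
  O_sub : O ⊆ s
  mem_O : ∀ i ∈ s, (i ∈ O ↔ β i = b)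
  β_min : ∀ i ∈ s, b ≤ β i
  α_min : ∀ i ∈ s, a ≤ α i
  α_O : ∀ i ∈ O, α i = a
  mem_SK : ∀ i, (i ∈ S ∨ i ∈ K) ↔ i ∈ s ∧ i ∉ O ∧ α i = a
  disj : ∀ i ∈ S, i ∉ K
  S_ne : S.Nonempty
  p_inj : ∀ i ∈ O, ∀ j ∈ O, p i = p j → i = j
  p_mem : ∀ j ∈ O, p j ∈ S ∨ p j = j
  p_surj : ∀ i ∈ S, ∃ j ∈ O, p j = i
  -- Either `S` is all that remains of the `α`-block and `p` may have fixed points, or `p` is a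
  -- bijection from `O` to `S` and `K` is left over.
  full : K = ∅ ∨ ∀ j ∈ O, p j ∈ S
  le : ∀ i ∈ K, ∀ j ∈ S, β i ≤ β j

/-- The index set that remains after a reduction step. -/
def rest (s O : Finset ι) (p : ι → ι) : Finset ι := s.filter fun i => i ∈ O → p i = i

/-- The block function after a reduction step: the image of `p` becomes a block. -/
def restBlock (α : ι → ℕ) (O : Finset ι) (p : ι → ι) (i : ι) : ℕ :=
  2 * α i + if i ∈ O.image p then 1 else 0

lemma mem_rest {s O : Finset ι} {p : ι → ι} {i : ι} :
    i ∈ rest s O p ↔ i ∈ s ∧ (i ∈ O → p i = i) := by simp [rest]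

namespace Reduction

variable {s : Finset ι} {α β : ι → ℕ} {O S K : Finset ι} {p : ι → ι} {a b : ℕ}

lemma S_sub (h : Reduction s α β O S K p a b) {i : ι} (hi : i ∈ S) : i ∈ s ∧ i ∉ O ∧ α i = a :=
  (h.mem_SK i).1 (Or.inl hi)

lemma K_sub (h : Reduction s α β O S K p a b) {i : ι} (hi : i ∈ K) : i ∈ s ∧ i ∉ O ∧ α i = a :=
  (h.mem_SK i).1 (Or.inr hi)

lemma p_mem_rest (h : Reduction s α β O S K p a b) {j : ι} (hj : j ∈ O) : p j ∈ rest s O p := by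
  rw [mem_rest]
  rcases h.p_mem j hj with h1 | h1
  · exact ⟨(h.S_sub h1).1, fun h2 => absurd h2 (h.S_sub h1).2.1⟩
  · rw [h1]; exact ⟨h.O_sub hj, fun _ => h1⟩

lemma α_p (h : Reduction s α β O S K p a b) {j : ι} (hj : j ∈ O) : α (p j) = a := by
  rcases h.p_mem j hj with h1 | h1
  · exact (h.S_sub h1).2.2
  · rw [h1]; exact h.α_O j hj

lemma restBlock_p (h : Reduction s α β O S K p a b) {j : ι} (hj : j ∈ O) :
    restBlock α O p (p j) = 2 * a + 1 := by
  rw [restBlock, h.α_p hj, if_pos (Finset.mem_image_of_mem p hj)]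

lemma p_notMem_K (h : Reduction s α β O S K p a b) {j : ι} (hj : j ∈ O) : p j ∉ K := by
  intro hk
  rcases h.p_mem j hj with h1 | h1
  · exact h.disj _ h1 hk
  · rw [h1] at hk; exact (h.K_sub hk).2.1 hj

lemma restBlock_K (h : Reduction s α β O S K p a b) {i : ι} (hi : i ∈ K) :
    restBlock α O p i = 2 * a := by
  rw [restBlock, (h.K_sub hi).2.2, if_neg, add_zero]
  intro h1
  obtain ⟨j, hj, rfl⟩ := Finset.mem_image.1 h1
  exact h.p_notMem_K hj hi

lemma mem_rest_of_notMem {i : ι} (hi : i ∈ s) (hO : i ∉ O) :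
    i ∈ rest s O p := mem_rest.2 ⟨hi, fun h1 => absurd h1 hO⟩

lemma cases_first (h : Reduction s α β O S K p a b) {i : ι} (hi : i ∈ rest s O p) (ha : α i = a) :
    (∃ j ∈ O, p j = i) ∨ i ∈ K := by
  rw [mem_rest] at hi
  by_cases hO : i ∈ O
  · exact Or.inl ⟨i, hO, hi.2 hO⟩
  · rcases (h.mem_SK i).2 ⟨hi.1, hO, ha⟩ with h1 | h1
    · exact Or.inl (h.p_surj i h1)
    · exact Or.inr h1

lemma restBlock_eq_odd (_h : Reduction s α β O S K p a b) {i : ι} (_hi : i ∈ rest s O p)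
    (ha : restBlock α O p i = 2 * a + 1) : ∃ j ∈ O, p j = i := by
  unfold restBlock at ha
  split_ifs at ha with h1
  · exact Finset.mem_image.1 h1
  · omega

lemma restBlock_eq_even (h : Reduction s α β O S K p a b) {i : ι} (hi : i ∈ rest s O p)
    (ha : restBlock α O p i = 2 * a) : i ∈ K := by
  unfold restBlock at ha
  split_ifs at ha with h1
  · omega
  · rcases h.cases_first hi (by omega) with ⟨j, hj, h2⟩ | h2
    · exact absurd (Finset.mem_image.2 ⟨j, hj, h2⟩) h1
    · exact h2

lemma restBlock_of_ne (h : Reduction s α β O S K p a b) {i : ι} (ha : α i ≠ a) :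
    restBlock α O p i = 2 * α i := by
  rw [restBlock, if_neg, add_zero]
  intro h1
  obtain ⟨j, hj, rfl⟩ := Finset.mem_image.1 h1
  exact ha (h.α_p hj)

lemma restBlock_eq_of_ne (h : Reduction s α β O S K p a b) {i j : ι} (ha : α i ≠ a) :
    restBlock α O p j = restBlock α O p i ↔ α j = α i := by
  rw [h.restBlock_of_ne ha]
  constructor
  · intro h1
    unfold restBlock at h1
    split_ifs at h1 <;> omega
  · intro h1
    rw [h.restBlock_of_ne (h1 ▸ ha), h1]

lemma restBlock_first (_h : Reduction s α β O S K p a b) {j : ι} :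
    restBlock α O p j ≤ 2 * a + 1 → α j ≤ a := by
  unfold restBlock
  split_ifs <;> omega

/-- The only new strict inequalities place `K` before the image of `p`. If `K` is nonempty, `full`
puts that image inside `S`, and `le` applies. -/
lemma comono_rest (h : Reduction s α β O S K p a b) : ∀ i ∈ rest s O p, ∀ j ∈ rest s O p,
    restBlock α O p i < restBlock α O p j → β i ≤ β j := by
  intro i hi j hj hij
  have his := (mem_rest.1 hi).1
  have hjs := (mem_rest.1 hj).1
  by_cases hlt : α i < α j
  · exact h.comono i his j hjs hlt
  have hY : i ∉ O.image p ∧ j ∈ O.image p ∧ α i = α j := by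
    unfold restBlock at hij
    split_ifs at hij with h1 h2 h2 <;> first | omega | exact ⟨h1, h2, by omega⟩
  obtain ⟨l, hl, rfl⟩ := Finset.mem_image.1 hY.2.1
  have hai : α i = a := by rw [hY.2.2, h.α_p hl]
  rcases h.cases_first hi hai with ⟨m, hm, h2⟩ | hK
  · exact absurd (Finset.mem_image.2 ⟨m, hm, h2⟩) hY.1
  · rcases h.full with h3 | h3
    · simp [h3] at hK
    · exact h.le i hK _ (h3 l hl)

variable {d d' : ι → ℤ}

/-- The extreme values of `d'` on the image of `p`; the maximum is attained on `S`. -/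
lemma exists_extremes (h : Reduction s α β O S K p a b)
    (hg : HalfGood (rest s O p) (restBlock α O p) β d') :
    ∃ y₀ ∈ O, ∃ y₁ ∈ S, (∀ j ∈ O, d' (p y₀) ≤ d' (p j) ∧ d' (p j) ≤ d' y₁) ∧
      ∀ v, d' (p y₀) ≤ v → v ≤ d' y₁ → ∃ j ∈ O, d' (p j) = v := by
  have hO : O.Nonempty := by
    obtain ⟨i, hi⟩ := h.S_ne
    obtain ⟨j, hj, -⟩ := h.p_surj i hi
    exact ⟨j, hj⟩
  obtain ⟨y₀, hy₀, hmin⟩ := O.exists_min_image (fun j => d' (p j)) hO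
  obtain ⟨z, hz, hmax⟩ := O.exists_max_image (fun j => d' (p j)) hO
  obtain ⟨y₁, hy₁, hle⟩ : ∃ y₁ ∈ S, d' (p z) ≤ d' y₁ := by
    rcases h.p_mem z hz with h1 | h1
    · exact ⟨_, h1, le_rfl⟩
    -- Here the maximum sits at a fixed point of `p` in `O`. Then `K` is empty, so the image of `p`
    -- is the first block of `restBlock`, and `z` also lies in the first block of `β`; `first` moves
    -- from there to `S` without lowering the value.
    · have hK : K = ∅ := by
        rcases h.full with h2 | h2
        · exact h2
        · have := h2 z hz
          rw [h1] at this
          exact absurd hz (h.S_sub this).2.1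
      have hzs := h.p_mem_rest hz
      obtain ⟨u, hu⟩ := h.S_ne
      have hus := h.S_sub hu
      obtain ⟨w, hw, hwu⟩ := h.p_surj u hu
      have hβ : β u ≠ b := fun h3 => hus.2.1 ((h.mem_O u hus.1).2 h3)
      have hβz : β (p z) = b := by rw [h1]; exact (h.mem_O z (h.O_sub hz)).1 hz
      obtain ⟨j, hj, h4, h5, h6⟩ := hg.first (p z) hzs u (mem_rest_of_notMem hus.1 hus.2.1)
        (by
          intro l hl
          have hls := (mem_rest.1 hl).1
          refine ⟨?_, hβz ▸ h.β_min l hls⟩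
          rw [h.restBlock_p hz]
          by_contra h7
          have h8 := h.α_min l hls
          have h9 : restBlock α O p l = 2 * a := by
            unfold restBlock at h7 ⊢
            split_ifs at h7 ⊢ <;> omega
          have := h.restBlock_eq_even hl h9
          simp [hK] at this)
        (by rw [h.restBlock_p hz, ← hwu, h.restBlock_p hw]) (by rw [hβz]; exact hβ)
      rw [h.restBlock_p hz] at h4
      obtain ⟨m, hm, rfl⟩ := h.restBlock_eq_odd hj h4
      rcases h.p_mem m hm with h7 | h7
      · exact ⟨_, h7, h6⟩
      · rw [h7, hβz] at h5
        exact absurd ((h.mem_O m (h.O_sub hm)).1 hm) h5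
  refine ⟨y₀, hy₀, y₁, hy₁, fun j hj => ⟨hmin j hj, (hmax j hj).trans hle⟩, ?_⟩
  intro v h1 h2
  obtain ⟨w, hw, rfl⟩ := h.p_surj y₁ hy₁
  obtain ⟨l, hl, h3, h4⟩ := hg.interval (p y₀) (h.p_mem_rest hy₀) (p w) (h.p_mem_rest hw)
    (by rw [h.restBlock_p hy₀, h.restBlock_p hw]) v h1 h2
  rw [h.restBlock_p hy₀] at h3
  obtain ⟨m, hm, rfl⟩ := h.restBlock_eq_odd hl h3
  exact ⟨m, hm, h4⟩

/-- Let `[P, Q]` be the range of `d'` on the image of `p`. Then `O` takes all values in `[P - 1, Q -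
1]`, and `S` has values in `[P, Q]`, among them `Q`. So the first block of `α` takes all of `[P - 1,
Q]`, together with an interval of values on `K` that meets or touches it. The other blocks of `α`
are unchanged. -/
theorem halfGood_left (h : Reduction s α β O S K p a b)
    (hg : HalfGood (rest s O p) (restBlock α O p) β d')
    (hd : ∀ i ∈ s, i ∉ O → d i = d' i) (hdO : ∀ j ∈ O, d j = d' (p j) - 1) :
    HalfGood s α β d := by
  obtain ⟨y₀, hy₀, y₁, hy₁, hbd, hex⟩ := h.exists_extremes hg
  have hy₁s := h.S_sub hy₁
  have hdy₁ := hd _ hy₁s.1 hy₁s.2.1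
  set P := d' (p y₀) with hP
  set Q := d' y₁ with hQ
  have hPQ : P ≤ Q := ((hbd y₀ hy₀).2)
  have hOval : ∀ v, P ≤ v → v ≤ Q → ∃ j ∈ O, d j = v - 1 := fun v h1 h2 => by
    obtain ⟨j, hj, h3⟩ := hex v h1 h2
    exact ⟨j, hj, by rw [hdO j hj, h3]⟩
  have hdK : ∀ k ∈ K, d k = d' k := fun k hk => hd k (h.K_sub hk).1 (h.K_sub hk).2.1
  have hKr : ∀ k ∈ K, k ∈ rest s O p := fun k hk =>
    mem_rest_of_notMem (h.K_sub hk).1 (h.K_sub hk).2.1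
  -- `K` precedes the image of `p` in the new block order, so `shift` links their values and
  -- excludes a gap.
  have hK0 : ∀ k ∈ K, ∃ k₀ ∈ K, P ≤ d k₀ - 1 ∧ d k₀ - 1 ≤ Q := by
    intro k hk
    obtain ⟨i', hi', j', hj', h1, h2, h3⟩ := hg.shift (p y₀) (h.p_mem_rest hy₀) k (hKr k hk)
      (by rw [h.restBlock_p hy₀, h.restBlock_K hk]; omega)
    rw [h.restBlock_p hy₀] at h1
    rw [h.restBlock_K hk] at h2
    obtain ⟨m, hm, rfl⟩ := h.restBlock_eq_odd hi' h1
    have hk' := h.restBlock_eq_even hj' h2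
    refine ⟨j', hk', ?_⟩
    rw [hdK _ hk', ← h3]
    exact hbd m hm
  have hKint : ∀ k ∈ K, ∀ k' ∈ K, ∀ v, d k ≤ v → v ≤ d k' → ∃ l ∈ K, d l = v := by
    intro k hk k' hk' v h1 h2
    obtain ⟨l, hl, h3, h4⟩ := hg.interval k (hKr k hk) k' (hKr k' hk')
      (by rw [h.restBlock_K hk, h.restBlock_K hk']) v (by rwa [← hdK k hk]) (by rwa [← hdK k' hk'])
    rw [h.restBlock_K hk] at h3
    have := h.restBlock_eq_even hl h3
    exact ⟨l, this, by rw [hdK l this, h4]⟩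
  have hval : ∀ i ∈ s, α i = a → (P - 1 ≤ d i ∧ d i ≤ Q) ∨ i ∈ K := by
    intro i hi hai
    by_cases hO : i ∈ O
    · left
      rw [hdO i hO]
      have := hbd i hO
      omega
    · rcases (h.mem_SK i).2 ⟨hi, hO, hai⟩ with h1 | h1
      · left
        obtain ⟨j, hj, rfl⟩ := h.p_surj i h1
        rw [hd _ hi hO]
        have := hbd j hj
        omega
      · exact Or.inr h1
  have hZ : ∀ v, P - 1 ≤ v → v ≤ Q → ∃ l ∈ s, α l = a ∧ d l = v := by
    intro v h1 h2
    by_cases h3 : v = Q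
    · exact ⟨y₁, hy₁s.1, hy₁s.2.2, by rw [hdy₁, h3]⟩
    · obtain ⟨j, hj, h4⟩ := hOval (v + 1) (by omega) (by omega)
      exact ⟨j, h.O_sub hj, h.α_O j hj, by omega⟩
  have hKs : ∀ k ∈ K, k ∈ s ∧ α k = a := fun k hk => ⟨(h.K_sub hk).1, (h.K_sub hk).2.2⟩
  have hβO : ∀ j ∈ O, ∀ i ∈ s, β j ≤ β i := fun j hj i hi => by
    rw [(h.mem_O j (h.O_sub hj)).1 hj]; exact h.β_min i hi
  constructor
  · intro i hi j hj hij v h1 h2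
    by_cases hai : α i = a
    · rw [hai]
      have haj : α j = a := by rw [← hij, hai]
      rcases hval i hi hai with hi1 | hi1 <;> rcases hval j hj haj with hj1 | hj1
      · exact hZ v (by omega) (by omega)
      · by_cases h3 : v ≤ Q
        · exact hZ v (by omega) h3
        · obtain ⟨k₀, hk₀, h4, h5⟩ := hK0 j hj1
          obtain ⟨l, hl, h6⟩ := hKint k₀ hk₀ j hj1 v (by omega) h2
          exact ⟨l, (hKs l hl).1, (hKs l hl).2, h6⟩
      · by_cases h3 : P - 1 ≤ v
        · exact hZ v h3 (by omega)
        · obtain ⟨k₀, hk₀, h4, h5⟩ := hK0 i hi1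
          obtain ⟨l, hl, h6⟩ := hKint i hi1 k₀ hk₀ v h1 (by omega)
          exact ⟨l, (hKs l hl).1, (hKs l hl).2, h6⟩
      · obtain ⟨l, hl, h6⟩ := hKint i hi1 j hj1 v h1 h2
        exact ⟨l, (hKs l hl).1, (hKs l hl).2, h6⟩
    · have hiO : i ∉ O := fun h3 => hai (h.α_O i h3)
      have hjO : j ∉ O := fun h3 => hai (hij.trans (h.α_O j h3))
      obtain ⟨l, hl, h3, h4⟩ := hg.interval i (mem_rest_of_notMem hi hiO) j
        (mem_rest_of_notMem hj hjO) ((h.restBlock_eq_of_ne (hij ▸ hai)).2 hij) v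
        (by rwa [← hd i hi hiO]) (by rwa [← hd j hj hjO])
      have hl3 := (h.restBlock_eq_of_ne hai).1 h3
      have hlO : l ∉ O := fun h5 => hai (hl3 ▸ h.α_O l h5)
      exact ⟨l, (mem_rest.1 hl).1, hl3, by rw [hd l (mem_rest.1 hl).1 hlO, h4]⟩
  · intro i hi j hj hij k h1 h2
    by_cases hai : α i = a
    · rw [hai]
      have haj : α j = a := by rw [← hij, hai]
      -- Short differences run from `y₁`, of value `Q`, into `O`, where `β` is minimal.
      have hE1 : k ≤ Q - P + 1 → ∃ i' ∈ s, ∃ j' ∈ s, α i' = a ∧ α j' = a ∧ β j' ≤ β i' ∧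
          d i' - d j' = k := by
        intro h3
        obtain ⟨l, hl, h4⟩ := hOval (Q + 1 - k) (by omega) (by omega)
        exact ⟨y₁, hy₁s.1, l, h.O_sub hl, hy₁s.2.2, h.α_O l hl, hβO l hl _ hy₁s.1, by omega⟩
      by_cases hE : k ≤ Q - P + 1
      · exact hE1 hE
      -- A longer difference involves `K`. Pairs from `S` to `K` and from `K` to `O` are always
      -- related, by `le` and by minimality of `β` on `O`, so only the value has to be matched;
      -- within `K` the smaller index set provides the pair.
      rcases hval i hi hai with hi1 | hi1 <;> rcases hval j hj haj with hj1 | hj1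
      · exact hE1 (by omega)
      · obtain ⟨k₀, hk₀, h4, h5⟩ := hK0 j hj1
        obtain ⟨l, hl, h6⟩ := hKint j hj1 k₀ hk₀ (Q - k) (by omega) (by omega)
        exact ⟨y₁, hy₁s.1, l, (hKs l hl).1, hy₁s.2.2, (hKs l hl).2, h.le l hl y₁ hy₁, by omega⟩
      · obtain ⟨k₀, hk₀, h4, h5⟩ := hK0 i hi1
        by_cases h3 : k + Q - 1 ≤ d i
        · obtain ⟨l, hl, h6⟩ := hKint k₀ hk₀ i hi1 (k + Q - 1) (by omega) (by omega)
          obtain ⟨m, hm, h7⟩ := hOval Q (by omega) (by omega)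
          exact ⟨l, (hKs l hl).1, m, h.O_sub hm, (hKs l hl).2, h.α_O m hm, hβO m hm _ (hKs l hl).1,
            by omega⟩
        · obtain ⟨m, hm, h7⟩ := hOval (d i - k + 1) (by omega) (by omega)
          exact ⟨i, hi, m, h.O_sub hm, hai, h.α_O m hm, hβO m hm _ hi, by omega⟩
      · obtain ⟨i', hi', j', hj', h3, h4, h5, h6⟩ := hg.diff i (hKr i hi1) j (hKr j hj1)
          (by rw [h.restBlock_K hi1, h.restBlock_K hj1]) k h1
          (by rw [← hdK i hi1, ← hdK j hj1]; exact h2)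
        rw [h.restBlock_K hi1] at h3 h4
        have hi'K := h.restBlock_eq_even hi' h3
        have hj'K := h.restBlock_eq_even hj' h4
        exact ⟨i', (hKs _ hi'K).1, j', (hKs _ hj'K).1, (hKs _ hi'K).2, (hKs _ hj'K).2, h5,
          by rw [hdK _ hi'K, hdK _ hj'K, h6]⟩
    · have hiO : i ∉ O := fun h3 => hai (h.α_O i h3)
      have hjO : j ∉ O := fun h3 => hai (hij.trans (h.α_O j h3))
      obtain ⟨i', hi', j', hj', h3, h4, h5, h6⟩ := hg.diff i (mem_rest_of_notMem hi hiO) j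
        (mem_rest_of_notMem hj hjO) ((h.restBlock_eq_of_ne (hij ▸ hai)).2 hij) k h1
        (by rwa [← hd i hi hiO, ← hd j hj hjO])
      have h3' := (h.restBlock_eq_of_ne hai).1 h3
      have h4' := (h.restBlock_eq_of_ne hai).1 h4
      have hi'O : i' ∉ O := fun h5 => hai (h3' ▸ h.α_O i' h5)
      have hj'O : j' ∉ O := fun h5 => hai (h4' ▸ h.α_O j' h5)
      exact ⟨i', (mem_rest.1 hi').1, j', (mem_rest.1 hj').1, h3', h4', h5,
        by rw [hd _ (mem_rest.1 hi').1 hi'O, hd _ (mem_rest.1 hj').1 hj'O, h6]⟩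
  · intro i hi j hj hji
    have hja := h.α_min j hj
    have hai : α i ≠ a := by omega
    have hiO : i ∉ O := fun h3 => hai (h.α_O i h3)
    have key : ∀ i' ∈ rest s O p, restBlock α O p i' = restBlock α O p i →
        i' ∈ s ∧ α i' = α i ∧ d i' = d' i' := by
      intro i' hi' h1
      have h1' := (h.restBlock_eq_of_ne hai).1 h1
      have hi'O : i' ∉ O := fun h5 => hai (h1' ▸ h.α_O i' h5)
      exact ⟨(mem_rest.1 hi').1, h1', hd _ (mem_rest.1 hi').1 hi'O⟩
    by_cases haj : α j = a
    · obtain ⟨i', hi', j', hj', h1, h2, h3⟩ := hg.shift i (mem_rest_of_notMem hi hiO) (p y₀)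
        (h.p_mem_rest hy₀) (by rw [h.restBlock_p hy₀, h.restBlock_of_ne hai]; omega)
      rw [h.restBlock_p hy₀] at h2
      obtain ⟨m, hm, rfl⟩ := h.restBlock_eq_odd hj' h2
      have hb := hbd m hm
      obtain ⟨l, hl, h4, h5⟩ := hZ (d' (p m)) (by omega) (by omega)
      obtain ⟨h6, h7, h8⟩ := key i' hi' h1
      exact ⟨i', h6, l, hl, h7, by rw [h4, haj], by omega⟩
    · have hjO : j ∉ O := fun h3 => haj (h.α_O j h3)
      obtain ⟨i', hi', j', hj', h1, h2, h3⟩ := hg.shift i (mem_rest_of_notMem hi hiO) j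
        (mem_rest_of_notMem hj hjO)
        (by rw [h.restBlock_of_ne haj, h.restBlock_of_ne hai]; omega)
      obtain ⟨h6, h7, h8⟩ := key i' hi' h1
      have h2' := (h.restBlock_eq_of_ne haj).1 h2
      have hj'O : j' ∉ O := fun h5 => haj (h2' ▸ h.α_O j' h5)
      exact ⟨i', h6, j', (mem_rest.1 hj').1, h7, h2',
        by rw [h8, hd _ (mem_rest.1 hj').1 hj'O, h3]⟩
  · intro i hi u hu hmin hui hβ
    have hai : α i = a := le_antisymm
      (by rw [← h.α_O y₀ hy₀]; exact (hmin y₀ (h.O_sub hy₀)).1) (h.α_min i hi)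
    have hβi : β i = b := le_antisymm
      (by rw [← (h.mem_O y₀ (h.O_sub hy₀)).1 hy₀]; exact (hmin y₀ (h.O_sub hy₀)).2) (h.β_min i hi)
    have hiO := (h.mem_O i hi).2 hβi
    refine ⟨y₁, hy₁s.1, by rw [hy₁s.2.2, hai], ?_, ?_⟩
    · rw [hβi]
      exact fun h1 => hy₁s.2.1 ((h.mem_O y₁ hy₁s.1).2 h1)
    · rw [hdO i hiO, hdy₁]
      have := hbd i hiO
      omega

end Reduction

end Combinatorics

/-! ### Combinatorics of the reduction: blocks of `β` and the full invariant -/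

section Combinatorics

variable {ι : Type*} [DecidableEq ι]

namespace Reduction

variable {s : Finset ι} {α β : ι → ℕ} {O S K : Finset ι} {p : ι → ι} {a b : ℕ} {d d' : ι → ℤ}

lemma β_ne (h : Reduction s α β O S K p a b) {i : ι} (hi : i ∈ s) (hO : i ∉ O) : β i ≠ b :=
  fun h1 => hO ((h.mem_O i hi).2 h1)

lemma notMem_of_β_eq (h : Reduction s α β O S K p a b) {i j : ι} (hi : i ∈ s) (hO : i ∉ O)
    (hj : j ∈ rest s O p) (hij : β j = β i) : j ∈ s ∧ j ∉ O :=
  ⟨(mem_rest.1 hj).1, fun h1 =>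
    h.β_ne hi hO (hij ▸ (h.mem_O j (mem_rest.1 hj).1).1 h1)⟩

/-- The blocks of `β` other than `O` are untouched, and `O` carries a translate of an interval.
Lowering by one on `O` exchanges two conditions: `cross` for the smaller data gives `shift` between
`O` and the other blocks of `β`, and `shift` for the smaller data gives `cross` between `O` and the
later blocks of `α`. -/
theorem good (h : Reduction s α β O S K p a b)
    (hg : Good (rest s O p) (restBlock α O p) β d')
    (hd : ∀ i ∈ s, i ∉ O → d i = d' i) (hdO : ∀ j ∈ O, d j = d' (p j) - 1) :
    Good s α β d := by
  obtain ⟨y₀, hy₀, y₁, hy₁, hbd, hex⟩ := h.exists_extremes hg.left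
  have hy₁s := h.S_sub hy₁
  have hβO : ∀ j ∈ O, β j = b := fun j hj => (h.mem_O j (h.O_sub hj)).1 hj
  have hrest : ∀ i ∈ s, i ∉ O → i ∈ rest s O p := fun i hi hO => mem_rest_of_notMem hi hO
  have hOint : ∀ i ∈ O, ∀ j ∈ O, ∀ v, d i ≤ v → v ≤ d j → ∃ l ∈ O, d l = v := by
    intro i hi j hj v h1 h2
    rw [hdO i hi] at h1
    rw [hdO j hj] at h2
    have h3 := hbd i hi
    have h4 := hbd j hj
    obtain ⟨m, hm, h5⟩ := hex (v + 1) (by omega) (by omega)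
    exact ⟨m, hm, by rw [hdO m hm]; omega⟩
  refine ⟨h.halfGood_left hg.left hd hdO, ⟨?_, ?_, ?_, ?_⟩, ?_⟩
  · intro i hi j hj hij v h1 h2
    by_cases hO : i ∈ O
    · have hjO : j ∈ O := (h.mem_O j hj).2 (by rw [← hij, hβO i hO])
      obtain ⟨l, hl, h3⟩ := hOint j hjO i hO (-v) (by omega) (by omega)
      exact ⟨l, h.O_sub hl, by rw [hβO l hl, hβO i hO], by omega⟩
    · have hjO : j ∉ O := fun h3 => h.β_ne hi hO (hij.trans (hβO j h3))
      obtain ⟨l, hl, h3, h4⟩ := hg.right.interval i (hrest i hi hO) j (hrest j hj hjO) hij v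
        (by simpa only [hd i hi hO] using h1) (by simpa only [hd j hj hjO] using h2)
      obtain ⟨h5, h6⟩ := h.notMem_of_β_eq hi hO hl h3
      exact ⟨l, h5, h3, by rw [← h4, hd l h5 h6]⟩
  · intro i hi j hj hij k h1 h2
    by_cases hO : i ∈ O
    · have hjO : j ∈ O := (h.mem_O j hj).2 (by rw [← hij, hβO i hO])
      obtain ⟨l, hl, h3⟩ := hOint i hO j hjO (d j - k) (by omega) (by omega)
      exact ⟨l, h.O_sub hl, j, hj, by rw [hβO l hl, hβO i hO], hij.symm,
        by rw [h.α_O l hl, h.α_O j hjO], by omega⟩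
    · have hjO : j ∉ O := fun h3 => h.β_ne hi hO (hij.trans (hβO j h3))
      obtain ⟨i', hi', j', hj', h3, h4, h5, h6⟩ := hg.right.diff i (hrest i hi hO) j
        (hrest j hj hjO) hij k h1 (by simpa only [hd i hi hO, hd j hj hjO] using h2)
      obtain ⟨hi1, hi2⟩ := h.notMem_of_β_eq hi hO hi' h3
      obtain ⟨hj1, hj2⟩ := h.notMem_of_β_eq hi hO hj' h4
      refine ⟨i', hi1, j', hj1, h3, h4, ?_, by rw [← h6, hd _ hi1 hi2, hd _ hj1 hj2]⟩
      unfold restBlock at h5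
      split_ifs at h5 <;> omega
  · intro i hi j hj hji
    have hO : i ∉ O := fun h1 => by
      have := h.β_min j hj
      have := hβO i h1
      omega
    by_cases hjO : j ∈ O
    · obtain ⟨m, hm, i', hi', h1, h2, h3⟩ := hg.cross (p y₀) (h.p_mem_rest hy₀) i (hrest i hi hO)
      rw [h.restBlock_p hy₀] at h1
      obtain ⟨l, hl, rfl⟩ := h.restBlock_eq_odd hm h1
      obtain ⟨hi1, hi2⟩ := h.notMem_of_β_eq hi hO hi' h2
      exact ⟨i', hi1, l, h.O_sub hl, h2, by rw [hβO l hl, hβO j hjO],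
        by rw [hd _ hi1 hi2, hdO l hl, h3]; ring⟩
    · obtain ⟨i', hi', j', hj', h1, h2, h3⟩ := hg.right.shift i (hrest i hi hO) j
        (hrest j hj hjO) hji
      obtain ⟨hi1, hi2⟩ := h.notMem_of_β_eq hi hO hi' h1
      obtain ⟨hj1, hj2⟩ := h.notMem_of_β_eq hj hjO hj' h2
      exact ⟨i', hi1, j', hj1, h1, h2, by rw [hd _ hi1 hi2, hd _ hj1 hj2, h3]⟩
  · intro i hi u hu hmin hui hα
    have hβi : β i = b := le_antisymm
      (by rw [← hβO y₀ hy₀]; exact (hmin y₀ (h.O_sub hy₀)).1) (h.β_min i hi)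
    have hiO := (h.mem_O i hi).2 hβi
    have huO := (h.mem_O u hu).2 (hui.trans hβi)
    exact absurd (by rw [h.α_O i hiO, h.α_O u huO]) hα
  · intro i hi j hj
    by_cases hai : α i = a
    · by_cases hjO : j ∈ O
      · exact ⟨j, hj, j, hj, by rw [hai, h.α_O j hjO], rfl, rfl⟩
      · obtain ⟨m, hm, j', hj', h1, h2, h3⟩ := hg.cross (p y₀) (h.p_mem_rest hy₀) j
          (hrest j hj hjO)
        rw [h.restBlock_p hy₀] at h1
        obtain ⟨l, hl, rfl⟩ := h.restBlock_eq_odd hm h1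
        obtain ⟨hj1, hj2⟩ := h.notMem_of_β_eq hj hjO hj' h2
        have hb := hbd l hl
        -- The value `d' (p l)` has to occur in the first block of `α`: the maximum occurs on `S`,
        -- and any smaller value on `O`, as its successor is a value of `d' ∘ p`.
        by_cases hq : d' (p l) = d' y₁
        · exact ⟨y₁, hy₁s.1, j', hj1, by rw [hy₁s.2.2, hai], h2,
            by rw [hd _ hy₁s.1 hy₁s.2.1, hd _ hj1 hj2, ← h3, hq]⟩
        · obtain ⟨m, hm, h5⟩ := hex (d' (p l) + 1) (by omega) (by omega)
          exact ⟨m, h.O_sub hm, j', hj1, by rw [h.α_O m hm, hai], h2,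
            by rw [hdO m hm, hd _ hj1 hj2, ← h3, h5]; ring⟩
    · have hiO : i ∉ O := fun h3 => hai (h.α_O i h3)
      have hα := h.α_min i hi
      by_cases hjO : j ∈ O
      · obtain ⟨i', hi', m, hm, h1, h2, h3⟩ := hg.left.shift i (hrest i hi hiO) (p y₀)
          (h.p_mem_rest hy₀) (by rw [h.restBlock_p hy₀, h.restBlock_of_ne hai]; omega)
        rw [h.restBlock_p hy₀] at h2
        obtain ⟨l, hl, rfl⟩ := h.restBlock_eq_odd hm h2
        have h1' := (h.restBlock_eq_of_ne hai).1 h1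
        have hi'O : i' ∉ O := fun h5 => hai (h1' ▸ h.α_O i' h5)
        exact ⟨i', (mem_rest.1 hi').1, l, h.O_sub hl, h1', by rw [hβO l hl, hβO j hjO],
          by rw [hd _ (mem_rest.1 hi').1 hi'O, hdO l hl, h3]⟩
      · obtain ⟨i', hi', j', hj', h1, h2, h3⟩ := hg.cross i (hrest i hi hiO) j (hrest j hj hjO)
        have h1' := (h.restBlock_eq_of_ne hai).1 h1
        have hi'O : i' ∉ O := fun h5 => hai (h1' ▸ h.α_O i' h5)
        obtain ⟨hj1, hj2⟩ := h.notMem_of_β_eq hj hjO hj' h2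
        exact ⟨i', (mem_rest.1 hi').1, j', hj1, h1', h2,
          by rw [hd _ (mem_rest.1 hi').1 hi'O, hd _ hj1 hj2, h3]⟩

end Reduction

end Combinatorics

/-! ### Algebras of supported matrices and the abelian ideal of a reduction step -/

section Supported

variable {ι : Type*}

/-- The relation on `s` whose matrix units span the seaweed algebra given by the block functions
`α` and `β`. -/
def seaweedRel (s : Finset ι) (α β : ι → ℕ) (i j : ι) : Prop :=
  i ∈ s ∧ j ∈ s ∧ α i ≤ α j ∧ β j ≤ β i

/-- The matrices whose entries vanish outside of the relation `R`. -/
def supported (R : ι → ι → Prop) : Submodule ℂ (Matrix ι ι ℂ) where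
  carrier := {x | ∀ i j, ¬ R i j → x i j = 0}
  add_mem' := fun {x y} hx hy i j h => by simp [hx i j h, hy i j h]
  zero_mem' := fun _ _ _ => rfl
  smul_mem' := fun c x hx i j h => by simp [hx i j h]

lemma mem_supported {R : ι → ι → Prop} {x : Matrix ι ι ℂ} :
    x ∈ supported R ↔ ∀ i j, ¬ R i j → x i j = 0 := Iff.rfl

lemma rel_of_ne_zero {R : ι → ι → Prop} {x : Matrix ι ι ℂ} (hx : x ∈ supported R) {i j : ι}
    (h : x i j ≠ 0) : R i j := by
  by_contra h1
  exact h (hx i j h1)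

variable [DecidableEq ι]

lemma single_mem_supported {R : ι → ι → Prop} {i j : ι} (h : R i j) (c : ℂ) :
    Matrix.single i j c ∈ supported R := by
  intro k l hkl
  rw [Matrix.single_apply, if_neg]
  rintro ⟨rfl, rfl⟩
  exact hkl h

variable [Fintype ι]

lemma mul_mem_supported {R : ι → ι → Prop} (hR : ∀ i j k, R i j → R j k → R i k)
    {x y : Matrix ι ι ℂ} (hx : x ∈ supported R) (hy : y ∈ supported R) : x * y ∈ supported R := by
  intro i k hik
  rw [Matrix.mul_apply]
  refine Finset.sum_eq_zero fun j _ => ?_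
  by_contra h
  exact hik (hR i j k (rel_of_ne_zero hx (left_ne_zero_of_mul h))
    (rel_of_ne_zero hy (right_ne_zero_of_mul h)))

lemma seaweedRel_trans {s : Finset ι} {α β : ι → ℕ} (i j k : ι) :
    seaweedRel s α β i j → seaweedRel s α β j k → seaweedRel s α β i k :=
  fun h1 h2 => ⟨h1.1, h2.2.1, h1.2.2.1.trans h2.2.2.1, h2.2.2.2.trans h1.2.2.2⟩

/-- The matrices supported on `R`, as a Lie algebra, have index one, as witnessed by `F`: the kernel
of the Kirillov form of `F` consists of the scalars. -/
def IndexOne (R : ι → ι → Prop) (F : Matrix ι ι ℂ →ₗ[ℂ] ℂ) : Prop :=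
  ∀ x ∈ supported R, (∀ y ∈ supported R, F (x * y - y * x) = 0) →
    (∀ i j, i ≠ j → x i j = 0) ∧ ∀ i j, R i i → R j j → x i i = x j j

/-- The diagonal matrix `d` is a principal element for `F`. -/
def IsPrincipalDiagonal (R : ι → ι → Prop) (F : Matrix ι ι ℂ →ₗ[ℂ] ℂ) (d : ι → ℤ) : Prop :=
  ∀ y ∈ supported R, F (Matrix.diagonal (fun i => (d i : ℂ)) * y -
    y * Matrix.diagonal (fun i => (d i : ℂ))) = F y

lemma commute_of_scalar {R : ι → ι → Prop} (hl : ∀ i j, R i j → R i i)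
    (hr : ∀ i j, R i j → R j j) {z y : Matrix ι ι ℂ} (hy : y ∈ supported R)
    (h1 : ∀ i j, i ≠ j → z i j = 0) (h2 : ∀ i j, R i i → R j j → z i i = z j j) :
    z * y - y * z = 0 := by
  ext i j
  rw [Matrix.sub_apply, Matrix.mul_apply, Matrix.mul_apply,
    Finset.sum_eq_single i (fun k _ hk => by rw [h1 i k hk.symm, zero_mul])
      (by simp),
    Finset.sum_eq_single j (fun k _ hk => by rw [h1 k j hk, mul_zero]) (by simp)]
  by_cases h : R i j
  · rw [h2 i j (hl i j h) (hr i j h)]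
    simp [mul_comm]
  · simp [hy i j h]

lemma apply_mul_single (F : Matrix ι ι ℂ →ₗ[ℂ] ℂ) (x : Matrix ι ι ℂ) (i j : ι) :
    F (x * Matrix.single i j 1) = ∑ k, x k i * F (Matrix.single k j 1) := by
  have : x * Matrix.single i j 1 = ∑ k, x k i • Matrix.single k j (1 : ℂ) := by
    ext k l
    simp only [Matrix.mul_apply, Matrix.sum_apply, Matrix.smul_apply, Matrix.single_apply,
      smul_eq_mul]
    by_cases hl : j = l <;> simp [hl]
  rw [this]
  simp only [map_sum, map_smul, smul_eq_mul]

lemma apply_single_mul (F : Matrix ι ι ℂ →ₗ[ℂ] ℂ) (x : Matrix ι ι ℂ) (i j : ι) :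
    F (Matrix.single i j 1 * x) = ∑ l, x j l * F (Matrix.single i l 1) := by
  have : Matrix.single i j 1 * x = ∑ l, x j l • Matrix.single i l (1 : ℂ) := by
    ext k l
    simp only [Matrix.mul_apply, Matrix.sum_apply, Matrix.smul_apply, Matrix.single_apply,
      smul_eq_mul]
    by_cases hl : i = k <;> simp [hl]
  rw [this]
  simp only [map_sum, map_smul, smul_eq_mul]

/-- The map from matrices on the remaining index set to matrices on the original one, given by
copying along `p`. -/
def inflate (O : Finset ι) (p : ι → ι) : Matrix ι ι ℂ →ₗ[ℂ] Matrix ι ι ℂ where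
  toFun x := Matrix.of fun i j =>
    if i ∈ O ∧ j ∈ O then x (p i) (p j) else if i ∈ O ∨ j ∈ O then 0 else x i j
  map_add' x y := by
    ext i j
    simp only [Matrix.of_apply, Matrix.add_apply]
    split_ifs <;> simp
  map_smul' c x := by
    ext i j
    simp only [Matrix.of_apply, Matrix.smul_apply, RingHom.id_apply]
    split_ifs <;> simp

lemma inflate_apply (O : Finset ι) (p : ι → ι) (x : Matrix ι ι ℂ) (i j : ι) :
    inflate O p x i j =
      if i ∈ O ∧ j ∈ O then x (p i) (p j) else if i ∈ O ∨ j ∈ O then 0 else x i j := rfl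

namespace Reduction

variable {s : Finset ι} {α β : ι → ℕ} {O S K : Finset ι} {p : ι → ι} {a b : ℕ}

/-- `F` takes the standard values on the abelian ideal of the reduction step. -/
def IsNormal (O S K : Finset ι) (p : ι → ι) (F : Matrix ι ι ℂ →ₗ[ℂ] ℂ) : Prop :=
  ∀ i, (i ∈ S ∨ i ∈ K) → ∀ j ∈ O, F (Matrix.single i j 1) = if p j = i then 1 else 0

/-- The condition that describes the orthogonal of the abelian ideal under a normal functional. -/
def IsPerp (O S K : Finset ι) (p : ι → ι) (x : Matrix ι ι ℂ) : Prop :=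
  ∀ i, (i ∈ S ∨ i ∈ K) → ∀ j ∈ O, x (p j) i = ∑ l ∈ O, if p l = i then x j l else 0

lemma rel_O (h : Reduction s α β O S K p a b) {i j : ι} (hij : seaweedRel s α β i j)
    (hi : i ∈ O) : j ∈ O := by
  rw [h.mem_O j hij.2.1]
  have h1 := (h.mem_O i hij.1).1 hi
  have h2 := h.β_min j hij.2.1
  have h3 := hij.2.2.2
  omega

lemma rel_to_O (h : Reduction s α β O S K p a b) {i j : ι} (hij : seaweedRel s α β i j)
    (hj : j ∈ O) (hi : i ∉ O) : i ∈ S ∨ i ∈ K := by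
  rw [h.mem_SK]
  have h1 := h.α_O j hj
  have h2 := h.α_min i hij.1
  have h3 := hij.2.2.1
  exact ⟨hij.1, hi, by omega⟩

lemma rel_of_mem_O (h : Reduction s α β O S K p a b) {i j : ι} (hi : i ∈ s) (hia : α i = a)
    (hj : j ∈ O) : seaweedRel s α β i j :=
  ⟨hi, h.O_sub hj, by rw [hia, h.α_O j hj], by
    rw [(h.mem_O j (h.O_sub hj)).1 hj]; exact h.β_min i hi⟩

lemma rel_SK (h : Reduction s α β O S K p a b) {i j : ι} (hij : seaweedRel s α β i j)
    (hj : j ∈ S ∨ j ∈ K) : i ∈ S ∨ i ∈ K := by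
  rw [h.mem_SK] at hj ⊢
  have h2 := h.α_min i hij.1
  have h3 := hij.2.2.1
  exact ⟨hij.1, fun hi => hj.2.1 (h.rel_O hij hi), by omega⟩

lemma rel_of_rest {i j : ι}
    (hij : seaweedRel (rest s O p) (restBlock α O p) β i j) : seaweedRel s α β i j := by
  refine ⟨(mem_rest.1 hij.1).1, (mem_rest.1 hij.2.1).1, ?_, hij.2.2.2⟩
  have h1 := hij.2.2.1
  unfold restBlock at h1
  split_ifs at h1 <;> omega

lemma not_rel_p_K (h : Reduction s α β O S K p a b) {i j : ι} (hi : i ∈ O) (hj : j ∈ K) :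
    ¬ seaweedRel (rest s O p) (restBlock α O p) β (p i) j := by
  intro hij
  have := hij.2.2.1
  rw [h.restBlock_p hi, h.restBlock_K hj] at this
  omega

lemma inflate_mem (h : Reduction s α β O S K p a b) {x : Matrix ι ι ℂ}
    (hx : x ∈ supported (seaweedRel (rest s O p) (restBlock α O p) β)) :
    inflate O p x ∈ supported (seaweedRel s α β) := by
  intro i j hij
  rw [inflate_apply]
  split_ifs with h1 h2
  · exact absurd (h.rel_of_mem_O (h.O_sub h1.1) (h.α_O i h1.1) h1.2) hij
  · rfl
  · exact hx i j fun h3 => hij (rel_of_rest h3)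

lemma sum_p (h : Reduction s α β O S K p a b) {m : ι} (hm : m ∈ O) (g : ι → ℂ) :
    (∑ l ∈ O, if p l = p m then g l else 0) = g m := by
  rw [Finset.sum_eq_single m]
  · simp
  · intro l hl hlm
    rw [if_neg fun h1 => hlm (h.p_inj l hl m hm h1)]
  · exact fun h1 => absurd hm h1

lemma sum_K (h : Reduction s α β O S K p a b) {i : ι} (hi : i ∈ K) (g : ι → ℂ) :
    (∑ l ∈ O, if p l = i then g l else 0) = 0 := by
  refine Finset.sum_eq_zero fun l hl => if_neg ?_
  rintro rfl
  exact h.p_notMem_K hl hi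

/-- The image of `p` is a block of `restBlock`, so a path that starts and ends in it never leaves
it; this makes the copy in `O × O` multiplicative. Outside of `O` no term is lost, because no
related pair leads from `O` out of `O`. -/
lemma inflate_mul (h : Reduction s α β O S K p a b) {x y : Matrix ι ι ℂ}
    (hx : x ∈ supported (seaweedRel (rest s O p) (restBlock α O p) β))
    (hy : y ∈ supported (seaweedRel (rest s O p) (restBlock α O p) β)) :
    inflate O p (x * y) = inflate O p x * inflate O p y := by
  ext i j
  rw [inflate_apply, Matrix.mul_apply]
  by_cases hi : i ∈ O <;> by_cases hj : j ∈ O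
  · rw [if_pos ⟨hi, hj⟩, Matrix.mul_apply]
    have h1 : ∀ k ∈ (Finset.univ : Finset ι), k ∉ O.image p → x (p i) k * y k (p j) = 0 := by
      intro k _ hk
      by_contra h2
      have h3 := rel_of_ne_zero hx (left_ne_zero_of_mul h2)
      have h4 := rel_of_ne_zero hy (right_ne_zero_of_mul h2)
      have h5 := h3.2.2.1
      have h6 := h4.2.2.1
      rw [h.restBlock_p hi] at h5
      rw [h.restBlock_p hj] at h6
      obtain ⟨l, hl, rfl⟩ := h.restBlock_eq_odd h4.1 (le_antisymm h6 h5)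
      exact hk (Finset.mem_image_of_mem p hl)
    rw [← Finset.sum_subset (Finset.subset_univ (O.image p)) h1,
      Finset.sum_image (fun l hl m hm hlm => h.p_inj l hl m hm hlm),
      ← Finset.sum_subset (Finset.subset_univ O)]
    · refine Finset.sum_congr rfl fun k hk => ?_
      rw [inflate_apply, inflate_apply, if_pos ⟨hi, hk⟩, if_pos ⟨hk, hj⟩]
    · intro k _ hk
      rw [inflate_apply, if_neg (fun h2 => hk h2.2), if_pos (Or.inl hi), zero_mul]
  · rw [if_neg (fun h2 => hj h2.2), if_pos (Or.inl hi)]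
    symm
    refine Finset.sum_eq_zero fun k _ => ?_
    beta_reduce
    by_cases hk : k ∈ O
    · rw [inflate_apply O p y, if_neg (fun h2 => hj h2.2), if_pos (Or.inl hk), mul_zero]
    · rw [inflate_apply O p x, if_neg (fun h2 => hk h2.2), if_pos (Or.inl hi), zero_mul]
  · rw [if_neg (fun h2 => hi h2.1), if_pos (Or.inr hj)]
    symm
    refine Finset.sum_eq_zero fun k _ => ?_
    beta_reduce
    by_cases hk : k ∈ O
    · rw [inflate_apply O p x, if_neg (fun h2 => hi h2.1), if_pos (Or.inr hk), zero_mul]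
    · rw [inflate_apply O p y, if_neg (fun h2 => hk h2.1), if_pos (Or.inr hj), mul_zero]
  · rw [if_neg (fun h2 => hi h2.1), if_neg (by tauto), Matrix.mul_apply]
    refine Finset.sum_congr rfl fun k _ => ?_
    beta_reduce
    by_cases hk : k ∈ O
    · rw [inflate_apply O p x, if_neg (fun h2 => hi h2.1), if_pos (Or.inr hk), zero_mul,
        hy k j fun h2 => hj (h.rel_O (rel_of_rest h2) hk), mul_zero]
    · rw [inflate_apply, inflate_apply, if_neg (fun h2 => hi h2.1), if_neg (by tauto),
        if_neg (fun h2 => hk h2.1), if_neg (by tauto)]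

lemma isPerp_inflate (h : Reduction s α β O S K p a b) {x : Matrix ι ι ℂ}
    (hx : x ∈ supported (seaweedRel (rest s O p) (restBlock α O p) β)) :
    IsPerp O S K p (inflate O p x) := by
  intro i hi j hj
  have hiO : i ∉ O := ((h.mem_SK i).1 hi).2.1
  rcases hi with hi | hi
  · obtain ⟨m, hm, rfl⟩ := h.p_surj i hi
    rw [h.sum_p hm, inflate_apply, inflate_apply, if_neg (fun h2 => hiO h2.2),
      if_pos (show j ∈ O ∧ m ∈ O from ⟨hj, hm⟩)]
    split_ifs with h1
    · rw [hx]
      intro h2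
      exact hiO (h.rel_O (rel_of_rest h2) (by tauto))
    · rfl
  · rw [h.sum_K hi, inflate_apply, if_neg (fun h2 => hiO h2.2)]
    split_ifs with h1
    · rfl
    · exact hx _ _ (h.not_rel_p_K hj hi)

/-- The orthogonal of the ideal is the smaller seaweed plus the ideal. Orthogonality makes the rows
`p l` repeat the rows `l` in the columns from `S` and vanish in the columns from `K`; the vanishing
is the reason why the image of `p` comes after `K` in `restBlock`. -/
lemma exists_eq_inflate_add (h : Reduction s α β O S K p a b) {x : Matrix ι ι ℂ}
    (hx : x ∈ supported (seaweedRel s α β)) (hperp : IsPerp O S K p x) :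
    ∃ y ∈ supported (seaweedRel (rest s O p) (restBlock α O p) β),
      ∀ i j, ¬ ((i ∈ S ∨ i ∈ K) ∧ j ∈ O) → x i j = inflate O p y i j := by
  classical
  obtain ⟨q, hq⟩ : ∃ q : ι → ι, ∀ j ∈ O, q (p j) = j := by
    refine ⟨fun i => if h1 : ∃ j ∈ O, p j = i then h1.choose else i, fun j hj => ?_⟩
    have h1 : ∃ l ∈ O, p l = p j := ⟨j, hj, rfl⟩
    simp only [dif_pos h1]
    exact h.p_inj _ h1.choose_spec.1 j hj h1.choose_spec.2
  have hY : ∀ {i}, i ∈ O.image p ↔ ∃ j ∈ O, p j = i := Finset.mem_image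
  have hS : ∀ l ∈ O, ∀ m ∈ O, p m ∈ S → x (p l) (p m) = x l m := fun l hl m hm hS => by
    rw [hperp (p m) (Or.inl hS) l hl, h.sum_p hm]
  refine ⟨Matrix.of fun i j => if i ∈ O.image p ∧ j ∈ O.image p then x (q i) (q j)
    else if i ∈ O ∨ j ∈ O then 0 else x i j, ?_, ?_⟩
  · intro i j hij
    rw [Matrix.of_apply]
    split_ifs with h1 h2
    · obtain ⟨l, hl, rfl⟩ := hY.1 h1.1
      obtain ⟨m, hm, rfl⟩ := hY.1 h1.2
      rw [hq l hl, hq m hm]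
      rcases h.p_mem m hm with h2 | h2
      · rw [← hS l hl m hm h2, hx]
        intro h3
        exact hij ⟨h.p_mem_rest hl, h.p_mem_rest hm, by
          rw [h.restBlock_p hl, h.restBlock_p hm], h3.2.2.2⟩
      · refine absurd ⟨h.p_mem_rest hl, h.p_mem_rest hm, by
          rw [h.restBlock_p hl, h.restBlock_p hm], ?_⟩ hij
        rw [h2, (h.mem_O m (h.O_sub hm)).1 hm]
        exact h.β_min _ (mem_rest.1 (h.p_mem_rest hl)).1
    · rfl
    · push Not at h2
      by_contra h3
      have h4 := rel_of_ne_zero hx h3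
      have hir : i ∈ rest s O p := mem_rest_of_notMem h4.1 h2.1
      have hjr : j ∈ rest s O p := mem_rest_of_notMem h4.2.1 h2.2
      have h5 : ¬ restBlock α O p i ≤ restBlock α O p j := fun h5 => hij ⟨hir, hjr, h5, h4.2.2.2⟩
      have h6 := h4.2.2.1
      have h7 : i ∈ O.image p ∧ α j = α i := by
        unfold restBlock at h5
        split_ifs at h5 with h8 h9
        all_goals first | omega | exact ⟨h8, by omega⟩
      obtain ⟨l, hl, rfl⟩ := hY.1 h7.1
      rcases h.cases_first hjr (h7.2.trans (h.α_p hl)) with h8 | h8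
      · exact h1 ⟨h7.1, hY.2 h8⟩
      · rw [hperp j (Or.inr h8) l hl, h.sum_K h8] at h3
        exact h3 rfl
  · intro i j hij
    rw [inflate_apply]
    split_ifs with h1 h2
    · rw [Matrix.of_apply, if_pos ⟨Finset.mem_image_of_mem p h1.1, Finset.mem_image_of_mem p h1.2⟩,
        hq i h1.1, hq j h1.2]
    · apply hx
      intro h3
      by_cases hi : i ∈ O
      · exact h1 ⟨hi, h.rel_O h3 hi⟩
      · have hj : j ∈ O := by tauto
        exact hij ⟨h.rel_to_O h3 hj hi, hj⟩
    · rw [Matrix.of_apply]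
      split_ifs with h3
      · obtain ⟨l, hl, rfl⟩ := hY.1 h3.1
        obtain ⟨m, hm, rfl⟩ := hY.1 h3.2
        rw [hq l hl, hq m hm]
        rcases h.p_mem m hm with h4 | h4
        · exact hS l hl m hm h4
        · rw [h4] at h2
          exact absurd (Or.inr hm) h2
      · rfl

lemma apply_bracket_single (h : Reduction s α β O S K p a b) {F : Matrix ι ι ℂ →ₗ[ℂ] ℂ}
    (hF : IsNormal O S K p F) {x : Matrix ι ι ℂ} (hx : x ∈ supported (seaweedRel s α β))
    {i j : ι} (hi : i ∈ S ∨ i ∈ K) (hj : j ∈ O) :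
    F (x * Matrix.single i j 1 - Matrix.single i j 1 * x) =
      x (p j) i - ∑ l ∈ O, if p l = i then x j l else 0 := by
  rw [map_sub, apply_mul_single, apply_single_mul]
  congr 1
  · rw [Finset.sum_eq_single (p j)]
    · by_cases h1 : x (p j) i = 0
      · simp [h1]
      · rw [hF _ (h.rel_SK (rel_of_ne_zero hx h1) hi) j hj, if_pos rfl, mul_one]
    · intro k _ hk
      by_cases h1 : x k i = 0
      · simp [h1]
      · rw [hF _ (h.rel_SK (rel_of_ne_zero hx h1) hi) j hj, if_neg hk.symm, mul_zero]
    · simp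
  · rw [← Finset.sum_subset (Finset.subset_univ O)]
    · refine Finset.sum_congr rfl fun l hl => ?_
      rw [hF i hi l hl]
      split_ifs <;> simp
    · intro l _ hl
      rw [hx j l fun h1 => hl (h.rel_O h1 hj), zero_mul]

lemma isPerp_iff (h : Reduction s α β O S K p a b) {F : Matrix ι ι ℂ →ₗ[ℂ] ℂ}
    (hF : IsNormal O S K p F) {x : Matrix ι ι ℂ} (hx : x ∈ supported (seaweedRel s α β)) :
    IsPerp O S K p x ↔ ∀ i, (i ∈ S ∨ i ∈ K) → ∀ j ∈ O,
      F (x * Matrix.single i j 1 - Matrix.single i j 1 * x) = 0 := by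
  refine forall_congr' fun i => forall_congr' fun hi => forall_congr' fun j =>
    forall_congr' fun hj => ?_
  rw [h.apply_bracket_single hF hx hi hj, sub_eq_zero]

/-- A perpendicular element brackets trivially with the abelian ideal. -/
lemma apply_bracket_ideal (h : Reduction s α β O S K p a b) {F : Matrix ι ι ℂ →ₗ[ℂ] ℂ}
    (hF : IsNormal O S K p F) {x : Matrix ι ι ℂ} (hx : x ∈ supported (seaweedRel s α β))
    (hperp : IsPerp O S K p x) {y : Matrix ι ι ℂ}
    (hy : ∀ i j, ¬ ((i ∈ S ∨ i ∈ K) ∧ j ∈ O) → y i j = 0) : F (x * y - y * x) = 0 := by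
  have h2 : F (x * y - y * x) = (F ∘ₗ (LinearMap.mulLeft ℂ x - LinearMap.mulRight ℂ x)) y := by
    simp
  rw [h2, Matrix.matrix_eq_sum_single y]
  simp only [map_sum]
  refine Finset.sum_eq_zero fun i _ => Finset.sum_eq_zero fun j _ => ?_
  by_cases hij : (i ∈ S ∨ i ∈ K) ∧ j ∈ O
  · have h3 := (h.isPerp_iff hF hx).1 hperp i hij.1 j hij.2
    have h4 : Matrix.single i j (y i j) = y i j • Matrix.single i j (1 : ℂ) := by simp
    rw [h4, map_smul]
    simp only [LinearMap.comp_apply, LinearMap.sub_apply, LinearMap.mulLeft_apply,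
      LinearMap.mulRight_apply, h3, smul_zero]
  · rw [hy i j hij]
    simp

end Reduction

end Supported

/-! ### Passing index one and principal elements through a reduction -/

section Reduce

variable {ι : Type*} [DecidableEq ι] [Fintype ι]

namespace Reduction

variable {s : Finset ι} {α β : ι → ℕ} {O S K : Finset ι} {p : ι → ι} {a b : ℕ}

/-- For `x` in the smaller kernel, `F [inflate x, ·]` vanishes on the orthogonal of the ideal, so by
double orthogonality it equals `F [ν, ·]` for some `ν` in the ideal. Then `inflate x - ν` is in the
kernel of the large form, hence scalar, and `x` can be read off from its entries. -/
theorem indexOne_rest (h : Reduction s α β O S K p a b) {F : Matrix ι ι ℂ →ₗ[ℂ] ℂ}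
    (hF : IsNormal O S K p F) (hI : IndexOne (seaweedRel s α β) F) :
    IndexOne (seaweedRel (rest s O p) (restBlock α O p) β) (F ∘ₗ inflate O p) := by
  intro x hx hker
  set z := inflate O p x with hz
  have hzR := h.inflate_mem hx
  rw [← hz] at hzR
  let A := supported (seaweedRel s α β)
  let comm : Matrix ι ι ℂ → Module.Dual ℂ A := fun u =>
    (F ∘ₗ (LinearMap.mulLeft ℂ u - LinearMap.mulRight ℂ u)).domRestrict A
  have hcomm : ∀ u (y : A), comm u y = F (u * y - y * u) := fun u y => by
    simp [comm, LinearMap.domRestrict_apply]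
  let J := {q : ι × ι // (q.1 ∈ S ∨ q.1 ∈ K) ∧ q.2 ∈ O}
  let L : J → Module.Dual ℂ A := fun q => comm (Matrix.single q.1.1 q.1.2 1)
  have hmem : comm z ∈ Submodule.span ℂ (Set.range L) := by
    apply mem_span_of_iInf_ker_le_ker
    intro y hy
    simp only [Submodule.mem_iInf, LinearMap.mem_ker] at hy
    have hperp : IsPerp O S K p (y : Matrix ι ι ℂ) := by
      rw [h.isPerp_iff hF y.2]
      intro i hi j hj
      have h1 := hy ⟨(i, j), hi, hj⟩
      rw [hcomm] at h1
      rw [← neg_sub, map_neg, h1, neg_zero]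
    obtain ⟨w, hw, hyw⟩ := h.exists_eq_inflate_add y.2 hperp
    rw [LinearMap.mem_ker, hcomm]
    have h1 : F (z * (y - inflate O p w) - (y - inflate O p w) * z) = 0 := by
      refine h.apply_bracket_ideal hF hzR (h.isPerp_inflate hx) fun i j hij => ?_
      rw [Matrix.sub_apply, hyw i j hij, sub_self]
    have h2 : F (z * inflate O p w - inflate O p w * z) = 0 := by
      rw [hz, ← h.inflate_mul hx hw, ← h.inflate_mul hw hx, ← map_sub]
      exact hker w hw
    have h3 : z * (y : Matrix ι ι ℂ) - y * z = (z * (y - inflate O p w) - (y - inflate O p w) * z) +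
        (z * inflate O p w - inflate O p w * z) := by noncomm_ring
    rw [h3, map_add, h1, h2, add_zero]
  obtain ⟨c, hc⟩ := (Submodule.mem_span_range_iff_exists_fun ℂ).1 hmem
  set ν : Matrix ι ι ℂ := ∑ q : J, c q • Matrix.single q.1.1 q.1.2 (1 : ℂ) with hν
  have hνR : ν ∈ A := Submodule.sum_mem _ fun q _ => Submodule.smul_mem _ _
    (single_mem_supported (h.rel_of_mem_O ((h.mem_SK _).1 q.2.1).1 ((h.mem_SK _).1 q.2.1).2.2
      q.2.2) _)
  have hν0 : ∀ i j, ¬ ((i ∈ S ∨ i ∈ K) ∧ j ∈ O) → ν i j = 0 := by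
    intro i j hij
    rw [hν, Matrix.sum_apply]
    refine Finset.sum_eq_zero fun q _ => ?_
    rw [Matrix.smul_apply, Matrix.single_apply, if_neg, smul_zero]
    rintro ⟨h1, h2⟩
    exact hij ⟨h1 ▸ q.2.1, h2 ▸ q.2.2⟩
  have hker' : ∀ y ∈ A, F ((z - ν) * y - y * (z - ν)) = 0 := by
    intro y hy
    have h1 : comm z ⟨y, hy⟩ = comm ν ⟨y, hy⟩ := by
      rw [← hc, LinearMap.sum_apply, hcomm, hν, Finset.sum_mul, Finset.mul_sum,
        ← Finset.sum_sub_distrib, map_sum]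
      refine Finset.sum_congr rfl fun q _ => ?_
      rw [LinearMap.smul_apply, hcomm]
      simp only [smul_mul_assoc, mul_smul_comm, ← smul_sub, map_smul]
    rw [hcomm, hcomm] at h1
    have h2 : (z - ν) * y - y * (z - ν) = (z * y - y * z) - (ν * y - y * ν) := by noncomm_ring
    rw [h2, map_sub, h1, sub_self]
  obtain ⟨h1, h2⟩ := hI (z - ν) (Submodule.sub_mem _ hzR hνR) hker'
  have hrel : ∀ {i}, i ∈ s → seaweedRel s α β i i := fun hi => ⟨hi, hi, le_rfl, le_rfl⟩
  have hOO : ∀ i ∈ O, ∀ j ∈ O, (z - ν) i j = x (p i) (p j) := fun i hi j hj => by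
    rw [Matrix.sub_apply, hν0 i j fun h3 => ((h.mem_SK i).1 h3.1).2.1 hi, sub_zero, hz,
      inflate_apply, if_pos ⟨hi, hj⟩]
  have hMM : ∀ i, i ∉ O → ∀ j, j ∉ O → (z - ν) i j = x i j := fun i hi j hj => by
    rw [Matrix.sub_apply, hν0 i j fun h3 => hj h3.2, sub_zero, hz,
      inflate_apply, if_neg (fun h3 => hi h3.1), if_neg (by tauto)]
  constructor
  · intro i j hij
    by_contra h3
    have h4 := rel_of_ne_zero hx h3
    by_cases hj : j ∈ O
    · have hpj := (mem_rest.1 h4.2.1).2 hj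
      have hai : restBlock α O p i ≤ 2 * a + 1 := by
        rw [← h.restBlock_p hj, hpj]; exact h4.2.2.1
      rcases h.cases_first h4.1 (le_antisymm (h.restBlock_first hai)
        (h.α_min i (mem_rest.1 h4.1).1)) with ⟨l, hl, h5⟩ | h5
      · rw [← h5, ← hpj, ← hOO l hl j hj] at h3
        refine h3 (h1 l j ?_)
        rintro rfl
        exact hij (h5.symm.trans hpj)
      · rcases h.full with h6 | h6
        · simp [h6] at h5
        · exact (h.S_sub (hpj ▸ h6 j hj)).2.1 hj
    · by_cases hi : i ∈ O
      · exact hj (h.rel_O (rel_of_rest h4) hi)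
      · exact h3 (hMM i hi j hj ▸ h1 i j hij)
  · have hdiag : ∀ i, i ∈ rest s O p → (z - ν) i i = x i i := by
      intro i hi
      by_cases hO : i ∈ O
      · rw [hOO i hO i hO, (mem_rest.1 hi).2 hO]
      · exact hMM i hO i hO
    intro i j hi hj
    rw [← hdiag i hi.1, ← hdiag j hj.1]
    exact h2 i j (hrel (mem_rest.1 hi.1).1) (hrel (mem_rest.1 hj.1).1)

/-- A kernel element is orthogonal to the ideal, hence of the form `inflate y + ν`. The ideal pairs
to zero with inflated elements, so `y` lies in the smaller kernel and is scalar. Then `inflate y` is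
central, and `ν` is itself in the kernel and has to vanish. -/
theorem indexOne_of_rest (h : Reduction s α β O S K p a b) {F F' : Matrix ι ι ℂ →ₗ[ℂ] ℂ}
    (hF : IsNormal O S K p F)
    (hFF' : ∀ x ∈ supported (seaweedRel (rest s O p) (restBlock α O p) β),
      F (inflate O p x) = F' x)
    (hI : IndexOne (seaweedRel (rest s O p) (restBlock α O p) β) F') :
    IndexOne (seaweedRel s α β) F := by
  intro x hx hker
  have hperp : IsPerp O S K p x := (h.isPerp_iff hF hx).2 fun i hi j hj =>
    hker _ (single_mem_supported (h.rel_of_mem_O ((h.mem_SK _).1 hi).1 ((h.mem_SK _).1 hi).2.2 hj) _)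
  obtain ⟨y, hy, hxy⟩ := h.exists_eq_inflate_add hx hperp
  set z := inflate O p y with hz
  have hzR := h.inflate_mem hy
  rw [← hz] at hzR
  set ν := x - z with hν
  have hν0 : ∀ i j, ¬ ((i ∈ S ∨ i ∈ K) ∧ j ∈ O) → ν i j = 0 := fun i j hij => by
    rw [hν, Matrix.sub_apply, hxy i j hij, sub_self]
  have hxz : x = z + ν := by rw [hν]; abel
  obtain ⟨h1, h2⟩ := hI y hy (by
    intro w hw
    rw [← hFF' _ (Submodule.sub_mem _ (mul_mem_supported seaweedRel_trans hy hw)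
      (mul_mem_supported seaweedRel_trans hw hy)), map_sub, h.inflate_mul hy hw,
      h.inflate_mul hw hy, ← hz]
    have h3 := hker _ (h.inflate_mem hw)
    have h4 := h.apply_bracket_ideal hF (h.inflate_mem hw) (h.isPerp_inflate hw) hν0
    rw [hxz] at h3
    have h5 : (z + ν) * inflate O p w - inflate O p w * (z + ν) =
      (z * inflate O p w - inflate O p w * z) - (inflate O p w * ν - ν * inflate O p w) := by
      noncomm_ring
    rw [h5, map_sub, h4, sub_zero] at h3
    exact h3)
  have hrest : ∀ i ∈ rest s O p, seaweedRel (rest s O p) (restBlock α O p) β i i :=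
    fun i hi => ⟨hi, hi, le_rfl, le_rfl⟩
  have hz1 : ∀ i j, i ≠ j → z i j = 0 := by
    intro i j hij
    rw [hz, inflate_apply]
    split_ifs with h3
    · exact h1 _ _ fun h4 => hij (h.p_inj i h3.1 j h3.2 h4)
    · rfl
    · exact h1 i j hij
  have hz2' : ∀ i ∈ s, ∃ j ∈ rest s O p, z i i = y j j := by
    intro i hi
    by_cases hO : i ∈ O
    · exact ⟨p i, h.p_mem_rest hO, by rw [hz, inflate_apply, if_pos ⟨hO, hO⟩]⟩
    · exact ⟨i, mem_rest_of_notMem hi hO, by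
        rw [hz, inflate_apply, if_neg (fun h3 => hO h3.1), if_neg (by tauto)]⟩
  have hz2 : ∀ i j, seaweedRel s α β i i → seaweedRel s α β j j → z i i = z j j := by
    intro i j hi hj
    obtain ⟨i', hi', h3⟩ := hz2' i hi.1
    obtain ⟨j', hj', h4⟩ := hz2' j hj.1
    rw [h3, h4]
    exact h2 i' j' (hrest i' hi') (hrest j' hj')
  have hνker : ∀ w ∈ supported (seaweedRel s α β), F (ν * w - w * ν) = 0 := by
    intro w hw
    have h3 := hker w hw
    have h4 : x * w - w * x = (z * w - w * z) + (ν * w - w * ν) := by rw [hxz]; noncomm_ring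
    rwa [h4, commute_of_scalar (fun i j hij => ⟨hij.1, hij.1, le_rfl, le_rfl⟩)
      (fun i j hij => ⟨hij.2.1, hij.2.1, le_rfl, le_rfl⟩) hw hz1 hz2, zero_add] at h3
  have hνval : ∀ k l, F (ν * Matrix.single k l 1 - Matrix.single k l 1 * ν) =
      ∑ i, ν i k * F (Matrix.single i l 1) - ∑ j, ν l j * F (Matrix.single k j 1) := by
    intro k l
    rw [map_sub, apply_mul_single, apply_single_mul]
  have hν_zero : ∀ i j, ν i j = 0 := by
    intro i j
    by_cases hij : (i ∈ S ∨ i ∈ K) ∧ j ∈ O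
    swap
    · exact hν0 i j hij
    obtain ⟨hi, hj⟩ := hij
    -- A matrix unit inside `O × O` isolates one entry of `ν` in a row from `S`.
    have hSval : ∀ i₀ ∈ S, ∀ j₀ ∈ O, ν i₀ j₀ = 0 := by
      intro i₀ hi₀ j₀ hj₀
      obtain ⟨l, hl, rfl⟩ := h.p_surj i₀ hi₀
      have h3 := hνker _ (single_mem_supported
        (h.rel_of_mem_O (h.O_sub hj₀) (h.α_O _ hj₀) hl) 1)
      rw [hνval, Finset.sum_eq_zero (s := Finset.univ) (f := fun j => ν l j * _), sub_zero,
        Finset.sum_eq_single (p l), hF _ (Or.inl hi₀) l hl, if_pos rfl, mul_one] at h3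
      · exact h3
      · intro i' _ hi'
        by_cases hi'' : i' ∈ S ∨ i' ∈ K
        · rw [hF i' hi'' l hl, if_neg hi'.symm, mul_zero]
        · rw [hν0 i' j₀ fun h4 => hi'' h4.1, zero_mul]
      · simp
      · intro j' _
        rw [hν0 l j' fun h4 => ((h.mem_SK l).1 h4.1).2.1 hl, zero_mul]
    rcases hi with hi | hi
    · exact hSval i hi j hj
    -- A row from `K` exists only if `p` maps `O` into `S`. The unit at `(p j, i)`, allowed because
    -- `K` precedes `S` in `β`, then isolates `ν i j`.
    · rcases h.full with h3 | h3
      · simp [h3] at hi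
      have hk := h3 j hj
      have hiS := h.K_sub hi
      have hkS := h.S_sub hk
      have h4 := hνker _ (single_mem_supported (i := p j) (j := i)
        ⟨hkS.1, hiS.1, by rw [hkS.2.2, hiS.2.2], h.le i hi _ hk⟩ 1)
      rw [hνval, Finset.sum_eq_zero (s := Finset.univ) (f := fun l => ν l (p j) * _), zero_sub,
        neg_eq_zero, Finset.sum_eq_single j, hF _ (Or.inl hk) j hj, if_pos rfl, mul_one] at h4
      · exact h4
      · intro l _ hlj
        by_cases hl : l ∈ O
        · rw [hF _ (Or.inl hk) l hl, if_neg (fun h5 => hlj (h.p_inj l hl j hj h5)), mul_zero]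
        · rw [hν0 i l fun h5 => hl h5.2, zero_mul]
      · simp
      · intro l _
        rw [hν0 l (p j) fun h5 => hkS.2.1 h5.2, zero_mul]
  have hxz' : x = z := by
    rw [hxz]
    ext i j
    rw [Matrix.add_apply, hν_zero, add_zero]
  rw [hxz']
  exact ⟨hz1, hz2⟩

/-- The functional is `F' ∘ τ + N`, where `τ` inverts `inflate` by reading entries and `N` sums the
entries at `(p j, j)` with `p j ∈ S`. Lowering `d' ∘ p` by one on `O` keeps the differences inside
`O` and gives the entries in `N` weight one, as a principal element requires. -/
theorem exists_extension (h : Reduction s α β O S K p a b) {F' : Matrix ι ι ℂ →ₗ[ℂ] ℂ}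
    {d' : ι → ℤ} (hI : IndexOne (seaweedRel (rest s O p) (restBlock α O p) β) F')
    (hP : IsPrincipalDiagonal (seaweedRel (rest s O p) (restBlock α O p) β) F' d') :
    ∃ F : Matrix ι ι ℂ →ₗ[ℂ] ℂ, IndexOne (seaweedRel s α β) F ∧
      IsPrincipalDiagonal (seaweedRel s α β) F fun i => if i ∈ O then d' (p i) - 1 else d' i := by
  classical
  obtain ⟨q, hq⟩ : ∃ q : ι → ι, ∀ j ∈ O, q (p j) = j := by
    refine ⟨fun i => if h1 : ∃ j ∈ O, p j = i then h1.choose else i, fun j hj => ?_⟩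
    have h1 : ∃ l ∈ O, p l = p j := ⟨j, hj, rfl⟩
    simp only [dif_pos h1]
    exact h.p_inj _ h1.choose_spec.1 j hj h1.choose_spec.2
  let R' := seaweedRel (rest s O p) (restBlock α O p) β
  -- A surviving column in `O` is a fixed point of `p`, and rows related to it lie in the image of
  -- `p`; such entries are read from the copy in `O × O`, through the inverse `q` of `p`.
  let τ : Matrix ι ι ℂ →ₗ[ℂ] Matrix ι ι ℂ :=
    { toFun := fun y => Matrix.of fun i j =>
        if R' i j then (if j ∈ O then y (q i) j else y i j) else 0
      map_add' := fun x y => by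
        ext i j
        simp only [Matrix.of_apply, Matrix.add_apply]
        split_ifs <;> simp
      map_smul' := fun c x => by
        ext i j
        simp only [Matrix.of_apply, Matrix.smul_apply, RingHom.id_apply]
        split_ifs <;> simp }
  have hτ : ∀ y i j, τ y i j = if R' i j then (if j ∈ O then y (q i) j else y i j) else 0 :=
    fun _ _ _ => rfl
  have hτR : ∀ y, τ y ∈ supported R' := fun y i j hij => by rw [hτ, if_neg hij]
  -- the relation `R'` into `O` consists of pairs in the image of `p`
  have hR'O : ∀ i j, R' i j → j ∈ O → p j = j ∧ ∃ l ∈ O, p l = i := by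
    intro i j hij hj
    have hpj := (mem_rest.1 hij.2.1).2 hj
    have hai : restBlock α O p i ≤ 2 * a + 1 := by
      rw [← h.restBlock_p hj, hpj]; exact hij.2.2.1
    refine ⟨hpj, ?_⟩
    rcases h.cases_first hij.1 (le_antisymm (h.restBlock_first hai)
      (h.α_min i (mem_rest.1 hij.1).1)) with h5 | h5
    · exact h5
    · rcases h.full with h6 | h6
      · simp [h6] at h5
      · exact absurd hj (h.S_sub (hpj ▸ h6 j hj)).2.1
  have hR'O' : ∀ i j, R' i j → j ∉ O → i ∉ O := fun i j hij hj hi =>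
    hj (h.rel_O (rel_of_rest hij) hi)
  let N : Matrix ι ι ℂ →ₗ[ℂ] ℂ :=
    ∑ j ∈ O.filter (fun j => p j ∈ S), Matrix.entryLinearMap ℂ ℂ (p j) j
  have hN : ∀ y, N y = ∑ j ∈ O.filter (fun j => p j ∈ S), y (p j) j := fun y => by
    simp [N, LinearMap.sum_apply]
  let F := F' ∘ₗ τ + N
  have hFτ : ∀ y, F y = F' (τ y) + N y := fun y => rfl
  have hnormal : IsNormal O S K p F := by
    intro i hi j hj
    have hiO := ((h.mem_SK i).1 hi).2.1
    have h1 : τ (Matrix.single i j 1) = 0 := by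
      ext k l
      rw [hτ, Matrix.zero_apply]
      split_ifs with h1 h2
      · obtain ⟨m, hm, rfl⟩ := (hR'O k l h1 h2).2
        rw [hq m hm, Matrix.single_apply, if_neg]
        rintro ⟨rfl, -⟩
        exact hiO hm
      · rw [Matrix.single_apply, if_neg]
        rintro ⟨-, rfl⟩
        exact h2 hj
      · rfl
    rw [hFτ, h1, map_zero, zero_add, hN]
    by_cases hpj : p j = i
    · rw [if_pos hpj, Finset.sum_eq_single j]
      · rw [hpj, Matrix.single_apply, if_pos ⟨rfl, rfl⟩]
      · intro l _ hl
        rw [Matrix.single_apply, if_neg fun h3 => hl h3.2.symm]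
      · intro h3
        exact absurd (Finset.mem_filter.2 ⟨hj, hpj ▸ hi.resolve_right
          fun h4 => h.p_notMem_K hj (hpj ▸ h4)⟩) h3
    · rw [if_neg hpj]
      refine Finset.sum_eq_zero fun l _ => ?_
      rw [Matrix.single_apply, if_neg]
      rintro ⟨h3, rfl⟩
      exact hpj h3.symm
  refine ⟨F, h.indexOne_of_rest hnormal ?_ hI, ?_⟩
  · intro x hx
    have h1 : τ (inflate O p x) = x := by
      ext i j
      rw [hτ]
      split_ifs with h1 h2
      · obtain ⟨h3, l, hl, rfl⟩ := hR'O i j h1 h2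
        rw [hq l hl, inflate_apply, if_pos ⟨hl, h2⟩, h3]
      · have := hR'O' i j h1 h2
        rw [inflate_apply, if_neg (fun h3 => h2 h3.2), if_neg (by tauto)]
      · exact (hx i j h1).symm
    rw [hFτ, h1, hN, Finset.sum_eq_zero, add_zero]
    intro j hj
    rw [Finset.mem_filter] at hj
    have := (h.S_sub hj.2).2.1
    rw [inflate_apply, if_neg (fun h3 => this h3.1), if_pos (Or.inr hj.1)]
  · intro y hy
    set d : ι → ℤ := fun i => if i ∈ O then d' (p i) - 1 else d' i with hd
    have hent : ∀ (e : ι → ℤ) (y : Matrix ι ι ℂ) i j, (Matrix.diagonal (fun i => (e i : ℂ)) * y -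
        y * Matrix.diagonal (fun i => (e i : ℂ))) i j = ((e i : ℂ) - e j) * y i j := by
      intro e y i j
      rw [Matrix.sub_apply, Matrix.diagonal_mul, Matrix.mul_diagonal]
      ring
    have h1 : τ (Matrix.diagonal (fun i => (d i : ℂ)) * y - y * Matrix.diagonal
        (fun i => (d i : ℂ))) = Matrix.diagonal (fun i => (d' i : ℂ)) * τ y -
          τ y * Matrix.diagonal (fun i => (d' i : ℂ)) := by
      ext i j
      rw [hent, hτ, hτ]
      split_ifs with h1 h2
      · obtain ⟨h3, l, hl, rfl⟩ := hR'O i j h1 h2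
        rw [hent, hq l hl]
        simp only [hd, if_pos hl, if_pos h2, h3]
        push_cast
        ring
      · rw [hent]
        simp only [hd, if_neg h2, if_neg (hR'O' i j h1 h2)]
      · simp
    rw [hFτ, hFτ, h1, hP _ (hτR y), hN, hN]
    congr 1
    refine Finset.sum_congr rfl fun j hj => ?_
    rw [Finset.mem_filter] at hj
    rw [hent]
    simp only [hd, if_pos hj.1, if_neg (h.S_sub hj.2).2.1]
    push_cast
    ring

end Reduction

end Reduce

/-! ### Normalizing the functional: conjugation and choice of the rows `S` -/

section NormalForm

lemma exists_equiv_single {O S : Type*} [Fintype O] [DecidableEq O] {w : S → O → ℂ}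
    (hw : LinearIndependent ℂ w) :
    ∃ g : (O → ℂ) ≃ₗ[ℂ] (O → ℂ), ∃ q : S → O, Function.Injective q ∧
      ∀ i, g (w i) = Pi.single (q i) 1 := by
  let b := Module.Basis.extend hw.linearIndepOn_id
  let σ := b.indexEquiv (Pi.basisFun ℂ O)
  have hmem : ∀ i, w i ∈ hw.linearIndepOn_id.extend (Set.subset_univ (Set.range w)) := fun i =>
    hw.linearIndepOn_id.subset_extend _ ⟨i, rfl⟩
  refine ⟨b.equiv (Pi.basisFun ℂ O) σ, fun i => σ ⟨w i, hmem i⟩, ?_, ?_⟩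
  · intro i j hij
    exact hw.injective (Subtype.ext_iff.1 (σ.injective hij))
  · intro i
    have h1 : w i = b ⟨w i, hmem i⟩ := (Module.Basis.extend_apply_self hw.linearIndepOn_id ⟨w i, hmem i⟩).symm
    conv_lhs => rw [h1]
    rw [Module.Basis.equiv_apply, Pi.basisFun_apply]

variable {ι : Type*} [DecidableEq ι] [Fintype ι]

lemma apply_bracket_eq_zero_of_single {R : ι → ι → Prop} {F : Matrix ι ι ℂ →ₗ[ℂ] ℂ}
    {x : Matrix ι ι ℂ}
    (h : ∀ k l, R k l → F (x * Matrix.single k l 1 - Matrix.single k l 1 * x) = 0) :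
    ∀ y ∈ supported R, F (x * y - y * x) = 0 := by
  intro y hy
  have h2 : F (x * y - y * x) = (F ∘ₗ (LinearMap.mulLeft ℂ x - LinearMap.mulRight ℂ x)) y := by
    simp
  rw [h2, Matrix.matrix_eq_sum_single y]
  simp only [map_sum]
  refine Finset.sum_eq_zero fun i _ => Finset.sum_eq_zero fun j _ => ?_
  by_cases hij : R i j
  · have h4 : Matrix.single i j (y i j) = y i j • Matrix.single i j (1 : ℂ) := by simp
    rw [h4, map_smul]
    simp only [LinearMap.comp_apply, LinearMap.sub_apply, LinearMap.mulLeft_apply,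
      LinearMap.mulRight_apply, h i j hij, smul_zero]
  · rw [hy i j hij]
    simp

/-- Conjugation by an invertible matrix compatible with the relation preserves index one. -/
theorem IndexOne.conj {R : ι → ι → Prop} (hR : ∀ i j k, R i j → R j k → R i k)
    (hl : ∀ i j, R i j → R i i) (hr : ∀ i j, R i j → R j j) {F : Matrix ι ι ℂ →ₗ[ℂ] ℂ}
    (hF : IndexOne R F) {u u' : Matrix ι ι ℂ} (huu' : u * u' = 1)
    (hu : ∀ i j, i ≠ j → ¬ R i j → u i j = 0) (hu' : ∀ i j, i ≠ j → ¬ R i j → u' i j = 0) :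
    IndexOne R (F ∘ₗ LinearMap.mulLeft ℂ u ∘ₗ LinearMap.mulRight ℂ u') := by
  classical
  have hu'u : u' * u = 1 := mul_eq_one_comm.1 huu'
  have hcl : ∀ v x : Matrix ι ι ℂ, (∀ i j, i ≠ j → ¬ R i j → v i j = 0) → x ∈ supported R →
      v * x ∈ supported R := by
    intro v x hv hx i k hik
    rw [Matrix.mul_apply]
    refine Finset.sum_eq_zero fun j _ => ?_
    by_contra h
    have h1 := rel_of_ne_zero hx (right_ne_zero_of_mul h)
    by_cases hij : i = j
    · exact hik (hij ▸ h1)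
    · refine left_ne_zero_of_mul h (hv i j hij fun h2 => hik (hR i j k h2 h1))
  have hcr : ∀ v x : Matrix ι ι ℂ, (∀ i j, i ≠ j → ¬ R i j → v i j = 0) → x ∈ supported R →
      x * v ∈ supported R := by
    intro v x hv hx i k hik
    rw [Matrix.mul_apply]
    refine Finset.sum_eq_zero fun j _ => ?_
    by_contra h
    have h1 := rel_of_ne_zero hx (left_ne_zero_of_mul h)
    by_cases hjk : j = k
    · exact hik (hjk ▸ h1)
    · refine right_ne_zero_of_mul h (hv j k hjk fun h2 => hik (hR i j k h1 h2))
  intro x hx hker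
  set X := u * x * u' with hX
  have hXR : X ∈ supported R := hcr _ _ hu' (hcl _ _ hu hx)
  obtain ⟨h1, h2⟩ := hF X hXR (by
    intro Y hY
    have h3 := hker (u' * Y * u) (hcr _ _ hu (hcl _ _ hu' hY))
    simp only [LinearMap.comp_apply, LinearMap.mulLeft_apply, LinearMap.mulRight_apply] at h3
    have h4 : u * ((x * (u' * Y * u) - u' * Y * u * x) * u') =
        X * Y * (u * u') - (u * u') * Y * X := by
      rw [hX]; noncomm_ring
    rwa [h4, huu', mul_one, one_mul] at h3)
  -- The scalars of the algebra are the multiples of `D`, the identity on the indices in use. It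
  -- commutes with `u`, so conjugating back changes nothing.
  set D : Matrix ι ι ℂ := Matrix.diagonal fun i => if R i i then 1 else 0 with hD
  have hDu : D * u = u * D := by
    ext i j
    rw [hD, Matrix.diagonal_mul, Matrix.mul_diagonal]
    by_cases hij : i = j
    · rw [hij, mul_comm]
    · by_cases h3 : R i j
      · rw [if_pos (hl i j h3), if_pos (hr i j h3), mul_comm]
      · rw [hu i j hij h3, mul_zero, zero_mul]
  obtain ⟨c, hc⟩ : ∃ c : ℂ, X = c • D := by
    by_cases h3 : ∃ i, R i i
    · obtain ⟨i₀, hi₀⟩ := h3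
      refine ⟨X i₀ i₀, ?_⟩
      ext i j
      rw [Matrix.smul_apply, hD, smul_eq_mul]
      by_cases hij : i = j
      · subst hij
        rw [Matrix.diagonal_apply_eq]
        split_ifs with h4
        · rw [mul_one, h2 i i₀ h4 hi₀]
        · rw [mul_zero, hXR i i h4]
      · rw [Matrix.diagonal_apply_ne _ hij, mul_zero, h1 i j hij]
    · refine ⟨0, ?_⟩
      ext i j
      rw [zero_smul, Matrix.zero_apply]
      exact hXR i j fun h4 => h3 ⟨i, hl i j h4⟩
  have hx' : x = c • D := by
    calc x = (u' * u) * x * (u' * u) := by rw [hu'u, one_mul, mul_one]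
      _ = u' * X * u := by rw [hX]; noncomm_ring
      _ = c • (u' * (D * u)) := by rw [hc]; simp [mul_assoc]
      _ = c • D := by rw [hDu, ← mul_assoc, hu'u, one_mul]
  rw [hx']
  refine ⟨fun i j hij => by simp [hD, hij], fun i j hi hj => by simp [hD, hi, hj]⟩

variable {s : Finset ι} {α β : ι → ℕ} {a b : ℕ}

lemma seaweedRel_left {i j : ι} (h : seaweedRel s α β i j) : seaweedRel s α β i i :=
  ⟨h.1, h.1, le_rfl, le_rfl⟩

lemma seaweedRel_right {i j : ι} (h : seaweedRel s α β i j) : seaweedRel s α β j j :=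
  ⟨h.2.1, h.2.1, le_rfl, le_rfl⟩

/-- The configuration in which the first block `O` of `β` is properly contained in the first block
`O ∪ U` of `α`. -/
structure FirstBlocks (s : Finset ι) (α β : ι → ℕ) (O U : Finset ι) (a b : ℕ) : Prop where
  comono : ∀ i ∈ s, ∀ j ∈ s, α i < α j → β i ≤ β j
  β_min : ∀ i ∈ s, b ≤ β i
  α_min : ∀ i ∈ s, a ≤ α i
  mem_O : ∀ i, i ∈ O ↔ i ∈ s ∧ β i = b
  α_O : ∀ i ∈ O, α i = a
  mem_U : ∀ i, i ∈ U ↔ i ∈ s ∧ i ∉ O ∧ α i = a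
  O_ne : O.Nonempty
  U_ne : U.Nonempty

namespace FirstBlocks

variable {O U : Finset ι}

lemma rel_O (h : FirstBlocks s α β O U a b) {i j : ι} (hij : seaweedRel s α β i j)
    (hi : i ∈ O) : j ∈ O := by
  rw [h.mem_O]
  have h1 := ((h.mem_O i).1 hi).2
  have h2 := h.β_min j hij.2.1
  have h3 := hij.2.2.2
  exact ⟨hij.2.1, by omega⟩

lemma rel_U (h : FirstBlocks s α β O U a b) {i j : ι} (hij : seaweedRel s α β i j)
    (hj : j ∈ U) : i ∈ U := by
  rw [h.mem_U] at hj ⊢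
  have h2 := h.α_min i hij.1
  have h3 := hij.2.2.1
  exact ⟨hij.1, fun hi => hj.2.1 (h.rel_O hij hi), by omega⟩

lemma rel_OO (h : FirstBlocks s α β O U a b) {i j : ι} (hi : i ∈ O) (hj : j ∈ O) :
    seaweedRel s α β i j :=
  ⟨((h.mem_O i).1 hi).1, ((h.mem_O j).1 hj).1, by rw [h.α_O i hi, h.α_O j hj],
    by rw [((h.mem_O i).1 hi).2, ((h.mem_O j).1 hj).2]⟩

lemma rel_UO (h : FirstBlocks s α β O U a b) {i j : ι} (hi : i ∈ U) (hj : j ∈ O) :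
    seaweedRel s α β i j :=
  ⟨((h.mem_U i).1 hi).1, ((h.mem_O j).1 hj).1, by rw [h.α_O j hj, ((h.mem_U i).1 hi).2.2],
    by rw [((h.mem_O j).1 hj).2]; exact h.β_min i ((h.mem_U i).1 hi).1⟩

/-- The values of `F` on the abelian ideal, as a family of vectors indexed by the rows. -/
def vec (F : Matrix ι ι ℂ →ₗ[ℂ] ℂ) (O : Finset ι) (i : ι) (j : O) : ℂ := F (Matrix.single i j.1 1)

/-- If the vectors from `T` satisfy a linear relation `c` and are all killed by a nonzero form `f`,
the rank-one matrix `c ⊗ f` in the ideal lies in the kernel of the Kirillov form. It is nonzero and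
off-diagonal, against index one. That `T` is closed upwards in `β` keeps the row of a test unit
inside `T`. -/
lemma linearIndepOn_or_span_eq_top (h : FirstBlocks s α β O U a b) {F : Matrix ι ι ℂ →ₗ[ℂ] ℂ}
    (hF : IndexOne (seaweedRel s α β) F) (T : Finset ι) (hTU : T ⊆ U)
    (hT : ∀ k ∈ U, ∀ i ∈ T, β i ≤ β k → k ∈ T) :
    LinearIndepOn ℂ (vec F O) (T : Set ι) ∨
      Submodule.span ℂ (vec F O '' (T : Set ι)) = ⊤ := by
  by_contra hcon
  push Not at hcon
  obtain ⟨h1, h2⟩ := hcon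
  rw [linearIndepOn_finset_iff] at h1
  push Not at h1
  obtain ⟨c, hc, i₀, hi₀, hci₀⟩ := h1
  obtain ⟨f, hf, hfker⟩ := Submodule.exists_le_ker_of_lt_top _ (lt_top_iff_ne_top.2 h2)
  have hfv : ∀ i ∈ T, f (vec F O i) = 0 := fun i hi =>
    hfker (Submodule.subset_span ⟨i, hi, rfl⟩)
  have hfsum : ∀ v : O → ℂ, f v = ∑ j : O, v j * f (Pi.single j 1) := fun v => by
    conv_lhs => rw [pi_eq_sum_univ' v]
    simp [map_sum]
  let ν : Matrix ι ι ℂ := Matrix.of fun i j =>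
    if i ∈ T then (if hj : j ∈ O then c i * f (Pi.single ⟨j, hj⟩ 1) else 0) else 0
  have hν : ∀ i j, ν i j =
      if i ∈ T then (if hj : j ∈ O then c i * f (Pi.single ⟨j, hj⟩ 1) else 0) else 0 :=
    fun _ _ => rfl
  have hνR : ν ∈ supported (seaweedRel s α β) := by
    intro i j hij
    rw [hν]
    split_ifs with h3 h4
    · exact absurd (h.rel_UO (hTU h3) h4) hij
    · rfl
    · rfl
  have hker := hF ν hνR (apply_bracket_eq_zero_of_single fun k l hkl => by
    rw [map_sub, apply_mul_single, apply_single_mul]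
    have e1 : ∑ i, ν i k * F (Matrix.single i l 1) = 0 := by
      by_cases hk : k ∈ O
      · have hl := h.rel_O hkl hk
        have h3 := congrFun hc ⟨l, hl⟩
        rw [Finset.sum_apply] at h3
        rw [← Finset.sum_subset (Finset.subset_univ T)]
        · calc _ = f (Pi.single ⟨k, hk⟩ 1) * ∑ i ∈ T, (c i • vec F O i) ⟨l, hl⟩ := by
                rw [Finset.mul_sum]
                refine Finset.sum_congr rfl fun i hi => ?_
                rw [hν, if_pos hi, dif_pos hk, Pi.smul_apply, smul_eq_mul, vec]
                ring
            _ = 0 := by rw [h3, Pi.zero_apply, mul_zero]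
        · intro i _ hi
          rw [hν, if_neg hi, zero_mul]
      · refine Finset.sum_eq_zero fun i _ => ?_
        rw [hν, dif_neg hk, ite_self, zero_mul]
    have e2 : ∑ j, ν l j * F (Matrix.single k j 1) = 0 := by
      by_cases hl : l ∈ T
      · have hk : k ∈ T := hT k (h.rel_U hkl (hTU hl)) l hl hkl.2.2.2
        have h3 := hfv k hk
        rw [hfsum] at h3
        rw [← Finset.sum_subset (Finset.subset_univ O), ← Finset.sum_coe_sort O]
        · calc _ = c l * ∑ j : O, vec F O k j * f (Pi.single j 1) := by
                rw [Finset.mul_sum]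
                refine Finset.sum_congr rfl fun j _ => ?_
                rw [hν, if_pos hl, dif_pos j.2, vec]
                ring
            _ = 0 := by rw [h3, mul_zero]
        · intro j _ hj
          rw [hν, dif_neg hj, ite_self, zero_mul]
      · refine Finset.sum_eq_zero fun j _ => ?_
        rw [hν, if_neg hl, zero_mul]
    rw [e1, e2, sub_zero])
  apply hf
  ext j
  have h3 := hker.1 i₀ j (by
    rintro rfl
    exact ((h.mem_U _).1 (hTU hi₀)).2.1 j.2)
  rw [hν, if_pos hi₀, dif_pos j.2] at h3
  simpa using (mul_eq_zero.1 h3).resolve_left hci₀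

/-- A basis of the span of the vectors, chosen greedily from the last blocks of `β`. -/
lemma exists_greedy (h : FirstBlocks s α β O U a b) {F : Matrix ι ι ℂ →ₗ[ℂ] ℂ}
    (hF : IndexOne (seaweedRel s α β) F) :
    ∃ S ⊆ U, S.Nonempty ∧ LinearIndepOn ℂ (vec F O) (S : Set ι) ∧
      (S = U ∨ Submodule.span ℂ (vec F O '' (S : Set ι)) = ⊤) ∧
      ∀ i ∈ U, i ∉ S → ∀ j ∈ S, β i ≤ β j := by
  classical
  by_cases htop : Submodule.span ℂ (vec F O '' (U : Set ι)) = ⊤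
  swap
  · exact ⟨U, subset_rfl, h.U_ne, (h.linearIndepOn_or_span_eq_top hF U subset_rfl
      fun k hk _ _ _ => hk).resolve_right htop, Or.inl rfl, fun i hi hi' => absurd hi hi'⟩
  have hbot : Submodule.span ℂ (vec F O '' ((∅ : Finset ι) : Set ι)) ≠ ⊤ := by
    obtain ⟨j, hj⟩ := h.O_ne
    have : Nonempty O := ⟨⟨j, hj⟩⟩
    simp
  let U' : ℕ → Finset ι := fun t => U.filter fun i => t ≤ β i
  have hex : ∃ t, Submodule.span ℂ (vec F O '' (U' t : Set ι)) ≠ ⊤ := by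
    refine ⟨U.sup β + 1, ?_⟩
    have : U' (U.sup β + 1) = ∅ := by
      refine Finset.filter_eq_empty_iff.2 fun i hi => ?_
      have := Finset.le_sup (f := β) hi
      omega
    rw [this]
    exact hbot
  -- At this threshold the rows with `t ≤ β i` still span, but those with `t + 1 ≤ β i` do not. The
  -- latter are independent and get completed to a basis from the layer `β i = t`, so every omitted
  -- row has `β i ≤ t`.
  obtain ⟨t, ht, ht1⟩ : ∃ t, Submodule.span ℂ (vec F O '' (U' t : Set ι)) = ⊤ ∧
      Submodule.span ℂ (vec F O '' (U' (t + 1) : Set ι)) ≠ ⊤ := by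
    obtain ⟨m, hm⟩ : ∃ m, Nat.find hex = m + 1 := by
      refine Nat.exists_eq_succ_of_ne_zero fun h0 => ?_
      have h1 := Nat.find_spec hex
      rw [h0] at h1
      refine h1 ?_
      have : U' 0 = U := by simp [U']
      rwa [this]
    refine ⟨m, ?_, hm ▸ Nat.find_spec hex⟩
    by_contra h1
    exact Nat.find_min hex (by omega) h1
  have hind := (h.linearIndepOn_or_span_eq_top hF (U' (t + 1)) (Finset.filter_subset _ _) (by
    intro k hk i hi hik
    rw [Finset.mem_filter] at hi ⊢
    exact ⟨hk, by omega⟩)).resolve_right ht1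
  obtain ⟨B, hBt, hB, hspan, hBind⟩ := exists_linearIndepOn_extension hind
    (t := (U' t : Set ι)) (by
      intro i hi
      simp only [U', Finset.coe_filter, Set.mem_ofPred_eq] at hi ⊢
      exact ⟨hi.1, by omega⟩)
  have hBS : (B.toFinite.toFinset : Set ι) = B := Set.Finite.coe_toFinset _
  have htopB : Submodule.span ℂ (vec F O '' B) = ⊤ :=
    top_le_iff.1 (ht ▸ Submodule.span_le.2 hspan)
  refine ⟨B.toFinite.toFinset, ?_, ?_, ?_, Or.inr ?_, ?_⟩
  · intro i hi
    have := hBt (B.toFinite.mem_toFinset.1 hi)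
    exact (Finset.mem_filter.1 this).1
  · rw [Finset.nonempty_iff_ne_empty]
    intro h1
    rw [h1] at hBS
    rw [← hBS] at htopB
    exact hbot htopB
  · rwa [hBS]
  · rwa [hBS]
  · intro i hi hiB j hj
    have h1 := (Finset.mem_filter.1 (hBt (B.toFinite.mem_toFinset.1 hj))).2
    have h2 : ¬ t + 1 ≤ β i := fun h3 => hiB (B.toFinite.mem_toFinset.2
      (hB (Finset.mem_coe.2 (Finset.mem_filter.2 ⟨hi, h3⟩))))
    omega

end FirstBlocks

end NormalForm

/-! ### Normalizing the functional: construction of the reduction data -/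

section NormalForm

variable {ι : Type*} [DecidableEq ι] [Fintype ι]

/-- The extension of a matrix on `O` by the identity. -/
def extendByOne (O : Finset ι) (M : Matrix O O ℂ) : Matrix ι ι ℂ :=
  Matrix.of fun i j => if h : i ∈ O ∧ j ∈ O then M ⟨i, h.1⟩ ⟨j, h.2⟩ else if i = j then 1 else 0

lemma extendByOne_apply (O : Finset ι) (M : Matrix O O ℂ) (i j : ι) : extendByOne O M i j =
    if h : i ∈ O ∧ j ∈ O then M ⟨i, h.1⟩ ⟨j, h.2⟩ else if i = j then 1 else 0 := rfl

lemma extendByOne_one (O : Finset ι) : extendByOne O (1 : Matrix O O ℂ) = 1 := by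
  ext i j
  rw [extendByOne_apply]
  split_ifs with h1 h2
  · simp only [Matrix.one_apply, Subtype.mk.injEq]
  · rw [h2, Matrix.one_apply_eq]
  · rw [Matrix.one_apply_ne h2]

lemma extendByOne_mul (O : Finset ι) (M N : Matrix O O ℂ) :
    extendByOne O M * extendByOne O N = extendByOne O (M * N) := by
  ext i k
  rw [Matrix.mul_apply, extendByOne_apply]
  by_cases hi : i ∈ O
  · rw [← Finset.sum_subset (Finset.subset_univ O)]
    · by_cases hk : k ∈ O
      · rw [dif_pos ⟨hi, hk⟩, Matrix.mul_apply, ← Finset.sum_coe_sort O]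
        refine Finset.sum_congr rfl fun j _ => ?_
        rw [extendByOne_apply, extendByOne_apply, dif_pos ⟨hi, j.2⟩, dif_pos ⟨j.2, hk⟩]
      · rw [dif_neg (fun h => hk h.2), if_neg (fun h : i = k => hk (h ▸ hi))]
        refine Finset.sum_eq_zero fun j hj => ?_
        rw [extendByOne_apply O N, dif_neg (fun h => hk h.2), if_neg (fun h : j = k => hk (h ▸ hj)),
          mul_zero]
    · intro j _ hj
      rw [extendByOne_apply O M, dif_neg (fun h => hj h.2), if_neg (fun h : i = j => hj (h ▸ hi)), zero_mul]
  · rw [dif_neg (fun h => hi h.1), Finset.sum_eq_single i]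
    · rw [extendByOne_apply, extendByOne_apply, dif_neg (fun h => hi h.1), dif_neg
        (fun h => hi h.1), if_pos rfl, one_mul]
    · intro j _ hj
      rw [extendByOne_apply O M, dif_neg (fun h => hi h.1), if_neg hj.symm, zero_mul]
    · simp

namespace FirstBlocks

variable {s : Finset ι} {α β : ι → ℕ} {a b : ℕ} {O U : Finset ι}

/-- Two conjugations suffice. One in the `O × O` block sends the vectors of `S` to unit vectors,
which defines `p`; the other subtracts combinations of these from the vectors of `U \ S`, which the
relation allows because `U \ S` precedes `S` in `β`. -/
theorem exists_reduction (h : FirstBlocks s α β O U a b) {F : Matrix ι ι ℂ →ₗ[ℂ] ℂ}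
    (hF : IndexOne (seaweedRel s α β) F) :
    ∃ (S K : Finset ι) (p : ι → ι) (F' : Matrix ι ι ℂ →ₗ[ℂ] ℂ), Reduction s α β O S K p a b ∧
      Reduction.IsNormal O S K p F' ∧ IndexOne (seaweedRel s α β) F' := by
  classical
  obtain ⟨S, hSU, hSne, hind, hfull, hle⟩ := h.exists_greedy hF
  have hUO : ∀ i ∈ U, i ∉ O := fun i hi => ((h.mem_U i).1 hi).2.1
  obtain ⟨g, q, hq, hgq⟩ := exists_equiv_single (w := fun i : (S : Set ι) => vec F O i) hind
  obtain ⟨p, hpq, hpn⟩ : ∃ p : ι → ι, (∀ i, p (q i) = i) ∧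
      ∀ j, (¬ ∃ i, (q i : ι) = j) → p j = j := by
    refine ⟨fun j => if h1 : ∃ i, (q i : ι) = j then h1.choose else j, fun i => ?_, fun j hj => ?_⟩
    · have h1 : ∃ i', (q i' : ι) = q i := ⟨i, rfl⟩
      simp only [dif_pos h1]
      exact congrArg _ (hq (Subtype.ext h1.choose_spec))
    · simp only [dif_neg hj]
  have hcases : ∀ j ∈ O, (∃ i : (S : Set ι), (q i : ι) = j ∧ p j = i) ∨ p j = j := by
    intro j _
    by_cases h1 : ∃ i, (q i : ι) = j
    · obtain ⟨i, rfl⟩ := h1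
      exact Or.inl ⟨i, rfl, hpq i⟩
    · exact Or.inr (hpn j h1)
  have hpinj : ∀ i ∈ O, ∀ j ∈ O, p i = p j → i = j := by
    intro i hi j hj hij
    rcases hcases i hi with ⟨i', h1, h2⟩ | h1 <;> rcases hcases j hj with ⟨j', h3, h4⟩ | h3
    · rw [h2, h4] at hij
      rw [← h1, ← h3, Subtype.ext hij]
    · rw [h2, h3] at hij
      exact absurd (hij ▸ hj) (hUO _ (hSU i'.2))
    · rw [h1, h4] at hij
      exact absurd (hij ▸ hi) (hUO _ (hSU j'.2))
    · rw [h1, h3] at hij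
      exact hij
  have hK : U \ S = ∅ ∨ ∀ j ∈ O, p j ∈ S := by
    rcases hfull with h1 | h1
    · left; rw [h1, Finset.sdiff_self]
    · right
      rw [Set.image_eq_range] at h1
      -- The vectors of `S` form a basis, so by counting `q` is bijective and every index of `O` is
      -- matched.
      have hb := Module.finrank_eq_card_basis (Module.Basis.mk hind (top_le_iff.2 h1))
      rw [Module.finrank_fintype_fun_eq_card] at hb
      have hsurj := ((Fintype.bijective_iff_injective_and_card q).2 ⟨hq, hb.symm⟩).2
      intro j hj
      obtain ⟨i, hi⟩ := hsurj ⟨j, hj⟩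
      have := hpq i
      rw [hi] at this
      rw [this]
      exact i.2
  have hred : Reduction s α β O S (U \ S) p a b :=
    { comono := h.comono
      O_sub := fun i hi => ((h.mem_O i).1 hi).1
      mem_O := fun i hi => by rw [h.mem_O]; simp [hi]
      β_min := h.β_min
      α_min := h.α_min
      α_O := h.α_O
      mem_SK := fun i => by
        rw [← h.mem_U, Finset.mem_sdiff]
        constructor
        · rintro (h1 | h1)
          · exact hSU h1
          · exact h1.1
        · intro h1
          by_cases h2 : i ∈ S
          · exact Or.inl h2
          · exact Or.inr ⟨h1, h2⟩
      disj := fun i hi h1 => (Finset.mem_sdiff.1 h1).2 hi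
      S_ne := hSne
      p_inj := hpinj
      p_mem := fun j hj => by
        rcases hcases j hj with ⟨i, -, h2⟩ | h1
        · exact Or.inl (h2 ▸ i.2)
        · exact Or.inr h1
      p_surj := fun i hi => ⟨q ⟨i, hi⟩, (q ⟨i, hi⟩).2, hpq ⟨i, hi⟩⟩
      full := hK
      le := fun i hi => hle i (Finset.mem_sdiff.1 hi).1 (Finset.mem_sdiff.1 hi).2 }
  have hgv : ∀ i : (S : Set ι), ∀ j : O, g (vec F O i) j = if p j = i then 1 else 0 := by
    intro i j
    rw [hgq i, Pi.single_apply]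
    refine if_congr ⟨?_, ?_⟩ rfl rfl
    · rintro rfl; exact hpq i
    · intro h1
      exact Subtype.ext (hpinj _ j.2 _ (q i).2 (h1.trans (hpq i).symm))
  -- the base change by the inverse of `g` on `O`
  set G := LinearMap.toMatrix' g.toLinearMap with hG
  set H := LinearMap.toMatrix' g.symm.toLinearMap with hH
  have hHG : H * G = 1 := by
    rw [hG, hH, ← LinearMap.toMatrix'_comp]
    simp
  have hne : ∀ M : Matrix O O ℂ, ∀ i j, i ≠ j → ¬ seaweedRel s α β i j →
      extendByOne O M i j = 0 := by
    intro M i j hij hR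
    rw [extendByOne_apply, dif_neg (fun h1 => hR (h.rel_OO h1.1 h1.2)), if_neg hij]
  have hF₁ := hF.conj seaweedRel_trans (fun _ _ => seaweedRel_left) (fun _ _ => seaweedRel_right)
    (u := extendByOne O H) (u' := extendByOne O G)
    (by rw [extendByOne_mul, hHG, extendByOne_one]) (hne H) (hne G)
  set F₁ := F ∘ₗ LinearMap.mulLeft ℂ (extendByOne O H) ∘ₗ LinearMap.mulRight ℂ (extendByOne O G)
    with hF₁def
  have hF₁val : ∀ i ∈ U, ∀ j : O, F₁ (Matrix.single i j.1 1) = g (vec F O i) j := by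
    intro i hi j
    have h1 : extendByOne O H * Matrix.single i j.1 1 = Matrix.single i j.1 1 := by
      ext k l
      rw [Matrix.mul_apply, Finset.sum_eq_single i]
      · rw [extendByOne_apply, dif_neg (fun h2 => hUO i hi h2.2)]
        by_cases hki : k = i
        · simp [hki]
        · rw [if_neg hki, zero_mul, Matrix.single_apply, if_neg (fun h2 => hki h2.1.symm)]
      · intro m _ hm
        rw [Matrix.single_apply, if_neg (fun h2 => hm h2.1.symm), mul_zero]
      · simp
    rw [hF₁def, LinearMap.comp_apply, LinearMap.comp_apply, LinearMap.mulRight_apply,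
      LinearMap.mulLeft_apply, ← mul_assoc, h1, apply_single_mul,
      ← Finset.sum_subset (Finset.subset_univ O), ← Finset.sum_coe_sort O]
    · have h2 : g (vec F O i) = Matrix.mulVec G (vec F O i) := by
        rw [← Matrix.toLin'_apply, hG, Matrix.toLin'_toMatrix']
        rfl
      rw [h2, Matrix.mulVec, dotProduct]
      refine Finset.sum_congr rfl fun l _ => ?_
      rw [extendByOne_apply, dif_pos ⟨j.2, l.2⟩, vec]
    · intro l _ hl
      rw [extendByOne_apply, dif_neg (fun h2 => hl h2.2), if_neg (fun h2 : j.1 = l => hl (h2 ▸ j.2)),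
        zero_mul]
  clear_value F₁
  have hF₁S : ∀ i ∈ S, ∀ j ∈ O, F₁ (Matrix.single i j 1) = if p j = i then 1 else 0 :=
    fun i hi j hj => by rw [hF₁val i (hSU hi) ⟨j, hj⟩, hgv ⟨i, hi⟩ ⟨j, hj⟩]
  -- the base change that clears the rows in `U \ S`
  let W : Matrix ι ι ℂ := Matrix.of fun k i => if k ∈ S ∧ i ∈ U \ S then
    -∑ j ∈ O, (if p j = k then F₁ (Matrix.single i j 1) else 0) else 0
  have hW : ∀ k i, W k i = if k ∈ S ∧ i ∈ U \ S then
    -∑ j ∈ O, (if p j = k then F₁ (Matrix.single i j 1) else 0) else 0 := fun _ _ => rfl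
  have hWW : W * W = 0 := by
    ext k i
    rw [Matrix.mul_apply, Matrix.zero_apply]
    refine Finset.sum_eq_zero fun m _ => ?_
    by_cases hm : m ∈ S
    · rw [hW k m, if_neg (fun h1 => (Finset.mem_sdiff.1 h1.2).2 hm), zero_mul]
    · rw [hW m i, if_neg (fun h1 => hm h1.1), mul_zero]
  have hWne : ∀ i j, ¬ seaweedRel s α β i j → W i j = 0 := by
    intro i j hij
    rw [hW, if_neg]
    rintro ⟨h1, h2⟩
    have h3 := hred.S_sub h1
    have h4 := hred.K_sub h2
    exact hij ⟨h3.1, h4.1, by rw [h3.2.2, h4.2.2], hred.le j h2 i h1⟩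
  refine ⟨S, U \ S, p, _, hred, ?_, hF₁.conj seaweedRel_trans (fun _ _ => seaweedRel_left)
    (fun _ _ => seaweedRel_right) (u := 1 + W) (u' := 1 - W)
    (by rw [add_mul, one_mul, mul_sub, mul_one, hWW]; simp)
    (fun i j hij hR => by rw [Matrix.add_apply, Matrix.one_apply_ne hij, hWne i j hR, add_zero])
    (fun i j hij hR => by rw [Matrix.sub_apply, Matrix.one_apply_ne hij, hWne i j hR, sub_zero])⟩
  intro i hi j hj
  have h1 : Matrix.single i j (1 : ℂ) * W = 0 := by
    ext k l
    rw [Matrix.mul_apply, Matrix.zero_apply]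
    refine Finset.sum_eq_zero fun m _ => ?_
    by_cases hm : m = j
    · rw [hm, hW j l, if_neg (fun h2 => (hred.S_sub h2.1).2.1 hj), mul_zero]
    · rw [Matrix.single_apply, if_neg (fun h2 => hm h2.2.symm), zero_mul]
  rw [LinearMap.comp_apply, LinearMap.comp_apply, LinearMap.mulRight_apply,
    LinearMap.mulLeft_apply, mul_sub, h1, sub_zero, mul_one, add_mul, one_mul, map_add,
    apply_mul_single]
  rcases hi with hi | hi
  · rw [hF₁S i hi j hj, Finset.sum_eq_zero, add_zero]
    intro k _
    rw [hW, if_neg (fun h2 => hred.disj i hi h2.2), zero_mul]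
  · have hpS : p j ∈ S := by
      rcases hK with h2 | h2
      · simp [h2] at hi
      · exact h2 j hj
    rw [if_neg (fun h2 : p j = i => hred.disj _ hpS (h2 ▸ hi)), Finset.sum_eq_single (p j)]
    · rw [hF₁S _ hpS j hj, if_pos rfl, mul_one, hW, if_pos ⟨hpS, hi⟩, hred.sum_p hj, add_neg_cancel]
    · intro k _ hk
      by_cases hkS : k ∈ S
      · rw [hF₁S k hkS j hj, if_neg hk.symm, mul_zero]
      · rw [hW, if_neg (fun h2 => hkS h2.1), zero_mul]
    · simp

end FirstBlocks

end NormalForm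

/-! ### Transposition, the base case and the induction -/

section Induction

variable {ι : Type*} [DecidableEq ι] [Fintype ι]

lemma transpose_mem_supported {s : Finset ι} {α β : ι → ℕ} {x : Matrix ι ι ℂ}
    (hx : x ∈ supported (seaweedRel s α β)) : x.transpose ∈ supported (seaweedRel s β α) :=
  fun i j hij => hx j i fun h => hij ⟨h.2.1, h.1, h.2.2.2, h.2.2.1⟩

/-- The functional on the transposed matrices. -/
def transposeFunctional (F : Matrix ι ι ℂ →ₗ[ℂ] ℂ) : Matrix ι ι ℂ →ₗ[ℂ] ℂ :=
  F ∘ₗ (Matrix.transposeLinearEquiv ι ι ℂ ℂ).toLinearMap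

lemma transposeFunctional_apply (F : Matrix ι ι ℂ →ₗ[ℂ] ℂ) (x : Matrix ι ι ℂ) :
    transposeFunctional F x = F x.transpose := rfl

lemma IndexOne.transpose {s : Finset ι} {α β : ι → ℕ} {F : Matrix ι ι ℂ →ₗ[ℂ] ℂ}
    (hF : IndexOne (seaweedRel s α β) F) :
    IndexOne (seaweedRel s β α) (transposeFunctional F) := by
  intro x hx hker
  obtain ⟨h1, h2⟩ := hF x.transpose (transpose_mem_supported hx) (by
    intro y hy
    have h3 := hker y.transpose (transpose_mem_supported hy)
    rw [transposeFunctional_apply] at h3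
    have h4 : (x * y.transpose - y.transpose * x).transpose =
        -(x.transpose * y - y * x.transpose) := by
      simp [Matrix.transpose_sub, Matrix.transpose_mul]
    rwa [h4, map_neg, neg_eq_zero] at h3)
  exact ⟨fun i j hij => h1 j i hij.symm, fun i j hi hj =>
    h2 i j ⟨hi.1, hi.1, le_rfl, le_rfl⟩ ⟨hj.1, hj.1, le_rfl, le_rfl⟩⟩

lemma IsPrincipalDiagonal.transpose {s : Finset ι} {α β : ι → ℕ} {F : Matrix ι ι ℂ →ₗ[ℂ] ℂ}
    {d : ι → ℤ} (hF : IsPrincipalDiagonal (seaweedRel s α β) F d) :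
    IsPrincipalDiagonal (seaweedRel s β α) (transposeFunctional F) fun i => -d i := by
  intro y hy
  rw [transposeFunctional_apply, transposeFunctional_apply,
    ← hF _ (transpose_mem_supported hy)]
  congr 1
  ext i j
  simp only [Matrix.transpose_apply, Matrix.sub_apply, Matrix.diagonal_mul, Matrix.mul_diagonal]
  push_cast
  ring

/-- A block of full matrices has index one only if it has size one. -/
lemma eq_of_indexOne_of_const {s : Finset ι} {α β : ι → ℕ} {F : Matrix ι ι ℂ →ₗ[ℂ] ℂ}
    (hF : IndexOne (seaweedRel s α β) F) (hR : ∀ i ∈ s, ∀ j ∈ s, seaweedRel s α β i j) :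
    ∀ i ∈ s, ∀ j ∈ s, i = j := by
  -- `x` represents `F` through the trace form, so it lies in the kernel of the Kirillov form. It is
  -- therefore scalar, and `F` is a multiple of the trace.
  let x : Matrix ι ι ℂ := Matrix.of fun i j => if i ∈ s ∧ j ∈ s then F (Matrix.single j i 1) else 0
  have hx : ∀ i j, x i j = if i ∈ s ∧ j ∈ s then F (Matrix.single j i 1) else 0 := fun _ _ => rfl
  obtain ⟨h1, h2⟩ := hF x (fun i j hij => by rw [hx, if_neg fun h => hij (hR i h.1 j h.2)])
    (apply_bracket_eq_zero_of_single fun k l hkl => by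
      rw [map_sub, apply_mul_single, apply_single_mul, sub_eq_zero]
      refine Finset.sum_congr rfl fun i _ => ?_
      rw [hx, hx]
      by_cases hi : i ∈ s
      · rw [if_pos ⟨hi, hkl.1⟩, if_pos ⟨hkl.2.1, hi⟩, mul_comm]
      · rw [if_neg fun h => hi h.1, if_neg fun h => hi h.2, zero_mul, zero_mul])
  have h3 : ∀ k ∈ s, ∀ l ∈ s, k ≠ l → F (Matrix.single k l 1) = 0 := fun k hk l hl hkl => by
    have := h1 l k hkl.symm
    rwa [hx, if_pos ⟨hl, hk⟩] at this
  have h4 : ∀ k ∈ s, ∀ l ∈ s, F (Matrix.single k k 1) = F (Matrix.single l l 1) :=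
    fun k hk l hl => by
      have := h2 k l (hR k hk k hk) (hR l hl l hl)
      rwa [hx, hx, if_pos ⟨hk, hk⟩, if_pos ⟨hl, hl⟩] at this
  intro i hi j hj
  by_contra hij
  -- A multiple of the trace kills all brackets, so an off-diagonal unit would lie in the kernel.
  have h5 := (hF (Matrix.single i j 1) (single_mem_supported (hR i hi j hj) 1)
    (apply_bracket_eq_zero_of_single fun k l hkl => by
      by_cases hjk : j = k
      · subst hjk
        by_cases hil : i = l
        · subst hil
          rw [Matrix.single_mul_single_same, Matrix.single_mul_single_same, map_sub, mul_one,
            h4 i hi j hj, sub_self]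
        · rw [Matrix.single_mul_single_same, Matrix.single_mul_single_of_ne (h := Ne.symm hil),
            sub_zero, mul_one, h3 i hi l hkl.2.1 hil]
      · rw [Matrix.single_mul_single_of_ne (h := hjk)]
        by_cases hil : i = l
        · subst hil
          rw [Matrix.single_mul_single_same, zero_sub, map_neg, mul_one,
            h3 k hkl.1 j hj (Ne.symm hjk), neg_zero]
        · rw [Matrix.single_mul_single_of_ne (h := Ne.symm hil), sub_zero, map_zero])).1 i j hij
  simp at h5

lemma rest_card_lt {s O S K : Finset ι} {α β : ι → ℕ} {p : ι → ι} {a b : ℕ}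
    (h : Reduction s α β O S K p a b) : (rest s O p).card < s.card := by
  refine Finset.card_lt_card ⟨Finset.filter_subset _ _, fun hsub => ?_⟩
  obtain ⟨i, hi⟩ := h.S_ne
  obtain ⟨j, hj, rfl⟩ := h.p_surj i hi
  have h1 := (mem_rest.1 (hsub (h.O_sub hj))).2 hj
  exact (h.S_sub hi).2.1 (h1.symm ▸ hj)

/-- A seaweed algebra of index one has a functional of index one with a diagonal integral principal
element whose entries satisfy `Good`. -/
theorem exists_good (n : ℕ) : ∀ (s : Finset ι) (α β : ι → ℕ), s.card = n → s.Nonempty →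
    (∀ i ∈ s, ∀ j ∈ s, α i < α j → β i ≤ β j) → (∃ F, IndexOne (seaweedRel s α β) F) →
    ∃ F d, IndexOne (seaweedRel s α β) F ∧ IsPrincipalDiagonal (seaweedRel s α β) F d ∧
      Good s α β d := by
  induction n using Nat.strong_induction_on with
  | _ n ih =>
  intro s α β hn hne hcom hF
  -- the reduction step
  have step : ∀ (α β : ι → ℕ) (O U : Finset ι) (a b : ℕ), FirstBlocks s α β O U a b →
      (∃ F, IndexOne (seaweedRel s α β) F) → ∃ F d, IndexOne (seaweedRel s α β) F ∧
        IsPrincipalDiagonal (seaweedRel s α β) F d ∧ Good s α β d := by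
    rintro α β O U a b h ⟨F, hF⟩
    obtain ⟨S, K, p, F₁, hred, hnorm, hF₁⟩ := h.exists_reduction hF
    obtain ⟨i, hi⟩ := hred.S_ne
    have hi' := hred.S_sub hi
    obtain ⟨F', d', h1, h2, h3⟩ := ih _ (hn ▸ rest_card_lt hred) (rest s O p)
      (restBlock α O p) β rfl ⟨i, Reduction.mem_rest_of_notMem hi'.1 hi'.2.1⟩ hred.comono_rest
      ⟨_, hred.indexOne_rest hnorm hF₁⟩
    obtain ⟨F₂, h4, h5⟩ := hred.exists_extension h1 h2
    exact ⟨F₂, _, h4, h5, hred.good h3 (fun i _ hi => if_neg hi) fun i hi => if_pos hi⟩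
  obtain ⟨iα, hiα, hαmin⟩ := s.exists_min_image α hne
  obtain ⟨iβ, hiβ, hβmin⟩ := s.exists_min_image β hne
  set a := α iα with ha
  set b := β iβ with hb
  by_cases h1 : ∀ i ∈ s, β i = b → α i = a
  · by_cases h2 : ∃ u ∈ s, α u = a ∧ β u ≠ b
    · obtain ⟨u, hu, hua, hub⟩ := h2
      refine step α β (s.filter fun i => β i = b) (s.filter fun i => β i ≠ b ∧ α i = a) a b
        ⟨hcom, hβmin, hαmin, fun i => by simp, fun i hi => ?_, fun i => ?_,
          ⟨iβ, by simp [hiβ, hb]⟩, ⟨u, by simp [hu, hua, hub]⟩⟩ hF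
      · rw [Finset.mem_filter] at hi
        exact h1 i hi.1 hi.2
      · simp only [Finset.mem_filter]
        tauto
    · push Not at h2
      -- The two first blocks coincide. The projection `z` onto this block is central, hence scalar,
      -- so the block is everything and the algebra is a full matrix algebra, of size one.
      obtain ⟨F, hF⟩ := hF
      let O := s.filter fun i => β i = b
      have hO : ∀ i ∈ s, (i ∈ O ↔ β i = b) := fun i hi => by simp [O, hi]
      let z : Matrix ι ι ℂ := Matrix.diagonal fun i => if i ∈ O then 1 else 0
      have hrel : ∀ i j, seaweedRel s α β i j → (i ∈ O ↔ j ∈ O) := by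
        intro i j hij
        rw [hO i hij.1, hO j hij.2.1]
        have e1 := hαmin i hij.1
        have e2 := hβmin j hij.2.1
        have e3 := hij.2.2
        constructor
        · intro h3; omega
        · intro h3
          have := h1 j hij.2.1 h3
          exact h2 i hij.1 (by omega)
      have hzall := hF z (by
          intro i j hij
          by_cases h3 : i = j
          · subst h3
            simp only [z, Matrix.diagonal_apply_eq]
            rw [if_neg]
            intro h4
            have := (Finset.mem_filter.1 h4).1
            exact hij ⟨this, this, le_rfl, le_rfl⟩
          · simp [z, h3])
        (by
          intro y hy
          have : z * y - y * z = 0 := by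
            ext i j
            simp only [z, Matrix.sub_apply, Matrix.diagonal_mul, Matrix.mul_diagonal,
              Matrix.zero_apply]
            by_cases h3 : seaweedRel s α β i j
            · simp only [hrel i j h3, mul_comm, sub_self]
            · rw [hy i j h3]; simp
          rw [this, map_zero])
      have hall : ∀ i ∈ s, β i = b := by
        intro i hi
        have h3 := hzall.2 i iβ ⟨hi, hi, le_rfl, le_rfl⟩ ⟨hiβ, hiβ, le_rfl, le_rfl⟩
        simp only [z, Matrix.diagonal_apply_eq, if_pos ((hO iβ hiβ).2 hb.symm)] at h3
        by_contra h4
        rw [if_neg fun h5 => h4 ((hO i hi).1 h5)] at h3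
        exact zero_ne_one h3
      have heq := eq_of_indexOne_of_const hF fun i hi j hj =>
        ⟨hi, hj, by rw [h1 i hi (hall i hi), h1 j hj (hall j hj)],
          by rw [hall i hi, hall j hj]⟩
      refine ⟨0, fun _ => 0, ?_, ?_, ⟨⟨?_, ?_, ?_, ?_⟩, ⟨?_, ?_, ?_, ?_⟩, ?_⟩⟩
      · intro x hx _
        refine ⟨fun i j hij => hx i j fun h3 => hij (heq i h3.1 j h3.2.1), fun i j hi hj => ?_⟩
        rw [heq i hi.1 j hj.1]
      · intro y _
        simp
      · intro i hi j hj _ v h3 h4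
        exact ⟨i, hi, rfl, by omega⟩
      · intro i hi j hj _ k h3 h4
        omega
      · intro i hi j hj h3
        rw [heq i hi j hj] at h3
        omega
      · intro i hi u hu _ _ h3
        rw [heq u hu i hi] at h3
        exact absurd rfl h3
      · intro i hi j hj _ v h3 h4
        exact ⟨i, hi, rfl, by omega⟩
      · intro i hi j hj _ k h3 h4
        omega
      · intro i hi j hj h3
        rw [heq i hi j hj] at h3
        omega
      · intro i hi u hu _ _ h3
        rw [heq u hu i hi] at h3
        exact absurd rfl h3
      · intro i hi j hj
        exact ⟨i, hi, i, hi, rfl, by rw [heq i hi j hj], rfl⟩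
  -- Now the first block of `α` is properly contained in that of `β`; transposition exchanges them
  -- and negates `d`.
  · push Not at h1
    obtain ⟨u, hu, hub, hua⟩ := h1
    have hαu := hαmin u hu
    obtain ⟨F, hF⟩ := hF
    have hab : ∀ i ∈ s, α i = a → β i = b := fun i hi hia => le_antisymm
      (hub ▸ hcom i hi u hu (by omega)) (hβmin i hi)
    obtain ⟨F', d, h2, h3, h4⟩ := step β α (s.filter fun i => α i = a)
      (s.filter fun i => α i ≠ a ∧ β i = b) b a
      ⟨fun i hi j hj hij => by
        by_contra h2
        have := hcom j hj i hi (by omega)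
        omega, hαmin, hβmin, fun i => by simp, fun i hi => by
          rw [Finset.mem_filter] at hi
          exact hab i hi.1 hi.2, fun i => by
          simp only [Finset.mem_filter]
          tauto,
        ⟨iα, by simp [hiα, ha]⟩, ⟨u, by simp [hu, hua, hub]⟩⟩ ⟨_, hF.transpose⟩
    exact ⟨_, _, h2.transpose, h3.transpose, h4.swap⟩

end Induction

/-! ### Traces and spectra; the symmetry about one half -/

section Spectrum

open Module

/-- Endomorphisms with the same traces of polynomials have the same spectrum. -/
lemma spectrum_subset_of_trace_aeval_eq {V : Type*} [AddCommGroup V] [Module ℂ V]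
    [FiniteDimensional ℂ V] {f g : Module.End ℂ V}
    (h : ∀ r : Polynomial ℂ, LinearMap.trace ℂ V (Polynomial.aeval f r) =
      LinearMap.trace ℂ V (Polynomial.aeval g r)) : spectrum ℂ f ⊆ spectrum ℂ g := by
  intro μ hμ
  rw [← Module.End.hasEigenvalue_iff_mem_spectrum] at hμ ⊢
  obtain ⟨w, hw⟩ := hμ.exists_hasEigenvector
  by_contra hg
  have hf0 : minpoly ℂ f ≠ 0 := minpoly.ne_zero (Algebra.IsIntegral.isIntegral f)
  obtain ⟨q, hq, hdvd⟩ := Polynomial.exists_eq_pow_rootMultiplicity_mul_and_not_dvd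
    (minpoly ℂ f) hf0 μ
  set k := Polynomial.rootMultiplicity μ (minpoly ℂ f)
  have hirr := Polynomial.irreducible_X_sub_C μ
  have hg' : ¬ (Polynomial.X - Polynomial.C μ) ∣ minpoly ℂ g := by
    rw [Polynomial.dvd_iff_isRoot, ← Module.End.hasEigenvalue_iff_isRoot]
    exact hg
  have hcop : IsCoprime ((Polynomial.X - Polynomial.C μ) ^ k) (q * minpoly ℂ g) :=
    IsCoprime.pow_left (IsCoprime.mul_right ((hirr.coprime_iff_not_dvd).2 hdvd)
      ((hirr.coprime_iff_not_dvd).2 hg'))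
  obtain ⟨u, v, huv⟩ := hcop
  -- By the Chinese remainder theorem `r` is 1 modulo the `μ`-part of the minimal polynomial of `f`,
  -- and divisible by its other part and by the minimal polynomial of `g`. So `r` is idempotent at
  -- `f`, zero at `g`, and equal to 1 at `μ`.
  set r := v * (q * minpoly ℂ g) with hr
  have hrg : Polynomial.aeval g r = 0 := by simp [hr]
  have hidem : IsIdempotentElem (Polynomial.aeval f r) := by
    have h1 : r * r = r - minpoly ℂ f * (u * v * minpoly ℂ g) := by
      have h2 : r = 1 - u * (Polynomial.X - Polynomial.C μ) ^ k := by rw [← huv]; ring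
      calc r * r = r * (1 - u * (Polynomial.X - Polynomial.C μ) ^ k) := by rw [← h2]
        _ = r - ((Polynomial.X - Polynomial.C μ) ^ k * q) * (u * v * minpoly ℂ g) := by
          rw [hr]; ring
        _ = _ := by rw [← hq]
    rw [IsIdempotentElem, ← map_mul, h1]
    simp
  have htr := h r
  rw [hrg, map_zero] at htr
  -- In characteristic zero an idempotent of trace zero vanishes, yet this one fixes the eigenvector
  -- `w`.
  have hrf := (LinearMap.IsIdempotentElem.trace_eq_zero_iff hidem).1 htr
  have hk : k ≠ 0 := by
    have h1 := (Polynomial.rootMultiplicity_pos hf0).2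
      (Module.End.isRoot_of_hasEigenvalue hμ)
    exact h1.ne'
  have h1 := Module.End.aeval_apply_of_hasEigenvector (p := r) hw
  rw [hrf, LinearMap.zero_apply] at h1
  have h2 : r.eval μ = 1 := by
    have := congrArg (Polynomial.eval μ) huv
    simpa [hk] using this
  rw [h2, one_smul] at h1
  exact hw.2 h1.symm

variable {L : Type*} [LieRing L] [LieAlgebra ℂ L]

lemma kirillovForm_apply (F : Module.Dual ℂ L) (x y : L) : kirillovForm F x y = F ⁅x, y⁆ := rfl

variable [FiniteDimensional ℂ L]

lemma isFrobeniusFunctional_of_ker {F : Module.Dual ℂ L}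
    (h : ∀ x : L, (∀ y : L, F ⁅x, y⁆ = 0) → x = 0) : IsFrobeniusFunctional F := by
  refine ⟨fun x hx => h x hx, fun y hy => h y fun x => ?_⟩
  rw [← lie_skew, map_neg, neg_eq_zero]
  exact hy x

lemma eq_zero_of_isFrobeniusFunctional {F : Module.Dual ℂ L} (h : IsFrobeniusFunctional F) {x : L}
    (hx : ∀ y : L, F ⁅x, y⁆ = 0) : x = 0 := h.1 x hx

lemma exists_isFrobeniusFunctional (h : IsFrobenius L) :
    ∃ F : Module.Dual ℂ L, IsFrobeniusFunctional F := by
  have h1 := Nat.sInf_mem (Set.range_nonempty fun F : Module.Dual ℂ L =>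
    finrank ℂ (LinearMap.ker (kirillovForm F)))
  obtain ⟨F, hF⟩ := h1
  have h2 : finrank ℂ (LinearMap.ker (kirillovForm F)) = 0 := hF.trans h
  rw [Submodule.finrank_eq_zero] at h2
  refine ⟨F, isFrobeniusFunctional_of_ker fun x hx => ?_⟩
  have : x ∈ LinearMap.ker (kirillovForm F) := LinearMap.mem_ker.2 (LinearMap.ext hx)
  rwa [h2, Submodule.mem_bot] at this

lemma exists_bracket_eq {F : Module.Dual ℂ L} (h : IsFrobeniusFunctional F)
    (G : Module.Dual ℂ L) : ∃ x : L, ∀ y : L, F ⁅x, y⁆ = G y := by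
  have hinj : Function.Injective (kirillovForm F) := by
    rw [← LinearMap.ker_eq_bot, LinearMap.ker_eq_bot']
    intro x hx
    exact eq_zero_of_isFrobeniusFunctional h fun y => LinearMap.congr_fun hx y
  have hsurj := (LinearMap.injective_iff_surjective_of_finrank_eq_finrank
    (Subspace.dual_finrank_eq (K := ℂ) (V := L)).symm).1 hinj
  obtain ⟨x, hx⟩ := hsurj G
  exact ⟨x, fun y => LinearMap.congr_fun hx y⟩

/-- The multiplicities of the eigenvalues of a principal element are symmetric about `1/2`. -/
theorem finrank_eigenspace_symm {x : L} (hx : IsPrincipalElement x) (c : ℂ) :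
    finrank ℂ (Module.End.eigenspace (LieAlgebra.ad ℂ L x) c) =
      finrank ℂ (Module.End.eigenspace (LieAlgebra.ad ℂ L x) (1 - c)) := by
  obtain ⟨F, hF, hxF⟩ := hx
  set B := kirillovForm F with hB
  have hrefl : B.IsRefl := fun y z hyz => by
    rw [hB, kirillovForm_apply] at hyz ⊢
    rw [← lie_skew, map_neg, hyz, neg_zero]
  set D := LieAlgebra.ad ℂ L x with hD
  -- `ad x` and `1 - ad x` are adjoint, by `F [x, [y, z]] = F [y, z]` and the Leibniz rule.
  have hadj : ∀ y z, B y ((D - (1 - c) • (1 : Module.End ℂ L)) z) =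
      - B ((D - c • (1 : Module.End ℂ L)) y) z := by
    intro y z
    have h1 : F ⁅x, ⁅y, z⁆⁆ = F ⁅y, z⁆ := LinearMap.congr_fun hxF ⁅y, z⁆
    rw [leibniz_lie, map_add] at h1
    simp only [hB, kirillovForm_apply, LinearMap.sub_apply, LinearMap.smul_apply,
      Module.End.one_apply, map_sub, map_smul, hD, LieAlgebra.ad_apply, smul_eq_mul]
    linear_combination h1
  have h1 : Module.End.eigenspace D c =
      LinearMap.BilinForm.orthogonal B
        (LinearMap.range (D - (1 - c) • (1 : Module.End ℂ L))) := by
    ext y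
    rw [Module.End.eigenspace_def, LinearMap.mem_ker, LinearMap.BilinForm.mem_orthogonal_iff]
    constructor
    · rintro h2 _ ⟨z, rfl⟩
      apply hrefl
      rw [hadj, h2, map_zero, LinearMap.zero_apply, neg_zero]
    · intro h2
      refine hF.1 _ fun z => ?_
      rw [← neg_eq_zero, ← hadj]
      exact hrefl _ _ (h2 _ ⟨z, rfl⟩)
  rw [h1, LinearMap.BilinForm.finrank_orthogonal hF, Module.End.eigenspace_def]
  have := LinearMap.finrank_range_add_finrank_ker (D - (1 - c) • (1 : Module.End ℂ L))
  omega

end Spectrum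

/-! ### Independence of the principal element by deformation -/

section Deformation

open Module

variable {L : Type*} [LieRing L] [LieAlgebra ℂ L] [FiniteDimensional ℂ L]

/-- The solutions of `F_t [x, y] = F_t y` along a line of functionals move by infinitesimal
automorphisms. -/
lemma eq_bracket_of_deriv {F G : Module.Dual ℂ L} (hF : IsFrobeniusFunctional F) {x x' z : L}
    (hx : ∀ y : L, F ⁅x, y⁆ = F y) (hx' : ∀ y : L, F ⁅x', y⁆ + G ⁅x, y⁆ = G y)
    (hz : ∀ y : L, F ⁅z, y⁆ = G y) : x' = ⁅x, z⁆ := by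
  rw [← sub_eq_zero]
  refine eq_zero_of_isFrobeniusFunctional hF fun y => ?_
  have h1 := hx ⁅z, y⁆
  rw [leibniz_lie, map_add] at h1
  have h2 := hx' y
  rw [← hz, ← hz y] at h2
  rw [sub_lie, map_sub]
  linear_combination h2 - h1

/-- A Lax equation passes to powers by the Leibniz rule; as commutators are traceless, the traces of
the powers are then stationary. -/
lemma hasDerivAt_pow_of_bracket {N : ℕ} {X : ℂ → Matrix (Fin N) (Fin N) ℂ}
    {Z : Matrix (Fin N) (Fin N) ℂ} {t : ℂ}
    (h : ∀ i j, HasDerivAt (fun s => X s i j) ((X t * Z - Z * X t) i j) t) (k : ℕ) :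
    ∀ i j, HasDerivAt (fun s => (X s ^ k) i j) ((X t ^ k * Z - Z * X t ^ k) i j) t := by
  induction k with
  | zero =>
    intro i j
    simpa using hasDerivAt_const t ((1 : Matrix (Fin N) (Fin N) ℂ) i j)
  | succ k ih =>
    intro i j
    have h1 : (fun s => (X s ^ (k + 1)) i j) = fun s => ∑ l, (X s ^ k) i l * X s l j := by
      ext s
      rw [pow_succ, Matrix.mul_apply]
    have h2 : (X t ^ (k + 1) * Z - Z * X t ^ (k + 1)) i j =
        ∑ l, ((X t ^ k * Z - Z * X t ^ k) i l * X t l j +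
          (X t ^ k) i l * (X t * Z - Z * X t) l j) := by
      rw [Finset.sum_add_distrib, ← Matrix.mul_apply, ← Matrix.mul_apply, ← Matrix.add_apply]
      refine congrFun (congrFun ?_ i) j
      rw [pow_succ]
      simp only [mul_sub, sub_mul, mul_assoc]
      abel
    rw [h1, h2]
    exact HasDerivAt.fun_sum fun l _ => (ih i l).mul (h l j)

/-- Along the line `F₁ + t • G` Cramer's rule gives the principal element as a rational function of
`t`, defined where the determinant of the form is nonzero. By `eq_bracket_of_deriv` its derivative
is a bracket with itself, so the traces have derivative zero. The parameter is complex because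
removing finitely many points leaves `ℂ` connected, unlike a real segment. -/
theorem trace_ad_pow_eq {x₁ x₂ : L} (h₁ : IsPrincipalElement x₁) (h₂ : IsPrincipalElement x₂)
    (k : ℕ) : LinearMap.trace ℂ L (LieAlgebra.ad ℂ L x₁ ^ k) =
      LinearMap.trace ℂ L (LieAlgebra.ad ℂ L x₂ ^ k) := by
  obtain ⟨F₁, hF₁, hx₁⟩ := h₁
  obtain ⟨F₂, hF₂, hx₂⟩ := h₂
  set G := F₂ - F₁ with hG
  let Ft : ℂ → Module.Dual ℂ L := fun t => F₁ + t • G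
  have hFt : ∀ t y, Ft t y = F₁ y + t * G y := fun t y => rfl
  let b := Module.finBasis ℂ L
  set N := finrank ℂ L
  let P : Matrix (Fin N) (Fin N) (Polynomial ℂ) := Matrix.of fun i j =>
    Polynomial.C (F₁ ⁅b j, b i⁆) + Polynomial.X * Polynomial.C (G ⁅b j, b i⁆)
  let f : Fin N → Polynomial ℂ := fun i =>
    Polynomial.C (F₁ (b i)) + Polynomial.X * Polynomial.C (G (b i))
  have hP : ∀ t i j, (P i j).eval t = Ft t ⁅b j, b i⁆ := fun t i j => by
    simp [P, hFt]; ring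
  have hf : ∀ t i, (f i).eval t = Ft t (b i) := fun t i => by
    simp [f, hFt]; ring
  set p := P.det with hp
  let q : Fin N → Polynomial ℂ := P.adjugate.mulVec f
  have hq : ∀ i, ∑ j, P i j * q j = p * f i := fun i => by
    have h1 : P.mulVec q = p • f := by
      rw [Matrix.mulVec_mulVec, Matrix.mul_adjugate, Matrix.smul_mulVec, Matrix.one_mulVec]
    exact congrFun h1 i
  let M : ℂ → Matrix (Fin N) (Fin N) ℂ := fun t => (Polynomial.evalRingHom t).mapMatrix P
  have hM : ∀ t i j, M t i j = Ft t ⁅b j, b i⁆ := fun t i j => hP t i j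
  have hdet : ∀ t, p.eval t = (M t).det := fun t =>
    RingHom.map_det (Polynomial.evalRingHom t) P
  have hMv : ∀ t (v : Fin N → ℂ) i, (M t).mulVec v i = Ft t ⁅∑ j, v j • b j, b i⁆ := by
    intro t v i
    rw [Matrix.mulVec, dotProduct, sum_lie, map_sum]
    refine Finset.sum_congr rfl fun j _ => ?_
    rw [hM, smul_lie, map_smul, smul_eq_mul, mul_comm]
  have hbasis : ∀ (A B : Module.Dual ℂ L), (∀ i, A (b i) = B (b i)) → ∀ y, A y = B y :=
    fun A B h y => LinearMap.congr_fun (b.ext h) y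
  have hfrob : ∀ t, p.eval t ≠ 0 → IsFrobeniusFunctional (Ft t) := by
    intro t ht
    refine isFrobeniusFunctional_of_ker fun x hx => ?_
    have h1 : (M t).mulVec (b.repr x) = 0 := by
      ext i
      rw [hMv, b.sum_repr, hx, Pi.zero_apply]
    have h2 := Matrix.eq_zero_of_mulVec_eq_zero (hdet t ▸ ht) h1
    exact b.repr.map_eq_zero_iff.1 (Finsupp.ext fun i => congrFun h2 i)
  have hfrob' : ∀ t, IsFrobeniusFunctional (Ft t) → p.eval t ≠ 0 := by
    intro t ht h0
    rw [hdet] at h0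
    obtain ⟨v, hv, hv0⟩ := Matrix.exists_mulVec_eq_zero_iff.2 h0
    have h1 : ∑ j, v j • b j = 0 := eq_zero_of_isFrobeniusFunctional ht fun y =>
      hbasis ((Ft t) ∘ₗ (LieAlgebra.ad ℂ L (∑ j, v j • b j))) 0 (fun i => by
        rw [LinearMap.comp_apply, LieAlgebra.ad_apply, ← hMv, hv0]; rfl) y
    exact hv (funext fun i => (Fintype.linearIndependent_iff.1 b.linearIndependent v h1 i))
  let c : ℂ → Fin N → ℂ := fun t i => (q i).eval t / p.eval t
  let x : ℂ → L := fun t => ∑ i, c t i • b i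
  have hMc : ∀ t, p.eval t ≠ 0 → ∀ i, ∑ j, (P i j).eval t * c t j = (f i).eval t := by
    intro t ht i
    have h1 := congrArg (Polynomial.eval t) (hq i)
    rw [Polynomial.eval_finsetSum, Polynomial.eval_mul] at h1
    simp only [Polynomial.eval_mul] at h1
    simp only [c, ← mul_div_assoc]
    rw [← Finset.sum_div, h1, mul_div_cancel_left₀ _ ht]
  have hx : ∀ t, p.eval t ≠ 0 → ∀ y : L, Ft t ⁅x t, y⁆ = Ft t y := by
    intro t ht
    refine hbasis ((Ft t) ∘ₗ (LieAlgebra.ad ℂ L (x t))) (Ft t) fun i => ?_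
    rw [LinearMap.comp_apply, LieAlgebra.ad_apply, ← hMv, ← hf, ← hMc t ht i]
    rfl
  let c' : ℂ → Fin N → ℂ := fun t i => deriv (fun s => c s i) t
  have hc' : ∀ t, p.eval t ≠ 0 → ∀ i, HasDerivAt (fun s => c s i) (c' t i) t := by
    intro t ht i
    exact ((q i).differentiable.differentiableAt.div p.differentiable.differentiableAt
      ht).hasDerivAt
  let Ω : Set ℂ := {t | p.eval t ≠ 0}
  have hΩo : IsOpen Ω := isOpen_ne_fun p.continuous continuous_const
  have hF0 : Ft 0 = F₁ := by simp [Ft]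
  have hF1 : Ft 1 = F₂ := by simp [Ft, hG]
  have h0Ω : (0 : ℂ) ∈ Ω := hfrob' 0 (hF0 ▸ hF₁)
  have h1Ω : (1 : ℂ) ∈ Ω := hfrob' 1 (hF1 ▸ hF₂)
  have hΩc : IsPreconnected Ω := by
    have hp0 : p ≠ 0 := fun h => h0Ω (by rw [h, Polynomial.eval_zero])
    have h1 : Ω = {t | p.IsRoot t}ᶜ := rfl
    rw [h1]
    exact (Set.Countable.isConnected_compl_of_one_lt_rank (by
      rw [Complex.rank_real_complex]; norm_num)
      (Polynomial.finite_setOfPred_isRoot hp0).countable).isPreconnected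
  have hx' : ∀ t, p.eval t ≠ 0 → ∀ y : L, Ft t ⁅∑ i, c' t i • b i, y⁆ + G ⁅x t, y⁆ = G y := by
    intro t ht
    refine hbasis ((Ft t) ∘ₗ (LieAlgebra.ad ℂ L (∑ i, c' t i • b i)) +
      G ∘ₗ (LieAlgebra.ad ℂ L (x t))) G fun i => ?_
    have hPd : ∀ j, HasDerivAt (fun s => (P i j).eval s) (G ⁅b j, b i⁆) t := fun j => by
      have := (P i j).hasDerivAt t
      simpa [P] using this
    have hfd : HasDerivAt (fun s => (f i).eval s) (G (b i)) t := by
      have := (f i).hasDerivAt t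
      simpa [f] using this
    have hd1 : HasDerivAt (fun s => ∑ j, (P i j).eval s * c s j)
        (∑ j, (G ⁅b j, b i⁆ * c t j + (P i j).eval t * c' t j)) t :=
      HasDerivAt.fun_sum fun j _ => (hPd j).mul (hc' t ht j)
    have hd2 := hfd.congr_of_eventuallyEq (f₁ := fun s => ∑ j, (P i j).eval s * c s j)
      (Filter.eventually_of_mem (hΩo.mem_nhds ht) fun s hs => hMc s hs i)
    rw [← hd1.unique hd2, LinearMap.add_apply, LinearMap.comp_apply, LinearMap.comp_apply,
      LieAlgebra.ad_apply, LieAlgebra.ad_apply, ← hMv, Finset.sum_add_distrib, add_comm]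
    congr 1
    simp only [x]
    rw [sum_lie, map_sum]
    refine Finset.sum_congr rfl fun j _ => ?_
    rw [smul_lie, map_smul, smul_eq_mul, mul_comm]
  let T : Module.End ℂ L ≃ₐ[ℂ] Matrix (Fin N) (Fin N) ℂ := LinearMap.toMatrixAlgEquiv b
  let X : ℂ → Matrix (Fin N) (Fin N) ℂ := fun t => T (LieAlgebra.ad ℂ L (x t))
  have hTsum : ∀ v : Fin N → ℂ, T (LieAlgebra.ad ℂ L (∑ i, v i • b i)) =
      ∑ i, v i • T (LieAlgebra.ad ℂ L (b i)) := fun v => by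
    simp only [map_sum, map_smul]
  have hXd : ∀ t, p.eval t ≠ 0 → ∃ Z : Matrix (Fin N) (Fin N) ℂ, ∀ i j,
      HasDerivAt (fun s => X s i j) ((X t * Z - Z * X t) i j) t := by
    intro t ht
    obtain ⟨z, hz⟩ := exists_bracket_eq (hfrob t ht) G
    have h1 := eq_bracket_of_deriv (hfrob t ht) (hx t ht) (hx' t ht) hz
    refine ⟨T (LieAlgebra.ad ℂ L z), fun i j => ?_⟩
    have h2 : X t * T (LieAlgebra.ad ℂ L z) - T (LieAlgebra.ad ℂ L z) * X t =
        ∑ i, c' t i • T (LieAlgebra.ad ℂ L (b i)) := by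
      have had : LieAlgebra.ad ℂ L ⁅x t, z⁆ =
          LieAlgebra.ad ℂ L (x t) * LieAlgebra.ad ℂ L z -
            LieAlgebra.ad ℂ L z * LieAlgebra.ad ℂ L (x t) := by
        ext y
        simp only [LinearMap.sub_apply, Module.End.mul_apply, LieAlgebra.ad_apply, lie_lie]
      rw [← hTsum, h1, had, map_sub, map_mul, map_mul]
    have h3 : (fun s => X s i j) = fun s => ∑ l, c s l * T (LieAlgebra.ad ℂ L (b l)) i j := by
      ext s
      simp only [X, x]
      rw [hTsum, Matrix.sum_apply]
      rfl
    rw [h2, h3, Matrix.sum_apply]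
    exact HasDerivAt.fun_sum fun l _ => (hc' t ht l).mul_const _
  have htr : ∀ t ∈ Ω, HasDerivAt (fun s => (X s ^ k).trace) 0 t := by
    intro t ht
    obtain ⟨Z, hZ⟩ := hXd t ht
    have h1 : (0 : ℂ) = ∑ i, (X t ^ k * Z - Z * X t ^ k) i i := by
      have : ∑ i, (X t ^ k * Z - Z * X t ^ k) i i = (X t ^ k * Z - Z * X t ^ k).trace := rfl
      rw [this, Matrix.trace_sub, Matrix.trace_mul_comm, sub_self]
    rw [h1]
    exact HasDerivAt.fun_sum fun i _ => hasDerivAt_pow_of_bracket hZ k i i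
  have hconst : (X 0 ^ k).trace = (X 1 ^ k).trace :=
    hΩo.is_const_of_deriv_eq_zero hΩc
      (fun t ht => (htr t ht).differentiableAt.differentiableWithinAt)
      (fun t ht => (htr t ht).deriv) h0Ω h1Ω
  have hXtr : ∀ t, (X t ^ k).trace = LinearMap.trace ℂ L (LieAlgebra.ad ℂ L (x t) ^ k) := by
    intro t
    rw [LinearMap.trace_eq_matrix_trace ℂ b]
    simp only [X]
    rw [← map_pow]
    rfl
  have huniq : ∀ t y, p.eval t ≠ 0 → kirillovForm (Ft t) y = Ft t → x t = y := by
    intro t y ht hy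
    rw [← sub_eq_zero]
    refine eq_zero_of_isFrobeniusFunctional (hfrob t ht) fun w => ?_
    rw [sub_lie, map_sub, hx t ht, ← kirillovForm_apply, hy, sub_self]
  rw [hXtr, hXtr, huniq 0 x₁ h0Ω (by rw [hF0, hx₁]), huniq 1 x₂ h1Ω (by rw [hF1, hx₂])] at hconst
  exact hconst

/-- The spectrum of a principal element does not depend on the choice of the principal element. -/
theorem spectrum_ad_eq {x₁ x₂ : L} (h₁ : IsPrincipalElement x₁) (h₂ : IsPrincipalElement x₂) :
    spectrum ℂ (LieAlgebra.ad ℂ L x₁) = spectrum ℂ (LieAlgebra.ad ℂ L x₂) := by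
  have h : ∀ {x₁ x₂ : L}, IsPrincipalElement x₁ → IsPrincipalElement x₂ →
      spectrum ℂ (LieAlgebra.ad ℂ L x₁) ⊆ spectrum ℂ (LieAlgebra.ad ℂ L x₂) := by
    intro x₁ x₂ h₁ h₂
    refine spectrum_subset_of_trace_aeval_eq fun r => ?_
    rw [Polynomial.aeval_eq_sum_range, Polynomial.aeval_eq_sum_range, map_sum, map_sum]
    refine Finset.sum_congr rfl fun k _ => ?_
    rw [map_smul, map_smul, trace_ad_pow_eq h₁ h₂]
  exact (h h₁ h₂).antisymm (h h₂ h₁)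

end Deformation

/-! ### Stable flags and Lie's theorem -/

section Flags

open Module

variable {V : Type*} [AddCommGroup V] [Module ℂ V]

/-- Lie's theorem gives a common eigenvector in the quotient by `W`, and a lift of it spans the new
direction. At `W = ⊤` the step is stationary, so the chain can be indexed by all of `ℕ`. -/
lemma exists_lieSubmodule_sup_span [FiniteDimensional ℂ V] {L : Type*} [LieRing L] [LieAlgebra ℂ L] [LieRingModule L V]
    [LieModule ℂ L V] [LieAlgebra.IsSolvable L] (W : LieSubmodule ℂ L V) :
    ∃ (W' : LieSubmodule ℂ L V) (v : V),
      W'.toSubmodule = W.toSubmodule ⊔ Submodule.span ℂ {v} ∧ (W ≠ ⊤ → v ∉ W) := by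
  by_cases hW : W = ⊤
  · exact ⟨W, 0, by simp, fun h => (h hW).elim⟩
  have : Nontrivial (V ⧸ W) := by
    rw [← not_subsingleton_iff_nontrivial]
    intro h
    refine hW ((LieSubmodule.toSubmodule_eq_top _).1 ?_)
    exact Submodule.Quotient.subsingleton_iff.1 h
  obtain ⟨χ, hχ⟩ := LieModule.exists_nontrivial_weightSpace_of_isSolvable ℂ L (V ⧸ W)
  obtain ⟨⟨u, hu⟩, hu0⟩ := exists_ne (0 : LieModule.weightSpace (V ⧸ W) χ)
  rw [LieModule.mem_weightSpace] at hu
  obtain ⟨v, rfl⟩ := LieSubmodule.Quotient.surjective_mk' W u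
  have hv : v ∉ W := fun h => hu0 (Subtype.ext ((LieSubmodule.Quotient.mk_eq_zero').2 h))
  have hL : ∀ (x : L), ⁅x, v⁆ - χ x • v ∈ W := fun x => by
    have h := hu x
    rw [← LieModuleHom.map_lie, ← sub_eq_zero, ← map_smul, ← map_sub] at h
    exact LieSubmodule.Quotient.mk_eq_zero'.1 h
  refine ⟨{ W.toSubmodule ⊔ Submodule.span ℂ {v} with lie_mem := ?_ }, v, rfl, fun _ => hv⟩
  intro x m hm
  obtain ⟨w, hw, y, hy, rfl⟩ := Submodule.mem_sup.1 hm
  obtain ⟨c, rfl⟩ := Submodule.mem_span_singleton.1 hy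
  refine Submodule.mem_sup.2 ⟨⁅x, w⁆ + c • (⁅x, v⁆ - χ x • v), ?_, (c * χ x) • v, ?_, ?_⟩
  · exact add_mem (W.lie_mem hw) (W.smul_mem c (hL x))
  · exact Submodule.smul_mem _ _ (Submodule.mem_span_singleton_self v)
  · rw [lie_add, lie_smul, smul_sub, smul_smul]
    abel

/-- A chain of subspaces growing by at most one dimension in each step. -/
structure IsFlag (W : ℕ → Submodule ℂ V) (N : ℕ) : Prop where
  zero : W 0 = ⊥
  succ : ∀ k, ∃ v, W (k + 1) = W k ⊔ Submodule.span ℂ {v}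
  top : W N = ⊤

lemma IsFlag.mono {W : ℕ → Submodule ℂ V} {N : ℕ} (h : IsFlag W N) : Monotone W :=
  monotone_nat_of_le_succ fun k => by
    obtain ⟨v, hv⟩ := h.succ k
    exact hv ▸ le_sup_left

/-- Lie's theorem: a module over a solvable Lie algebra has a stable flag. -/
theorem exists_stable_flag [FiniteDimensional ℂ V] (L : Type*) [LieRing L] [LieAlgebra ℂ L] [LieRingModule L V]
    [LieModule ℂ L V] [LieAlgebra.IsSolvable L] :
    ∃ (W : ℕ → Submodule ℂ V) (N : ℕ), IsFlag W N ∧ ∀ (x : L), ∀ k, ∀ v ∈ W k, ⁅x, v⁆ ∈ W k := by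
  choose next vec h1 h2 using fun W : LieSubmodule ℂ L V => exists_lieSubmodule_sup_span W
  let W : ℕ → LieSubmodule ℂ L V := fun k => next^[k] ⊥
  have hs : ∀ k, W (k + 1) = next (W k) := fun k => Function.iterate_succ_apply' next k ⊥
  have hle : ∀ k, (W k).toSubmodule ≤ (W (k + 1)).toSubmodule := fun k => by
    rw [hs, h1]
    exact le_sup_left
  have htop : ∀ k, W k = ⊤ ∨ k ≤ finrank ℂ (W k).toSubmodule := by
    intro k
    induction k with
    | zero => exact Or.inr (Nat.zero_le _)
    | succ k ih =>
      by_cases hk : W k = ⊤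
      · left
        rw [← LieSubmodule.toSubmodule_eq_top, eq_top_iff] at hk ⊢
        exact hk.trans (hle k)
      · right
        refine (Nat.succ_le_succ (ih.resolve_left hk)).trans (Submodule.finrank_lt_finrank_of_lt ?_)
        refine lt_of_le_of_ne (hle k) fun h => h2 _ hk ?_
        have : vec (W k) ∈ (W (k + 1)).toSubmodule := by
          rw [hs, h1]
          exact Submodule.mem_sup_right (Submodule.mem_span_singleton_self _)
        rwa [← h] at this
  -- One more than the dimension, so that the second alternative of `htop` is impossible.
  refine ⟨fun k => (W k).toSubmodule, finrank ℂ V + 1, ⟨rfl, fun k => ⟨vec (W k), ?_⟩, ?_⟩,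
    fun x k v hv => (W k).lie_mem hv⟩
  · rw [hs, h1]
  · rcases htop (finrank ℂ V + 1) with h | h
    · rw [h]; rfl
    · have := Submodule.finrank_le (W (finrank ℂ V + 1)).toSubmodule
      omega

lemma IsFlag.exists_smul {W : ℕ → Submodule ℂ V} {N : ℕ} (h : IsFlag W N) {f : V →ₗ[ℂ] V}
    (hf : ∀ k, ∀ v ∈ W k, f v ∈ W k) (k : ℕ) :
    ∃ c : ℂ, ∀ v ∈ W (k + 1), f v - c • v ∈ W k := by
  obtain ⟨u, hu⟩ := h.succ k
  have huk : f u ∈ W (k + 1) := hf _ _ (hu ▸ Submodule.mem_sup_right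
    (Submodule.mem_span_singleton_self u))
  rw [hu] at huk
  obtain ⟨w, hw, y, hy, hwy⟩ := Submodule.mem_sup.1 huk
  obtain ⟨c, rfl⟩ := Submodule.mem_span_singleton.1 hy
  refine ⟨c, fun v hv => ?_⟩
  rw [hu] at hv
  obtain ⟨w', hw', y, hy, rfl⟩ := Submodule.mem_sup.1 hv
  obtain ⟨a, rfl⟩ := Submodule.mem_span_singleton.1 hy
  have : f (w' + a • u) - c • (w' + a • u) = f w' + a • w - c • w' := by
    rw [map_add, map_smul, ← hwy, smul_add, smul_add, smul_comm a c]
    abel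
  rw [this]
  exact sub_mem (add_mem (hf k _ hw') (Submodule.smul_mem _ a hw)) (Submodule.smul_mem _ c hw')

/-- A Lie algebra acting faithfully and stabilizing a flag is solvable. -/
theorem IsFlag.isSolvable {W : ℕ → Submodule ℂ V} {N : ℕ} (h : IsFlag W N) (L : Type*) [LieRing L]
    [LieAlgebra ℂ L] [LieRingModule L V] [LieModule ℂ L V]
    (hfaith : ∀ x : L, (∀ v : V, ⁅x, v⁆ = 0) → x = 0)
    (hW : ∀ (x : L), ∀ k, ∀ v ∈ W k, ⁅x, v⁆ ∈ W k) : LieAlgebra.IsSolvable L := by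
  -- The elements that lower the flag by `m` steps; with truncated subtraction they kill `W k` for
  -- `k ≤ m`.
  let I : ℕ → Submodule ℂ L := fun m =>
    { carrier := {x | ∀ k, ∀ v ∈ W k, ⁅x, v⁆ ∈ W (k - m)}
      add_mem' := fun {x y} hx hy k v hv => by
        rw [add_lie]; exact add_mem (hx k v hv) (hy k v hv)
      zero_mem' := fun k v hv => by rw [zero_lie]; exact zero_mem _
      smul_mem' := fun c x hx k v hv => by
        rw [smul_lie]; exact Submodule.smul_mem _ c (hx k v hv) }
  -- Each quotient of the flag is at most a line, on which `x` and `y` act by commuting scalars.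
  have hI1 : ∀ x y : L, ⁅x, y⁆ ∈ I 1 := by
    intro x y k v hv
    cases k with
    | zero =>
      rw [h.zero, Submodule.mem_bot] at hv
      rw [hv, lie_zero]
      exact zero_mem _
    | succ k =>
      obtain ⟨a, ha⟩ := h.exists_smul (f := LieModule.toEnd ℂ L V x) (hW x) k
      obtain ⟨c, hc⟩ := h.exists_smul (f := LieModule.toEnd ℂ L V y) (hW y) k
      have h1 := ha _ (hW y _ v hv)
      have h2 := hc _ (hW x _ v hv)
      have h3 := hc _ hv
      have h4 := ha _ hv
      simp only [LieModule.toEnd_apply_apply] at h1 h2 h3 h4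
      have : ⁅⁅x, y⁆, v⁆ = (⁅x, ⁅y, v⁆⁆ - a • ⁅y, v⁆) - (⁅y, ⁅x, v⁆⁆ - c • ⁅x, v⁆)
          + a • (⁅y, v⁆ - c • v) - c • (⁅x, v⁆ - a • v) := by
        rw [lie_lie, smul_sub, smul_sub, smul_comm a c]
        abel
      rw [this, Nat.add_sub_cancel]
      exact sub_mem (add_mem (sub_mem h1 h2) (Submodule.smul_mem _ _ h3))
        (Submodule.smul_mem _ _ h4)
  -- Lowering twice by `m` lowers by `2 * m`, which is at least `m + 1` since `1 ≤ m`.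
  have hIm : ∀ m, 1 ≤ m → ∀ x ∈ I m, ∀ y ∈ I m, ⁅x, y⁆ ∈ I (m + 1) := by
    intro m hm x hx y hy k v hv
    rw [lie_lie]
    refine h.mono ?_ (sub_mem (hx _ _ (hy _ _ hv)) (hy _ _ (hx _ _ hv)))
    omega
  have hD : ∀ m, (LieAlgebra.derivedSeries ℂ L (m + 1)).toSubmodule ≤ I (m + 1) := by
    intro m
    induction m with
    | zero =>
      rw [LieAlgebra.derivedSeries_def, LieAlgebra.derivedSeriesOfIdeal_succ,
        LieSubmodule.lieIdeal_oper_eq_linear_span', Submodule.span_le]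
      rintro _ ⟨x, -, y, -, rfl⟩
      exact hI1 x y
    | succ m ih =>
      rw [LieAlgebra.derivedSeries_def, LieAlgebra.derivedSeriesOfIdeal_succ,
        LieSubmodule.lieIdeal_oper_eq_linear_span', Submodule.span_le]
      rintro _ ⟨x, hx, y, hy, rfl⟩
      exact hIm _ (Nat.le_add_left 1 m) x (ih hx) y (ih hy)
  refine LieAlgebra.IsSolvable.mk (R := ℂ) (k := N + 1) ?_
  rw [eq_bot_iff]
  intro x hx
  refine (LieSubmodule.mem_bot x).2 (hfaith x fun v => ?_)
  have h1 := hD N hx N v (h.top ▸ Submodule.mem_top)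
  rwa [Nat.sub_eq_zero_of_le (Nat.le_succ N), h.zero, Submodule.mem_bot] at h1

end Flags

/-! ### Borel subalgebras of `sl n` and flags -/

section Borel

open LieAlgebra.SpecialLinear

variable {n : ℕ}

lemma coe_bracket_sl (x y : sl (Fin n) ℂ) :
    ((⁅x, y⁆ : sl (Fin n) ℂ) : Matrix (Fin n) (Fin n) ℂ) = x.1 * y.1 - y.1 * x.1 := rfl

/-- The subalgebra of `sl n` stabilizing a family of subspaces. -/
def flagStabilizer (W : ℕ → Submodule ℂ (Fin n → ℂ)) : LieSubalgebra ℂ (sl (Fin n) ℂ) where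
  carrier := {x | ∀ k, ∀ v ∈ W k, x.1.mulVec v ∈ W k}
  add_mem' := fun {x y} hx hy k v hv => by
    have : (x + y).1.mulVec v = x.1.mulVec v + y.1.mulVec v := Matrix.add_mulVec _ _ _
    rw [this]
    exact add_mem (hx k v hv) (hy k v hv)
  zero_mem' := fun k v hv => by
    have : (0 : sl (Fin n) ℂ).1.mulVec v = 0 := Matrix.zero_mulVec _
    rw [this]
    exact zero_mem _
  smul_mem' := fun c x hx k v hv => by
    have : (c • x).1.mulVec v = c • x.1.mulVec v := Matrix.smul_mulVec _ _ _
    rw [this]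
    exact Submodule.smul_mem _ _ (hx k v hv)
  lie_mem' := fun {x y} hx hy k v hv => by
    change (x.1 * y.1 - y.1 * x.1).mulVec v ∈ W k
    rw [Matrix.sub_mulVec, ← Matrix.mulVec_mulVec, ← Matrix.mulVec_mulVec]
    exact sub_mem (hx k _ (hy k v hv)) (hy k _ (hx k v hv))

/-- A Borel subalgebra contains the stabilizer of a flag. -/
theorem IsBorel.exists_flag {b : LieSubalgebra ℂ (sl (Fin n) ℂ)} (hb : IsBorel b) :
    ∃ (W : ℕ → Submodule ℂ (Fin n → ℂ)) (N : ℕ), IsFlag W N ∧ flagStabilizer W ≤ b := by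
  have := hb.prop
  obtain ⟨W, N, hW, hs⟩ := exists_stable_flag (V := Fin n → ℂ) b
  -- The stabilizer of the flag contains `b` and is solvable, so maximality of `b` gives the reverse
  -- inclusion.
  refine ⟨W, N, hW, hb.le_of_ge ?_ fun x hx k v hv => hs ⟨x, hx⟩ k v hv⟩
  refine hW.isSolvable (flagStabilizer W) (fun x hx => ?_) fun x k v hv => x.2 k v hv
  refine Subtype.ext (Subtype.ext ?_)
  refine Matrix.ext fun i j => ?_
  have := congrFun (hx (Pi.single j 1)) i
  change x.1.1.mulVec (Pi.single j 1) i = 0 at this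
  rwa [Matrix.mulVec_single_one] at this

end Borel

/-! ### A basis adapted to two flags -/

section AdaptedBasis

open Module

variable {V : Type*} [AddCommGroup V] [Module ℂ V] [FiniteDimensional ℂ V]

/-- Two chains of subspaces have a common adapted generating linearly independent set. -/
lemma exists_adapted_set {W W' : ℕ → Submodule ℂ V} {N N' : ℕ} (hW : IsFlag W N)
    (hW' : IsFlag W' N') (d : ℕ) : ∀ X : Submodule ℂ V, finrank ℂ X = d → ∃ B : Set V,
      LinearIndepOn ℂ id B ∧ Submodule.span ℂ B = X ∧
        (∀ k, X ⊓ W k ≤ Submodule.span ℂ (B ∩ W k)) ∧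
        ∀ k, X ⊓ W' k ≤ Submodule.span ℂ (B ∩ W' k) := by
  induction d using Nat.strong_induction_on with
  | _ d ih =>
    intro X hX
    by_cases hX0 : X = ⊥
    · exact ⟨∅, linearIndepOn_empty ℂ id, by simp [hX0], by simp [hX0], by simp [hX0]⟩
    have hex : ∃ k, X ≤ W k := ⟨N, hW.top ▸ le_top⟩
    classical
    obtain ⟨k, hk, hkmin⟩ : ∃ k, X ≤ W (k + 1) ∧ ¬ X ≤ W k := by
      have h0 : Nat.find hex ≠ 0 := fun h => by
        have := Nat.find_spec hex
        rw [h, hW.zero, le_bot_iff] at this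
        exact hX0 this
      obtain ⟨k, hk⟩ := Nat.exists_eq_succ_of_ne_zero h0
      rw [Nat.succ_eq_add_one] at hk
      exact ⟨k, by rw [← hk]; exact Nat.find_spec hex, Nat.find_min hex (hk ▸ Nat.lt_succ_self k)⟩
    obtain ⟨u, huX, huk⟩ := SetLike.not_le_iff_exists.1 hkmin
    -- The kernel of `φ` cuts `X` in a hyperplane that contains `X ⊓ W k`, while the later `W i`
    -- contain all of `X`. The new basis vector is taken off this hyperplane in the earliest
    -- possible `W' j`, so it serves both chains.
    obtain ⟨φ, hφu, hφW⟩ := Submodule.exists_le_ker_of_notMem huk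
    have hex' : ∃ j, ¬ X ⊓ W' j ≤ LinearMap.ker φ :=
      ⟨N', fun h => hφu (h ⟨huX, hW'.top ▸ Submodule.mem_top⟩)⟩
    set j := Nat.find hex' with hj
    obtain ⟨v, ⟨hvX, hvj⟩, hφv⟩ := SetLike.not_le_iff_exists.1 (Nat.find_spec hex')
    rw [LinearMap.mem_ker] at hφv
    set H := X ⊓ LinearMap.ker φ with hH
    have hHX : H < X := lt_of_le_of_ne inf_le_left fun h => hφu (by
      have : u ∈ H := h ▸ huX
      exact this.2)
    obtain ⟨B, hBi, hBs, hBW, hBW'⟩ :=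
      ih (finrank ℂ H) (hX ▸ Submodule.finrank_lt_finrank_of_lt hHX) H rfl
    have hvH : v ∉ H := fun h => hφv h.2
    have hdec : ∀ w ∈ X, w - (φ w / φ v) • v ∈ H := fun w hw =>
      ⟨sub_mem hw (Submodule.smul_mem _ _ hvX), by
        rw [SetLike.mem_coe, LinearMap.mem_ker, map_sub, map_smul, smul_eq_mul, div_mul_cancel₀ _ hφv, sub_self]⟩
    have hmono : ∀ Y : Submodule ℂ V, Submodule.span ℂ (B ∩ Y) ≤
        Submodule.span ℂ (insert v B ∩ Y) := fun Y =>
      Submodule.span_mono (Set.inter_subset_inter_left _ (Set.subset_insert v B))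
    have hbig : ∀ Y : Submodule ℂ V, H ⊓ Y ≤ Submodule.span ℂ (B ∩ Y) → v ∈ Y →
        X ⊓ Y ≤ Submodule.span ℂ (insert v B ∩ Y) := by
      rintro Y hY hvY w ⟨hwX, hwY⟩
      have h1 := hmono Y (hY ⟨hdec w hwX, sub_mem hwY (Submodule.smul_mem _ _ hvY)⟩)
      have h2 : v ∈ Submodule.span ℂ (insert v B ∩ Y) :=
        Submodule.subset_span ⟨Set.mem_insert v B, hvY⟩
      have h3 := add_mem h1 (Submodule.smul_mem _ (φ w / φ v) h2)
      rwa [sub_add_cancel] at h3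
    have hsmall : ∀ Y : Submodule ℂ V, H ⊓ Y ≤ Submodule.span ℂ (B ∩ Y) →
        X ⊓ Y ≤ LinearMap.ker φ → X ⊓ Y ≤ Submodule.span ℂ (insert v B ∩ Y) := by
      intro Y hY hφY w hw
      exact hmono Y (hY ⟨⟨hw.1, hφY hw⟩, hw.2⟩)
    refine ⟨insert v B, ?_, ?_, fun i => ?_, fun i => ?_⟩
    · refine LinearIndepOn.id_insert hBi ?_
      rwa [hBs]
    · rw [Submodule.span_insert, hBs]
      refine le_antisymm (sup_le ((Submodule.span_singleton_le_iff_mem v X).2 hvX) hHX.le) ?_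
      intro w hw
      refine Submodule.mem_sup.2 ⟨_, Submodule.smul_mem _ (φ w / φ v)
        (Submodule.mem_span_singleton_self v), _, hdec w hw, ?_⟩
      abel
    · rcases lt_or_ge k i with hi | hi
      · exact hbig _ (hBW i) (hW.mono hi (hk hvX))
      · exact hsmall _ (hBW i) (inf_le_right.trans ((hW.mono hi).trans hφW))
    · rcases lt_or_ge i j with hi | hi
      · exact hsmall _ (hBW' i) (not_not.1 (Nat.find_min hex' hi))
      · exact hbig _ (hBW' i) (hW'.mono hi hvj)

theorem exists_adapted_basis {n : ℕ} (hn : finrank ℂ V = n) {W W' : ℕ → Submodule ℂ V} {N N' : ℕ}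
    (hW : IsFlag W N) (hW' : IsFlag W' N') : ∃ e : Basis (Fin n) ℂ V,
      (∀ k, W k ≤ Submodule.span ℂ {v | v ∈ Set.range e ∧ v ∈ W k}) ∧
      ∀ k, W' k ≤ Submodule.span ℂ {v | v ∈ Set.range e ∧ v ∈ W' k} := by
  obtain ⟨B, hBi, hBs, hBW, hBW'⟩ := exists_adapted_set hW hW' _ ⊤ rfl
  let b : Basis B ℂ V := Basis.mk hBi (by
    simp [hBs])
  have : Fintype B := FiniteDimensional.fintypeBasisIndex b
  have hc : Fintype.card B = n := by rw [← hn, finrank_eq_card_basis b]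
  let e : Basis (Fin n) ℂ V := b.reindex (Fintype.equivFinOfCardEq hc)
  have hr : Set.range e = B := by
    rw [Basis.range_reindex]
    simp [b]
  refine ⟨e, fun k => ?_, fun k => ?_⟩
  · rw [hr]
    exact le_trans (by simp) (hBW k)
  · rw [hr]
    exact le_trans (by simp) (hBW' k)

end AdaptedBasis

/-! ### Matrix algebras containing the diagonal, and total preorders -/

section MatrixRelation

open Matrix

variable {n : ℕ}

lemma single_bracket_apply (i : Fin n) (y : Matrix (Fin n) (Fin n) ℂ) (k l : Fin n) :
    (single i i (1 : ℂ) * y - y * single i i (1 : ℂ)) k l =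
      ((if k = i then 1 else 0) - (if l = i then 1 else 0)) * y k l := by
  rw [Matrix.sub_apply, sub_mul]
  congr 1
  · by_cases h : k = i
    · subst h; simp
    · rw [Matrix.single_mul_apply_of_ne _ _ _ _ _ h]; simp [h]
  · by_cases h : l = i
    · subst h; simp
    · rw [Matrix.mul_single_apply_of_ne _ _ _ _ _ h]; simp [h]

/-- A Lie algebra of traceless matrices which contains all traceless matrices supported on a
total reflexive relation consists of the traceless matrices supported on a total preorder. -/
theorem exists_total_preorder {A : Submodule ℂ (Matrix (Fin n) (Fin n) ℂ)}
    (htr : ∀ y ∈ A, y.trace = 0) (hbr : ∀ x ∈ A, ∀ y ∈ A, x * y - y * x ∈ A)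
    {R₀ : Fin n → Fin n → Prop} (htot : ∀ i j, R₀ i j ∨ R₀ j i)
    (hR₀ : ∀ y ∈ supported R₀, y.trace = 0 → y ∈ A) :
    ∃ R : Fin n → Fin n → Prop, (∀ i j, R i j ∨ R j i) ∧ (∀ i j k, R i j → R j k → R i k) ∧
      ∀ y, y ∈ A ↔ y.trace = 0 ∧ y ∈ supported R := by
  have hrefl : ∀ i, R₀ i i := fun i => (htot i i).elim id id
  have hdiag : ∀ d : Fin n → ℂ, ∑ i, d i = 0 → diagonal d ∈ A := fun d hd =>
    hR₀ _ (mem_supported.2 fun i j hij => by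
      rw [diagonal_apply_ne]
      rintro rfl
      exact hij (hrefl i)) (by rw [trace_diagonal, hd])
  -- The identity is central, so a diagonal unit brackets like its traceless part, which lies in
  -- `A`.
  have hT : ∀ i, ∀ y ∈ A, single i i (1 : ℂ) * y - y * single i i 1 ∈ A := by
    intro i y hy
    have h0 : NeZero n := ⟨fun h => by subst h; exact i.elim0⟩
    have hd := hdiag (fun k => (if k = i then 1 else 0) - (n : ℂ)⁻¹) (by
      rw [Finset.sum_sub_distrib]
      simp [NeZero.ne n])
    have h1 := hbr _ hd y hy
    convert h1 using 1
    ext k l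
    rw [single_bracket_apply, Matrix.sub_apply, diagonal_mul, mul_diagonal]
    ring
  -- Bracketing with the diagonal units at `j` and `i` leaves only the entries at `(i, j)` and `(j,
  -- i)`. A further bracket with the unit at `i` changes their relative sign, so the sum keeps only
  -- `-2 * y i j` at `(i, j)`.
  have hkey : ∀ i j, i ≠ j → ∀ y ∈ A, y i j ≠ 0 → single i j 1 ∈ A := by
    intro i j hij y hy hyij
    have h1 := hT j y hy
    have h2 := hT i _ h1
    have h3 := hT i _ h2
    have h4 := A.smul_mem (-(2 * y i j)⁻¹) (A.add_mem h2 h3)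
    convert h4 using 1
    ext k l
    simp only [Matrix.smul_apply, Matrix.add_apply, single_bracket_apply, single_apply]
    by_cases hki : k = i
    · subst hki
      by_cases hlj : l = j
      · subst hlj
        simp [hij, Ne.symm hij]
        field_simp
        norm_num
      · by_cases hlk : l = k
        · simp [hlk, Ne.symm hij, hij]
        · simp [hlj, hlk, Ne.symm hlj, hij]
    · by_cases hkj : k = j
      · subst hkj
        by_cases hli : l = i
        · subst hli
          simp [hki, Ne.symm hki]
        · simp [hki, hli, Ne.symm hki]
      · simp [hki, hkj, Ne.symm hki]
        by_cases hlj : l = j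
        · subst hlj
          simp [Ne.symm hij]
        · simp [hlj]
  refine ⟨fun i j => i = j ∨ single i j 1 ∈ A, fun i j => ?_, fun i j k hij hjk => ?_,
    fun y => ⟨fun hy => ⟨htr y hy, mem_supported.2 fun i j hij => ?_⟩, fun hy => ?_⟩⟩
  · by_cases hij : i = j
    · exact Or.inl (Or.inl hij)
    have h : ∀ i j : Fin n, i ≠ j → R₀ i j → single i j 1 ∈ A := fun i j hij h =>
      hR₀ _ (single_mem_supported h 1) (trace_single_eq_of_ne _ _ _ hij)
    exact (htot i j).imp (fun h1 => Or.inr (h i j hij h1))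
      (fun h1 => Or.inr (h j i (Ne.symm hij) h1))
  · rcases hij with rfl | hij
    · exact hjk
    rcases hjk with rfl | hjk
    · exact Or.inr hij
    by_cases hik : i = k
    · exact Or.inl hik
    have := hbr _ hij _ hjk
    rw [single_mul_single_same, single_mul_single_of_ne _ _ _ _ (Ne.symm hik), sub_zero,
      mul_one] at this
    exact Or.inr this
  · by_contra h
    push Not at hij
    exact hij.2 (hkey i j hij.1 y hy h)
  · have h1 : y = diagonal (fun i => y i i) +
        ∑ i, ∑ j, if i = j then 0 else y i j • single i j (1 : ℂ) := by
      ext k l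
      rw [Matrix.add_apply, Matrix.sum_apply, Finset.sum_eq_single k, Matrix.sum_apply,
        Finset.sum_eq_single l]
      · by_cases hkl : k = l
        · subst hkl; simp
        · simp [hkl]
      · intro j _ hj
        by_cases hkj : k = j
        · simp [hkj]
        · simp [hkj, hj]
      · simp
      · intro i _ hi
        rw [Matrix.sum_apply]
        refine Finset.sum_eq_zero fun j _ => ?_
        by_cases hij : i = j
        · simp [hij]
        · simp [hij, hi]
      · simp
    rw [h1]
    refine A.add_mem (hdiag _ hy.1) (A.sum_mem fun i _ => A.sum_mem fun j _ => ?_)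
    split_ifs with hij
    · exact A.zero_mem
    · by_cases h0 : y i j = 0
      · rw [h0, zero_smul]; exact A.zero_mem
      · exact A.smul_mem _ ((rel_of_ne_zero hy.2 h0).resolve_left hij)

lemma exists_rank_of_total_preorder {R : Fin n → Fin n → Prop} (htot : ∀ i j, R i j ∨ R j i)
    (htrans : ∀ i j k, R i j → R j k → R i k) : ∃ α : Fin n → ℕ, ∀ i j, R i j ↔ α i ≤ α j := by
  classical
  refine ⟨fun i => (Finset.univ.filter fun k => R k i).card, fun i j => ⟨fun h => ?_, fun h => ?_⟩⟩
  · refine Finset.card_le_card fun k hk => ?_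
    simp only [Finset.mem_filter, Finset.mem_univ, true_and] at hk ⊢
    exact htrans k i j hk h
  · by_contra hij
    have hji := (htot i j).resolve_left hij
    refine absurd h (not_le.2 (Finset.card_lt_card ⟨fun k hk => ?_, fun hs => hij ?_⟩))
    · simp only [Finset.mem_filter, Finset.mem_univ, true_and] at hk ⊢
      exact htrans k j i hk hji
    · have := hs (x := i) (by simpa using (htot i i).elim id id)
      simpa using this

end MatrixRelation

/-! ### Standard form of parabolic and seaweed subalgebras -/

section StandardForm

open Matrix LieAlgebra.SpecialLinear

variable {n : ℕ} {P Q : Matrix (Fin n) (Fin n) ℂ}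

lemma mem_sl_iff {x : Matrix (Fin n) (Fin n) ℂ} : x ∈ sl (Fin n) ℂ ↔ x.trace = 0 := Iff.rfl

lemma trace_conj (h : P * Q = 1) (y : Matrix (Fin n) (Fin n) ℂ) :
    (Q * y * P).trace = y.trace := by
  rw [trace_mul_comm, ← mul_assoc, h, one_mul]

/-- The matrices `y` with `P y Q` in a given subalgebra of `sl n`. -/
def pullback (P Q : Matrix (Fin n) (Fin n) ℂ) (p : LieSubalgebra ℂ (sl (Fin n) ℂ)) :
    Submodule ℂ (Matrix (Fin n) (Fin n) ℂ) where
  carrier := {y | ∃ x ∈ p, x.1 = P * y * Q}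
  add_mem' := by
    rintro y y' ⟨x, hx, h⟩ ⟨x', hx', h'⟩
    refine ⟨x + x', add_mem hx hx', ?_⟩
    rw [mul_add, add_mul, ← h, ← h']
    rfl
  zero_mem' := ⟨0, zero_mem _, by rw [mul_zero, zero_mul]; rfl⟩
  smul_mem' := by
    rintro c y ⟨x, hx, h⟩
    refine ⟨c • x, p.smul_mem c hx, ?_⟩
    rw [Matrix.mul_smul, Matrix.smul_mul, ← h]
    rfl

lemma mem_pullback_iff (hPQ : P * Q = 1) {p : LieSubalgebra ℂ (sl (Fin n) ℂ)} (x : sl (Fin n) ℂ) :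
    Q * x.1 * P ∈ pullback P Q p ↔ x ∈ p := by
  have h : P * (Q * x.1 * P) * Q = x.1 := by
    rw [← mul_assoc, ← mul_assoc, hPQ, one_mul, mul_assoc, hPQ, mul_one]
  constructor
  · rintro ⟨x', hx', he⟩
    rw [h] at he
    exact Subtype.ext he ▸ hx'
  · intro hx
    exact ⟨x, hx, h.symm⟩

/-- In a basis adapted to a flag, a subalgebra containing the stabilizer of the flag consists of the
matrices supported on a total preorder. -/
theorem exists_total_preorder_of_flagStabilizer_le {W : ℕ → Submodule ℂ (Fin n → ℂ)} {N : ℕ}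
    (hW : IsFlag W N) {p : LieSubalgebra ℂ (sl (Fin n) ℂ)} (hp : flagStabilizer W ≤ p)
    (hPQ : P * Q = 1) (hQP : Q * P = 1) {e : Fin n → Fin n → ℂ}
    (he : ∀ j, P.mulVec (Pi.single j 1) = e j)
    (hWe : ∀ k, W k ≤ Submodule.span ℂ {v | v ∈ Set.range e ∧ v ∈ W k}) :
    ∃ R : Fin n → Fin n → Prop, (∀ i j, R i j ∨ R j i) ∧ (∀ i j k, R i j → R j k → R i k) ∧
      ∀ x : sl (Fin n) ℂ, x ∈ p ↔ Q * x.1 * P ∈ supported R := by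
  suffices h : ∃ R : Fin n → Fin n → Prop, (∀ i j, R i j ∨ R j i) ∧
      (∀ i j k, R i j → R j k → R i k) ∧
      ∀ y, y ∈ pullback P Q p ↔ y.trace = 0 ∧ y ∈ supported R by
    obtain ⟨R, h1, h2, h3⟩ := h
    refine ⟨R, h1, h2, fun x => ?_⟩
    rw [← mem_pullback_iff hPQ, h3, trace_conj hPQ]
    exact and_iff_right x.2
  -- Basis vectors are compared by when the flag reaches them, so that matrices supported on this
  -- relation stabilize the flag.
  refine exists_total_preorder (R₀ := fun i j => ∀ k, e j ∈ W k → e i ∈ W k) ?_ ?_ ?_ ?_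
  · rintro y ⟨x, hx, h⟩
    rw [← trace_conj hQP, ← h]
    exact x.2
  · rintro y ⟨x, hx, h⟩ y' ⟨x', hx', h'⟩
    refine ⟨⁅x, x'⁆, p.lie_mem hx hx', ?_⟩
    rw [coe_bracket_sl, h, h']
    have h4 : ∀ y y', P * y * Q * (P * y' * Q) = P * (y * y') * Q := fun y y' => by
      rw [mul_assoc (P * y), ← mul_assoc Q, ← mul_assoc Q, hQP, one_mul]
      simp only [mul_assoc]
    rw [h4, h4, mul_sub, sub_mul]
  · intro i j
    by_contra h
    push Not at h
    obtain ⟨⟨k, hk, hk'⟩, l, hl, hl'⟩ := h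
    rcases le_total k l with h | h
    · exact hl' (hW.mono h hk)
    · exact hk' (hW.mono h hl)
  · intro y hy htr
    refine ⟨⟨P * y * Q, ?_⟩, hp fun k v hv => ?_, rfl⟩
    · rw [mem_sl_iff, trace_conj hQP, htr]
    · have hle : W k ≤ (W k).comap (P * y * Q).mulVecLin := by
        refine (hWe k).trans (Submodule.span_le.2 ?_)
        rintro _ ⟨⟨j, rfl⟩, hj⟩
        change (P * y * Q).mulVec (e j) ∈ W k
        have h5 : (P * y * Q).mulVec (e j) = ∑ i, y i j • e i := by
          rw [← he, mulVec_mulVec, mul_assoc, hQP, mul_one, ← mulVec_mulVec, mulVec_single_one]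
          have : y.col j = ∑ i, y i j • (Pi.single i 1 : Fin n → ℂ) := by
            ext k
            simp [Finset.sum_apply, Pi.single_apply]
          rw [this, ← mulVecLin_apply, map_sum]
          refine Finset.sum_congr rfl fun i _ => ?_
          rw [map_smul, mulVecLin_apply, he]
        rw [h5]
        refine Submodule.sum_mem _ fun i _ => ?_
        by_cases h0 : y i j = 0
        · rw [h0, zero_smul]; exact zero_mem _
        · exact Submodule.smul_mem _ _ (rel_of_ne_zero hy h0 k hj)
      exact hle hv

/-- The standard form of seaweed subalgebras of `sl n`. -/
theorem IsSeaweed.exists_standard_form {g : LieSubalgebra ℂ (sl (Fin n) ℂ)} (hg : IsSeaweed g) :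
    ∃ (P Q : Matrix (Fin n) (Fin n) ℂ) (α β : Fin n → ℕ), P * Q = 1 ∧ Q * P = 1 ∧
      (∀ i j, α i < α j → β i ≤ β j) ∧
      ∀ x : sl (Fin n) ℂ, x ∈ g ↔ Q * x.1 * P ∈ supported (seaweedRel Finset.univ α β) := by
  obtain ⟨p, p', ⟨b, hb, hbp⟩, ⟨b', hb', hbp'⟩, htop, rfl⟩ := hg
  obtain ⟨W, N, hW, hWb⟩ := hb.exists_flag
  obtain ⟨W', N', hW', hWb'⟩ := hb'.exists_flag
  obtain ⟨e, he, he'⟩ := exists_adapted_basis (n := n) (by simp) hW hW'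
  set P := (Pi.basisFun ℂ (Fin n)).toMatrix e
  set Q := e.toMatrix (Pi.basisFun ℂ (Fin n))
  have hPQ : P * Q = 1 := Module.Basis.toMatrix_mul_toMatrix_flip _ _
  have hQP : Q * P = 1 := Module.Basis.toMatrix_mul_toMatrix_flip _ _
  have hPe : ∀ j, P.mulVec (Pi.single j 1) = e j := fun j => by
    rw [mulVec_single_one]
    ext i
    simp [P, Module.Basis.toMatrix_apply]
  obtain ⟨R, h1, h2, h3⟩ :=
    exists_total_preorder_of_flagStabilizer_le hW (hWb.trans hbp) hPQ hQP hPe he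
  obtain ⟨R', h1', h2', h3'⟩ :=
    exists_total_preorder_of_flagStabilizer_le hW' (hWb'.trans hbp') hPQ hQP hPe he'
  obtain ⟨α, hα⟩ := exists_rank_of_total_preorder h1 h2
  -- The preorder of `p'` is reversed, so that `β` does not increase along related pairs.
  obtain ⟨β, hβ⟩ := exists_rank_of_total_preorder (R := fun i j => R' j i)
    (fun i j => h1' j i) (fun i j k hij hjk => h2' k j i hjk hij)
  -- A matrix unit is a sum of elements of the two parabolics, one of which must be nonzero at its
  -- position.
  have hor : ∀ i j, R i j ∨ R' i j := by
    intro i j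
    by_cases hij : i = j
    · subst hij
      exact Or.inl ((h1 i i).elim id id)
    let x : sl (Fin n) ℂ := ⟨P * single i j 1 * Q, by
      rw [mem_sl_iff, trace_conj hQP, trace_single_eq_of_ne _ _ _ hij]⟩
    have hx : x ∈ p.toSubmodule ⊔ p'.toSubmodule := htop ▸ Submodule.mem_top
    obtain ⟨a, ha, a', ha', haa⟩ := Submodule.mem_sup.1 hx
    have hxm : Q * a.1 * P + Q * a'.1 * P = single i j 1 := by
      have : a.1 + a'.1 = P * single i j 1 * Q := congrArg Subtype.val haa
      rw [← add_mul, ← mul_add, this, ← mul_assoc, ← mul_assoc, hQP, one_mul, mul_assoc, hQP,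
        mul_one]
    have hij1 : (Q * a.1 * P) i j + (Q * a'.1 * P) i j = 1 := by
      rw [← Matrix.add_apply, hxm, single_apply_same]
    by_cases h0 : (Q * a.1 * P) i j = 0
    · right
      refine rel_of_ne_zero ((h3' a').1 ha') (i := i) (j := j) ?_
      rw [h0, zero_add] at hij1
      rw [hij1]
      exact one_ne_zero
    · exact Or.inl (rel_of_ne_zero ((h3 a).1 ha) h0)
  refine ⟨P, Q, α, β, hPQ, hQP, fun i j hij => ?_, fun x => ?_⟩
  · exact (hβ i j).1 ((hor j i).resolve_left fun h => absurd ((hα j i).1 h) (not_le.2 hij))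
  · rw [LieSubalgebra.mem_inf, h3, h3']
    simp only [mem_supported, seaweedRel, Finset.mem_univ, true_and, ← hα, ← hβ]
    constructor
    · rintro ⟨h, h'⟩ i j hij
      by_cases hR : R i j
      · exact h' i j fun hR' => hij ⟨hR, hR'⟩
      · exact h i j hR
    · exact fun h => ⟨fun i j hij => h i j fun h => hij h.1, fun i j hij => h i j fun h => hij h.2⟩

end StandardForm

/-! ### Between traceless and all supported matrices; the spectrum -/

section Realization

open Matrix

variable {n : ℕ} {L : Type*} [LieRing L] [LieAlgebra ℂ L] [FiniteDimensional ℂ L]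

/-- An isomorphism of a Lie algebra with the traceless matrices supported on `R`. -/
structure IsRealization (R : Fin n → Fin n → Prop) (κ : L →ₗ[ℂ] Matrix (Fin n) (Fin n) ℂ) :
    Prop where
  inj : Function.Injective κ
  bracket : ∀ x y : L, κ ⁅x, y⁆ = κ x * κ y - κ y * κ x
  range : ∀ y, (∃ x, κ x = y) ↔ y.trace = 0 ∧ y ∈ supported R

/-- The projection of a matrix to its traceless part. -/
noncomputable def traceless (y : Matrix (Fin n) (Fin n) ℂ) : Matrix (Fin n) (Fin n) ℂ :=
  y - (y.trace / n) • 1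

lemma trace_traceless [NeZero n] (y : Matrix (Fin n) (Fin n) ℂ) : (traceless y).trace = 0 := by
  rw [traceless, trace_sub, trace_smul, trace_one, Fintype.card_fin, smul_eq_mul,
    div_mul_cancel₀ _ (NeZero.ne (n : ℂ)), sub_self]

lemma traceless_bracket_left (x y : Matrix (Fin n) (Fin n) ℂ) :
    traceless x * y - y * traceless x = x * y - y * x := by
  rw [traceless, sub_mul, mul_sub, Matrix.smul_mul, Matrix.mul_smul, one_mul, mul_one]
  abel

lemma traceless_bracket_right (x y : Matrix (Fin n) (Fin n) ℂ) :
    x * traceless y - traceless y * x = x * y - y * x := by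
  rw [← neg_sub, traceless_bracket_left, neg_sub]

lemma one_mem_supported {R : Fin n → Fin n → Prop} (hR : ∀ i, R i i) :
    (1 : Matrix (Fin n) (Fin n) ℂ) ∈ supported R := mem_supported.2 fun i j hij => by
  rw [one_apply_ne]
  rintro rfl
  exact hij (hR i)

lemma traceless_mem_supported {R : Fin n → Fin n → Prop} (hR : ∀ i, R i i)
    {y : Matrix (Fin n) (Fin n) ℂ} (hy : y ∈ supported R) : traceless y ∈ supported R :=
  sub_mem hy (Submodule.smul_mem _ _ (one_mem_supported hR))

variable {R : Fin n → Fin n → Prop} {κ : L →ₗ[ℂ] Matrix (Fin n) (Fin n) ℂ}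

lemma IsRealization.mem (h : IsRealization R κ) (x : L) : κ x ∈ supported R :=
  ((h.range _).1 ⟨x, rfl⟩).2

lemma IsRealization.exists_traceless [NeZero n] (h : IsRealization R κ) (hR : ∀ i, R i i)
    {y : Matrix (Fin n) (Fin n) ℂ} (hy : y ∈ supported R) : ∃ x, κ x = traceless y :=
  (h.range _).2 ⟨trace_traceless y, traceless_mem_supported hR hy⟩

/-- Brackets do not see scalars, so for any extension of `F` along `κ` the traceless part of a
kernel element is in the kernel for `L`, hence zero. -/
theorem IsRealization.exists_indexOne [NeZero n] (h : IsRealization R κ) (hR : ∀ i, R i i)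
    {F : Module.Dual ℂ L} (hF : IsFrobeniusFunctional F) :
    ∃ F' : Matrix (Fin n) (Fin n) ℂ →ₗ[ℂ] ℂ, IndexOne R F' := by
  obtain ⟨ρ, hρ⟩ := LinearMap.exists_leftInverse_of_injective κ (LinearMap.ker_eq_bot.2 h.inj)
  have hρκ : ∀ x, ρ (κ x) = x := fun x => LinearMap.congr_fun hρ x
  refine ⟨F ∘ₗ ρ, fun x hx hker => ?_⟩
  obtain ⟨u, hu⟩ := h.exists_traceless hR hx
  have hu0 : u = 0 := by
    refine eq_zero_of_isFrobeniusFunctional hF fun z => ?_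
    have h1 := hker _ (h.mem z)
    rwa [LinearMap.comp_apply, ← traceless_bracket_left, ← hu, ← h.bracket, hρκ] at h1
  rw [hu0, map_zero] at hu
  have hx1 : x = (x.trace / n) • 1 := (sub_eq_zero.1 hu.symm)
  refine ⟨fun i j hij => ?_, fun i j _ _ => ?_⟩
  · rw [hx1, Matrix.smul_apply, one_apply_ne hij, smul_zero]
  · rw [hx1]
    simp

/-- Conversely, a kernel element is a scalar matrix of trace zero. -/
theorem IsRealization.isFrobeniusFunctional [NeZero n] (h : IsRealization R κ) (hR : ∀ i, R i i)
    {F : Matrix (Fin n) (Fin n) ℂ →ₗ[ℂ] ℂ} (hF : IndexOne R F) :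
    IsFrobeniusFunctional (F ∘ₗ κ) := by
  refine isFrobeniusFunctional_of_ker fun x hx => ?_
  obtain ⟨h1, h2⟩ := hF _ (h.mem x) fun y hy => by
    obtain ⟨z, hz⟩ := h.exists_traceless hR hy
    rw [← traceless_bracket_right, ← hz, ← h.bracket]
    exact hx z
  have htr := ((h.range _).1 ⟨x, rfl⟩).1
  have h0 : ∀ i, κ x i i = 0 := by
    intro i
    have : (κ x).trace = n * κ x i i := by
      refine (Finset.sum_congr rfl fun j _ => h2 j i (hR j) (hR i)).trans ?_
      simp
    rw [htr] at this
    exact (mul_eq_zero.1 this.symm).resolve_left (NeZero.ne (n : ℂ))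
  refine h.inj ?_
  rw [map_zero]
  ext i j
  by_cases hij : i = j
  · subst hij
    exact h0 i
  · exact h1 i j hij

/-- The eigenvalues of the diagonal principal element. -/
theorem IsRealization.exists_isPrincipalElement (hn : 2 ≤ n) (h : IsRealization R κ)
    (hR : ∀ i, R i i) {F : Matrix (Fin n) (Fin n) ℂ →ₗ[ℂ] ℂ} (hF : IndexOne R F) {d : Fin n → ℤ}
    (hd : IsPrincipalDiagonal R F d) : ∃ x : L, IsPrincipalElement x ∧
      spectrum ℂ (LieAlgebra.ad ℂ L x) = {c | ∃ i j, R i j ∧ ((d i - d j : ℤ) : ℂ) = c} := by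
  have : NeZero n := ⟨by omega⟩
  have hD : diagonal (fun i => (d i : ℂ)) ∈ supported R := mem_supported.2 fun i j hij => by
    rw [diagonal_apply_ne]
    rintro rfl
    exact hij (hR i)
  obtain ⟨x, hx⟩ := h.exists_traceless hR hD
  have hκ : ∀ y i j, κ ⁅x, y⁆ i j = (d i - d j) * κ y i j := fun y i j => by
    rw [h.bracket, hx, traceless_bracket_left, Matrix.sub_apply, diagonal_mul, mul_diagonal]
    ring
  refine ⟨x, ⟨F ∘ₗ κ, h.isFrobeniusFunctional hR hF, LinearMap.ext fun y => ?_⟩, ?_⟩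
  · rw [kirillovForm_apply, LinearMap.comp_apply, LinearMap.comp_apply, h.bracket, hx,
      traceless_bracket_left, hd _ (h.mem y)]
  ext c
  rw [← Module.End.hasEigenvalue_iff_mem_spectrum]
  constructor
  · intro hc
    obtain ⟨y, hy⟩ := hc.exists_hasEigenvector
    have hy1 : ⁅x, y⁆ = c • y := hy.apply_eq_smul
    have hy0 : κ y ≠ 0 := fun h0 => hy.2 (h.inj (h0.trans (map_zero κ).symm))
    obtain ⟨i, j, hij⟩ : ∃ i j, κ y i j ≠ 0 := by
      by_contra hall
      push Not at hall
      exact hy0 (Matrix.ext hall)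
    refine ⟨i, j, rel_of_ne_zero (h.mem y) hij, ?_⟩
    have h1 := hκ y i j
    rw [hy1, map_smul, Matrix.smul_apply, smul_eq_mul] at h1
    push_cast
    exact (mul_right_cancel₀ hij h1).symm
  · rintro ⟨i, j, hij, rfl⟩
    obtain ⟨y, hy⟩ := h.exists_traceless hR (single_mem_supported hij 1)
    refine Module.End.hasEigenvalue_of_hasEigenvector (x := y)
      ⟨Module.End.mem_eigenspace_iff.2 (h.inj ?_), ?_⟩
    · ext k l
      rw [LieAlgebra.ad_apply, hκ, map_smul, Matrix.smul_apply, smul_eq_mul, hy, traceless,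
        Matrix.sub_apply, Matrix.smul_apply]
      by_cases hkl : i = k ∧ j = l
      · rw [hkl.1, hkl.2]
        push_cast
        rfl
      · rw [single_apply, if_neg hkl]
        by_cases hkl' : k = l
        · subst hkl'
          by_cases hij' : i = j
          · subst hij'; simp
          · rw [trace_single_eq_of_ne _ _ _ hij']; simp
        · rw [one_apply_ne hkl']; simp
    -- The traceless part of a matrix unit is nonzero because `2 ≤ n`: a diagonal entry away from
    -- row `i` would force the trace, and then the unit itself, to vanish.
    · rintro rfl
      rw [map_zero, traceless] at hy
      have : Nontrivial (Fin n) := Fin.nontrivial_iff_two_le.2 hn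
      obtain ⟨k, hk⟩ := exists_ne i
      have h1 := congrFun (congrFun hy k) k
      have h2 := congrFun (congrFun hy i) j
      rw [Matrix.sub_apply, single_apply_of_row_ne hk.symm, Matrix.smul_apply, one_apply_eq] at h1
      simp only [Matrix.zero_apply, smul_eq_mul, mul_one, zero_sub] at h1
      rw [Matrix.sub_apply, Matrix.smul_apply, neg_eq_zero.1 h1.symm, zero_smul,
        single_apply_same] at h2
      simp at h2

/-- The differences along the relation fill up an interval. -/
lemma Good.exists_rel_sub_eq {α β : Fin n → ℕ} {d : Fin n → ℤ} (h : Good Finset.univ α β d)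
    (hcom : ∀ i j, α i < α j → β i ≤ β j) {i j : Fin n} (hij : seaweedRel Finset.univ α β i j)
    {k : ℤ} (hk : 1 ≤ k) (hk' : k ≤ d i - d j) :
    ∃ i' j', seaweedRel Finset.univ α β i' j' ∧ d i' - d j' = k := by
  obtain ⟨-, -, h1, h2⟩ := hij
  -- By comonotonicity a related pair shares a block of `α` or a block of `β`.
  rcases h1.eq_or_lt with h3 | h3
  · obtain ⟨i', hi', j', hj', h4, h5, h6, h7⟩ :=
      h.left.diff i (Finset.mem_univ i) j (Finset.mem_univ j) h3 k hk hk'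
    exact ⟨i', j', ⟨hi', hj', (h4.trans h5.symm).le, h6⟩, h7⟩
  · obtain ⟨i', hi', j', hj', h4, h5, h6, h7⟩ :=
      h.right.diff j (Finset.mem_univ j) i (Finset.mem_univ i) (h2.antisymm (hcom i j h3)) k hk
        (by linarith)
    exact ⟨j', i', ⟨hj', hi', h6, (h4.trans h5.symm).le⟩, by linarith⟩

theorem spectrum_of_realization (hn : 2 ≤ n) {α β : Fin n → ℕ}
    (hcom : ∀ i j, α i < α j → β i ≤ β j) (h : IsRealization (seaweedRel Finset.univ α β) κ)
    (hF : IsFrobenius L) : ∃ m : ℕ, 1 ≤ m ∧ ∀ x : L, IsPrincipalElement x →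
      spectrum ℂ (LieAlgebra.ad ℂ L x) =
        (fun k : ℤ => (k : ℂ)) '' Set.Icc (1 - (m : ℤ)) (m : ℤ) := by
  have : NeZero n := ⟨by omega⟩
  have hR : ∀ i, seaweedRel Finset.univ α β i i := fun i =>
    ⟨Finset.mem_univ i, Finset.mem_univ i, le_rfl, le_rfl⟩
  obtain ⟨F, hF⟩ := exists_isFrobeniusFunctional hF
  obtain ⟨F', d, hF', hd, hgood⟩ := exists_good n Finset.univ α β (by simp) Finset.univ_nonempty
    (fun i _ j _ => hcom i j) (h.exists_indexOne hR hF)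
  obtain ⟨x₀, hx₀, hspec⟩ := h.exists_isPrincipalElement hn hR hF' hd
  let S : Set ℤ := {k | ∃ i j, seaweedRel Finset.univ α β i j ∧ d i - d j = k}
  have hS : spectrum ℂ (LieAlgebra.ad ℂ L x₀) = (fun k : ℤ => (k : ℂ)) '' S := by
    rw [hspec]
    ext c
    constructor
    · rintro ⟨i, j, hij, rfl⟩
      exact ⟨_, ⟨i, j, hij, rfl⟩, rfl⟩
    · rintro ⟨_, ⟨i, j, hij, rfl⟩, rfl⟩
      exact ⟨i, j, hij, rfl⟩
  have hmem : ∀ k : ℤ, k ∈ S ↔ Module.finrank ℂ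
      (Module.End.eigenspace (LieAlgebra.ad ℂ L x₀) (k : ℂ)) ≠ 0 := by
    intro k
    rw [Ne, Submodule.finrank_eq_zero, ← Ne, ← Module.End.hasEigenvalue_iff,
      Module.End.hasEigenvalue_iff_mem_spectrum, hS, Set.mem_image]
    simp
  have hsymm : ∀ k ∈ S, 1 - k ∈ S := by
    intro k hk
    rw [hmem] at hk ⊢
    rw [finrank_eigenspace_symm hx₀] at hk
    rwa [Int.cast_sub, Int.cast_one]
  have hfin : S.Finite := by
    refine (Set.finite_range fun q : Fin n × Fin n => d q.1 - d q.2).subset ?_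
    rintro _ ⟨i, j, -, rfl⟩
    exact ⟨(i, j), rfl⟩
  -- The diagonal contributes 0 and the symmetry then 1, so the maximum is at least 1.
  have h0 : (0 : ℤ) ∈ S := ⟨0, 0, hR 0, sub_self _⟩
  have h1 : (1 : ℤ) ∈ S := by simpa using hsymm 0 h0
  obtain ⟨M, hM, hmax⟩ := hfin.exists_maximal ⟨0, h0⟩
  have hle : ∀ k ∈ S, k ≤ M := fun k hk => (le_total k M).elim id fun hMk => hmax hk hMk
  have hfill : ∀ k, 1 ≤ k → k ≤ M → k ∈ S := by
    intro k hk hkM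
    obtain ⟨i, j, hij, rfl⟩ := hM
    exact hgood.exists_rel_sub_eq hcom hij hk hkM
  have hM1 := hle 1 h1
  have hSM : S = Set.Icc (1 - M) M := by
    ext k
    constructor
    · intro hk
      have := hle _ (hsymm k hk)
      exact ⟨by linarith, hle k hk⟩
    · rintro ⟨hk, hk'⟩
      rcases le_or_gt 1 k with h2 | h2
      · exact hfill k h2 hk'
      · have := hsymm _ (hfill (1 - k) (by omega) (by omega))
        rwa [sub_sub_cancel] at this
  lift M to ℕ using by omega
  refine ⟨M, by exact_mod_cast hM1, fun x hx => ?_⟩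
  rw [spectrum_ad_eq hx hx₀, hS, hSM]

end Realization

end Seaweed

/-! ### Conclusion, by conjugation into standard form -/

theorem theorem1 (n : ℕ) (hn : 2 ≤ n)
    (g : LieSubalgebra ℂ (LieAlgebra.SpecialLinear.sl (Fin n) ℂ))
    (hg : Seaweed.IsSeaweed g) (hF : Seaweed.IsFrobenius g) :
    ∃ m : ℕ, 1 ≤ m ∧ ∀ x : g, Seaweed.IsPrincipalElement x →
      spectrum ℂ (LieAlgebra.ad ℂ g x) =
        (fun k : ℤ => (k : ℂ)) '' Set.Icc (1 - (m : ℤ)) (m : ℤ) ∧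
      ∀ k : ℤ,
        Module.finrank ℂ (Module.End.eigenspace (LieAlgebra.ad ℂ g x) (k : ℂ)) =
          Module.finrank ℂ (Module.End.eigenspace (LieAlgebra.ad ℂ g x) ((1 - k : ℤ) : ℂ)) := by
  obtain ⟨P, Q, α, β, hPQ, hQP, hcom, hmem⟩ := hg.exists_standard_form
  have hconj : ∀ x : Matrix (Fin n) (Fin n) ℂ, P * (Q * x * P) * Q = x := fun x => by
    rw [← mul_assoc, ← mul_assoc, hPQ, one_mul, mul_assoc, hPQ, mul_one]
  have hconj' : ∀ x : Matrix (Fin n) (Fin n) ℂ, Q * (P * x * Q) * P = x := fun x => by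
    rw [← mul_assoc, ← mul_assoc, hQP, one_mul, mul_assoc, hQP, mul_one]
  let κ : g →ₗ[ℂ] Matrix (Fin n) (Fin n) ℂ :=
    { toFun := fun x => Q * x.1.1 * P
      map_add' := fun x y => by
        change Q * (x.1.1 + y.1.1) * P = _
        rw [mul_add, add_mul]
      map_smul' := fun c x => by
        change Q * (c • x.1.1) * P = c • (Q * x.1.1 * P)
        rw [Matrix.mul_smul, Matrix.smul_mul] }
  have hκ : Seaweed.IsRealization (Seaweed.seaweedRel Finset.univ α β) κ := by
    refine ⟨fun x y hxy => ?_, fun x y => ?_, fun y => ⟨?_, fun hy => ?_⟩⟩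
    · have h1 : Q * x.1.1 * P = Q * y.1.1 * P := hxy
      refine Subtype.ext (Subtype.ext ?_)
      rw [← hconj x.1.1, h1, hconj]
    · change Q * (x.1.1 * y.1.1 - y.1.1 * x.1.1) * P =
        Q * x.1.1 * P * (Q * y.1.1 * P) - Q * y.1.1 * P * (Q * x.1.1 * P)
      have h2 : ∀ u v : Matrix (Fin n) (Fin n) ℂ, Q * u * P * (Q * v * P) = Q * (u * v) * P :=
        fun u v => by
          rw [mul_assoc (Q * u), ← mul_assoc P, ← mul_assoc P, hPQ, one_mul]
          simp only [mul_assoc]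
      rw [h2, h2, mul_sub, sub_mul]
    · rintro ⟨x, rfl⟩
      exact ⟨(Seaweed.trace_conj hPQ _).trans x.1.2, (hmem x.1).1 x.2⟩
    · have h3 : P * y * Q ∈ LieAlgebra.SpecialLinear.sl (Fin n) ℂ := by
        rw [Seaweed.mem_sl_iff, Seaweed.trace_conj hQP, hy.1]
      exact ⟨⟨⟨P * y * Q, h3⟩, (hmem _).2 ((hconj' y).symm ▸ hy.2)⟩, hconj' y⟩
  obtain ⟨m, hm, hspec⟩ := Seaweed.spectrum_of_realization hn hcom hκ hF
  refine ⟨m, hm, fun x hx => ⟨hspec x hx, fun k => ?_⟩⟩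
  rw [Seaweed.finrank_eigenspace_symm hx, Int.cast_sub, Int.cast_one]
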